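/- **Definitions.** A *trace* is a finite sequence of $\mathcal N$ events; each event is performed by a thread and reads or writes a variable, or acquires or releases a lock. Traces are well-formed: for every lock $\ell$, the subsequence of its acquire and release events is a prefix of a sequence of pairs $\langle t,\mathrm{acq}(\ell)\rangle\langle t,\mathrm{rel}(\ell)\rangle$. The *happens-before* order (HB) is the smallest partial order on the events in which $e$ is below $f$ whenever $e$ precedes $f$ in the trace and either both belong to the same thread, or $e$ is a release and $f$ an acquire of the same lock. An *HB race* is a pair of HB-incomparable events of different threads that access the same variable, at least one of them writing. *HB race detection* is the problem to decide whether a given trace has an HB race. Its size parameter is $\mathcal N$, and threads, variables and locks are named by natural numbers below $\mathcal N^{c}$ (words of $O(\log \mathcal N)$ bits), for an arbitrary fixed $c\in\mathbb N$. Algorithms are programs for random access machines with logarithmic cost (an operation costs the total bit length of the numbers and addresses it handles); nondeterministic programs may also guess numbers. A problem is in $\mathrm{NTIME}(T)$ if some nondeterministic program has an accepting run exactly on the yes-instances, and on each of these has one of cost $O(T)$. $k$-SAT and $k$-TAUT are satisfiability of $k$-CNF formulas and validity of $k$-DNF formulas (at most $k$ literals per clause or term, no clause or term repeated), where $n$ is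 the number of variables. *NSETH* states: for every $\epsilon>0$ there is a $k$ such that $k$-TAUT is not in $\mathrm{NTIME}(2^{n(1-\epsilon)})$. For $a,b:\mathbb N\to\mathbb R_{\ge 0}$, an $(a,b)$-*fine-grained reduction* from SAT to a problem $B$ consists of the following: for every $\epsilon>0$ there is a $\delta>0$ such that for every $k$ there is a deterministic algorithm with an oracle for $B$ that decides $k$-SAT and on every $k$-CNF formula with $n$ variables runs in time $O(a(n)^{1-\delta})$ and makes oracle calls on instances of $B$ of sizes $n_1,\dots,n_q$ with $\sum_{i=1}^{q} b(n_i)^{1-\epsilon}=O(a(n)^{1-\delta})$. (The algorithm and the implied constants may depend on $\epsilon$ and $k$, whereas $\delta$ depends on $\epsilon$ only; in particular, a single algorithm for CNF-SAT may be used for all $k$.) **Theorem.** Assume NSETH. Then for every $\epsilon>0$ (and every $c$) there is no $(2^{n},\mathcal N^{3/2+\epsilon})$-fine-grained reduction from SAT to HB race detection, where $n$ is the number of variables of the formula and $\mathcal N$ the number of events of the trace. -/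

import Mathlib

namespace FGC

/-! ### Random access machines with logarithmic cost

Programs are finite; the store consists of registers and arrays, both named by natural numbers and
holding natural numbers. -/

/-- Arithmetic operations on natural numbers (truncated subtraction, rounded division). -/
inductive BinOp where
  | add | sub | mul | div

def BinOp.eval : BinOp → ℕ → ℕ → ℕ
  | .add, a, b => a + b
  | .sub, a, b => a - b
  | .mul, a, b => a * b
  | .div, a, b => a / b

/-- Memory contents: `reg x` is register `x`, and `mem A i` is cell `i` of array `A`. -/
structure Store where
  reg : ℕ → ℕ
  mem : ℕ → ℕ → ℕ

inductive Expr where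
  | const (v : ℕ)
  | reg (x : ℕ)
  | get (A : ℕ) (e : Expr)
  | op (o : BinOp) (e₁ e₂ : Expr)

/-- The cost of handling a word: the length of its binary representation. -/
def wordCost (v : ℕ) : ℕ := Nat.log 2 v + 1

def Expr.eval (s : Store) : Expr → ℕ
  | .const v => v
  | .reg x => s.reg x
  | .get A e => s.mem A (e.eval s)
  | .op o e₁ e₂ => o.eval (e₁.eval s) (e₂.eval s)

/-- The cost of evaluating an expression: the total length of all values that occur in the
evaluation, including the addresses of the cells that are read. -/
def Expr.cost (s : Store) : Expr → ℕ
  | .const v => wordCost v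
  | .reg x => wordCost (s.reg x)
  | .get A e => e.cost s + wordCost (s.mem A (e.eval s))
  | .op o e₁ e₂ => e₁.cost s + e₂.cost s + wordCost (o.eval (e₁.eval s) (e₂.eval s))

/-- Programs. -/
inductive Cmd where
  | skip
  /-- `x := e` -/
  | assign (x : ℕ) (e : Expr)
  /-- `A[i] := e` -/
  | store (A : ℕ) (i e : Expr)
  /-- nondeterministically assign a number to register `x` -/
  | guess (x : ℕ)
  /-- ask the oracle about the word `A[0], …, A[len - 1]`;
  register `x` receives `1` if the answer is yes, and `0` otherwise -/
  | query (x : ℕ) (A : ℕ) (len : Expr)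
  | seq (p q : Cmd)
  /-- execute `p` if the value of `e` is nonzero, and `q` otherwise -/
  | ite (e : Expr) (p q : Cmd)
  /-- repeat `p` as long as the value of `e` is nonzero -/
  | loop (e : Expr) (p : Cmd)

/-- A program is deterministic if it never guesses. -/
def Cmd.Deterministic : Cmd → Prop
  | .guess _ => False
  | .seq p q => p.Deterministic ∧ q.Deterministic
  | .ite _ p q => p.Deterministic ∧ q.Deterministic
  | .loop _ p => p.Deterministic
  | _ => True

def Cmd.OracleFree : Cmd → Prop
  | .query _ _ _ => False
  | .seq p q => p.OracleFree ∧ q.OracleFree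
  | .ite _ p q => p.OracleFree ∧ q.OracleFree
  | .loop _ p => p.OracleFree
  | _ => True

def Store.setReg (s : Store) (x v : ℕ) : Store :=
  { s with reg := Function.update s.reg x v }

def Store.setMem (s : Store) (A i v : ℕ) : Store :=
  { s with mem := Function.update s.mem A (Function.update (s.mem A) i v) }

/-- The word stored in the first `n` cells of array `A`. -/
def Store.word (s : Store) (A n : ℕ) : List ℕ := (List.range n).map (s.mem A)

/-- `Run O p s s' t qs`: with oracle `O`, the program `p` has a terminating run from the store `s`
to the store `s'` of cost `t`, along which the oracle is asked, in this order, about the words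
in `qs`. -/
inductive Run (O : List ℕ → Prop) : Cmd → Store → Store → ℕ → List (List ℕ) → Prop where
  | skip (s : Store) : Run O .skip s s 1 []
  | assign (s : Store) (x : ℕ) (e : Expr) :
      Run O (.assign x e) s (s.setReg x (e.eval s)) (e.cost s + 1) []
  | store (s : Store) (A : ℕ) (i e : Expr) :
      Run O (.store A i e) s (s.setMem A (i.eval s) (e.eval s)) (i.cost s + e.cost s + 1) []
  | guess (s : Store) (x v : ℕ) :
      Run O (.guess x) s (s.setReg x v) (wordCost v + 1) []
  | query_yes (s : Store) (x A : ℕ) (len : Expr) (h : O (s.word A (len.eval s))) :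
      Run O (.query x A len) s (s.setReg x 1) (len.cost s + 1) [s.word A (len.eval s)]
  | query_no (s : Store) (x A : ℕ) (len : Expr) (h : ¬ O (s.word A (len.eval s))) :
      Run O (.query x A len) s (s.setReg x 0) (len.cost s + 1) [s.word A (len.eval s)]
  | seq {p q : Cmd} {s s' s'' : Store} {t t' : ℕ} {qs qs' : List (List ℕ)}
      (hp : Run O p s s' t qs) (hq : Run O q s' s'' t' qs') :
      Run O (.seq p q) s s'' (t + t') (qs ++ qs')
  | ite_true {e : Expr} {p q : Cmd} {s s' : Store} {t : ℕ} {qs : List (List ℕ)}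
      (he : e.eval s ≠ 0) (hp : Run O p s s' t qs) :
      Run O (.ite e p q) s s' (e.cost s + 1 + t) qs
  | ite_false {e : Expr} {p q : Cmd} {s s' : Store} {t : ℕ} {qs : List (List ℕ)}
      (he : e.eval s = 0) (hq : Run O q s s' t qs) :
      Run O (.ite e p q) s s' (e.cost s + 1 + t) qs
  | loop_true {e : Expr} {p : Cmd} {s s' s'' : Store} {t t' : ℕ} {qs qs' : List (List ℕ)}
      (he : e.eval s ≠ 0) (hp : Run O p s s' t qs) (hl : Run O (.loop e p) s' s'' t' qs') :
      Run O (.loop e p) s s'' (e.cost s + 1 + t + t') (qs ++ qs')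
  | loop_false {e : Expr} {p : Cmd} {s : Store} (he : e.eval s = 0) :
      Run O (.loop e p) s s (e.cost s + 1) []

/-- The initial store on input `w`: array `0` holds `w`, register `0` holds the length of `w`, and
everything else is `0`. -/
def initStore (w : List ℕ) : Store where
  reg x := if x = 0 then w.length else 0
  mem A i := if A = 0 then w.getD i 0 else 0

/-- A terminating run accepts if register `0` is nonzero at its end. -/
def Store.Accepting (s : Store) : Prop := s.reg 0 ≠ 0

/-! ### Decision problems, nondeterministic time, fine-grained reductions -/

/-- A decision problem: its instances, their encoding as words, the parameter in which running times
are measured, and the set of yes-instances. -/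
structure Problem where
  Inst : Type
  encode : Inst → List ℕ
  size : Inst → ℕ
  Yes : Inst → Prop

/-- `P ∈ NTIME(O(T))`: some nondeterministic program has an accepting run exactly on the
yes-instances, and on each of these it has an accepting run of cost `O(T)`. -/
def NTime (P : Problem) (T : ℕ → ℝ) : Prop :=
  ∃ M : Cmd, M.OracleFree ∧ ∃ C : ℝ, ∀ x : P.Inst,
    (P.Yes x → ∃ s t qs, Run (fun _ => False) M (initStore (P.encode x)) s t qs ∧
      s.Accepting ∧ (t : ℝ) ≤ C * T (P.size x)) ∧
    (¬ P.Yes x → ¬ ∃ s t qs, Run (fun _ => False) M (initStore (P.encode x)) s t qs ∧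
      s.Accepting)

/-- The oracle for `P`. -/
def Problem.oracle (P : Problem) (w : List ℕ) : Prop := ∃ y : P.Inst, P.encode y = w ∧ P.Yes y

/-- The deterministic oracle program `R` decides `A`, asking the oracle for `B` only about instances
`y₁, …, y_q` of `B`; on instances of size `n`, both its running time and `∑ i, f (size yᵢ)` are at
most `C * g n`. -/
def TuringReduction (A B : Problem) (R : Cmd) (C : ℝ) (f g : ℕ → ℝ) : Prop :=
  R.Deterministic ∧ ∀ x : A.Inst, ∃ (s : Store) (t : ℕ) (ys : List B.Inst),
    Run B.oracle R (initStore (A.encode x)) s t (ys.map B.encode) ∧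
    (s.Accepting ↔ A.Yes x) ∧
    (t : ℝ) ≤ C * g (A.size x) ∧
    (ys.map fun y => f (B.size y)).sum ≤ C * g (A.size x)

/-- An `(a, b)`-fine-grained reduction to `B` from a problem that is given as a family of
subproblems `A k` (as SAT is given by `k`-SAT for all `k`). The saving `δ` may not depend on `k`;
the algorithm and the implied constant may. -/
def FineGrainedReduces {ι : Type} (A : ι → Problem) (a : ℕ → ℝ) (B : Problem) (b : ℕ → ℝ) :
    Prop :=
  ∀ ε : ℝ, 0 < ε → ∃ δ : ℝ, 0 < δ ∧ ∀ k : ι, ∃ (R : Cmd) (C : ℝ),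
    TuringReduction (A k) B R C (fun m => b m ^ (1 - ε)) (fun n => a n ^ (1 - δ))

/-! ### Satisfiability, tautologies, and NSETH -/

/-- A set of clauses (or terms) of at most `k` literals over `n` variables, listed without
repetition. The literal `(i, true)` is the `i`-th variable, `(i, false)` is its negation. -/
structure KFormula (k : ℕ) where
  n : ℕ
  parts : List (List (Fin n × Bool))
  nodup : parts.Nodup
  width : ∀ c ∈ parts, c.length ≤ k

/-- The encoding consists of the number of variables, the number of clauses, and each clause,
preceded by its length; the literals of the `i`-th variable are coded as `2 * i + 1` (positive)
and `2 * i` (negative). -/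
def KFormula.encode {k : ℕ} (φ : KFormula k) : List ℕ :=
  φ.n :: φ.parts.length ::
    φ.parts.flatMap fun c => c.length :: c.map fun l => 2 * (l.1 : ℕ) + l.2.toNat

/-- `k`-SAT: the formula is read as a conjunction of clauses. -/
def kSAT (k : ℕ) : Problem where
  Inst := KFormula k
  encode := KFormula.encode
  size φ := φ.n
  Yes φ := ∃ v : Fin φ.n → Bool, ∀ c ∈ φ.parts, ∃ l ∈ c, v l.1 = l.2

/-- `k`-TAUT: the formula is read as a disjunction of conjunctive terms. -/
def kTAUT (k : ℕ) : Problem where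
  Inst := KFormula k
  encode := KFormula.encode
  size φ := φ.n
  Yes φ := ∀ v : Fin φ.n → Bool, ∃ c ∈ φ.parts, ∀ l ∈ c, v l.1 = l.2

/-- The nondeterministic strong exponential time hypothesis. -/
def NSETH : Prop :=
  ∀ ε : ℝ, 0 < ε → ∃ k : ℕ, ¬ NTime (kTAUT k) fun n => (2 : ℝ) ^ ((n : ℝ) * (1 - ε))

/-! ### Traces and happens-before races -/

/-- Operations: read or write of a variable, acquire or release of a lock. -/
inductive Operation where
  | read (x : ℕ)
  | write (x : ℕ)
  | acq (l : ℕ)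
  | rel (l : ℕ)

structure Event where
  thread : ℕ
  op : Operation

/-- `op` is an acquire or a release of the lock `l`. -/
def Operation.OnLock (l : ℕ) (op : Operation) : Prop := op = .acq l ∨ op = .rel l

/-- `op` accesses the variable `x`. -/
def Operation.Accesses (x : ℕ) (op : Operation) : Prop := op = .read x ∨ op = .write x

open Classical in
/-- Critical sections on the same lock do not overlap: for every lock `l`, the subsequence of the
acquire and release events of `l` is a prefix of a sequence of matching pairs
`⟨t, acq l⟩ ⟨t, rel l⟩`. -/
def WellFormed (σ : List Event) : Prop :=
  ∀ l : ℕ, ∃ ts : List ℕ,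
    σ.filter (fun e => e.op.OnLock l) <+: ts.flatMap fun t => [⟨t, .acq l⟩, ⟨t, .rel l⟩]

/-- The pairs of positions that generate the happens-before order: thread order, and a release of a
lock before a later acquire of the same lock. -/
def HBStep (σ : List Event) (i j : Fin σ.length) : Prop :=
  i < j ∧ ((σ.get i).thread = (σ.get j).thread ∨
    ∃ l, (σ.get i).op = .rel l ∧ (σ.get j).op = .acq l)

/-- The happens-before order. As `HBStep` only leads to later positions, its reflexive transitive
closure is antisymmetric, hence the smallest partial order that contains `HBStep`. -/
def HB (σ : List Event) : Fin σ.length → Fin σ.length → Prop :=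
  Relation.ReflTransGen (HBStep σ)

def Conflicting (σ : List Event) (i j : Fin σ.length) : Prop :=
  (σ.get i).thread ≠ (σ.get j).thread ∧
  ∃ x, (σ.get i).op.Accesses x ∧ (σ.get j).op.Accesses x ∧
    ((σ.get i).op = .write x ∨ (σ.get j).op = .write x)

def HasHBRace (σ : List Event) : Prop :=
  ∃ i j, Conflicting σ i j ∧ ¬ HB σ i j ∧ ¬ HB σ j i

def Operation.code : Operation → ℕ
  | .read _ => 0
  | .write _ => 1
  | .acq _ => 2
  | .rel _ => 3

/-- The name of the variable or lock on which the operation acts. -/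
def Operation.name : Operation → ℕ
  | .read x => x
  | .write x => x
  | .acq l => l
  | .rel l => l

/-- Detecting whether a trace has an HB race. The size of a trace is its number `N` of events, and
its threads, variables and locks are named by numbers below `N ^ c`, that is, by words of `O(log N)`
bits. -/
def hbRaceProblem (c : ℕ) : Problem where
  Inst := {σ : List Event // WellFormed σ ∧
    ∀ e ∈ σ, e.thread < σ.length ^ c ∧ e.op.name < σ.length ^ c}
  encode σ := σ.1.flatMap fun e => [e.thread, e.op.code, e.op.name]
  size σ := σ.1.length
  Yes σ := HasHBRace σ.1

end FGC

/-!
The proof turns a hypothetical reduction into a nondeterministic algorithm for `k`-TAUT that NSETH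
excludes. Two facts make this work.

A formula, read as a disjunction of terms, is a tautology exactly if the same formula, read as a
conjunction of clauses, is unsatisfiable (`kTAUT_yes_iff`). Hence it suffices to run the reduction
from `k`-SAT and to reverse its answer, provided that the oracle can be dispensed with.

Both answers to an instance of race detection have certificates that can be verified in time
`N ^ (3 / 2 + o(1))`. A race is certified by its two events and a linear-time computation of all
that is reachable from the first one (`sweep`, `findRace`). The absence of races amounts to `O(N)`
reachabilities: each access of a variable has to be ordered after the last write before it, and
each read before the next write after it (`VisitInv`). A reachability that has a path of at most
`√N` steps is certified by the path. The other paths have their first `√N` positions hit by a set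
of `O(√N log N)` hubs (`exists_hitting`, `Table.exists_cert`); after one sweep per hub, they are
certified by the initial part that leads to a hub (`check`, `certify`).

A query is therefore replaced by a program that guesses the answer and verifies a guessed
certificate (`simQuery`); a wrong guess leads to a run that does not terminate, and so cannot
accept. Since the reduction is deterministic, the terminating runs of the translated program follow
the run of the reduction (`Run.unquery`, `Run.unquery_sound`), and the cost of the verification is
absorbed by the gap between the exponents `3 / 2` and `3 / 2 + ε` (`simCost_le`).

Programs are analyzed with two predicates: `Wlp`, which speaks about all terminating runs (so that
wrong guesses are harmless), and `Can`, which asserts that some run is correct and cheap.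
-/

namespace FGC

/-! ### Stores and expressions -/

@[simp] theorem Store.setReg_reg (s : Store) (x v y : ℕ) :
    (s.setReg x v).reg y = if y = x then v else s.reg y := by
  simp [Store.setReg, Function.update_apply]

@[simp] theorem Store.setReg_mem (s : Store) (x v : ℕ) : (s.setReg x v).mem = s.mem := rfl

@[simp] theorem Store.setMem_reg (s : Store) (A i v : ℕ) : (s.setMem A i v).reg = s.reg := rfl

@[simp] theorem Store.setMem_mem (s : Store) (A i v B j : ℕ) :
    (s.setMem A i v).mem B j = if B = A ∧ j = i then v else s.mem B j := by
  by_cases h : B = A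
  · subst h; simp [Store.setMem, Function.update_apply]
  · simp [Store.setMem, h]

/-- All constants, register contents and cell contents that occur as leaves in the evaluation of the
expression are at most `U`. -/
def Expr.Bdd (U : ℕ) (s : Store) : Expr → Prop
  | .const v => v ≤ U
  | .reg x => s.reg x ≤ U
  | .get A e => e.Bdd U s ∧ s.mem A (e.eval s) ≤ U
  | .op _ e₁ e₂ => e₁.Bdd U s ∧ e₂.Bdd U s

/-- The number of leaves that contribute to the size of the value. -/
def Expr.leaves : Expr → ℕ
  | .const _ => 1
  | .reg _ => 1
  | .get _ _ => 1
  | .op _ e₁ e₂ => e₁.leaves + e₂.leaves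

/-- The cost of an expression, in units of the word length of a bound for its leaves. -/
def Expr.weight : Expr → ℕ
  | .const _ => 1
  | .reg _ => 1
  | .get _ e => e.weight + 1
  | .op _ e₁ e₂ => e₁.weight + e₂.weight + (e₁.leaves + e₂.leaves)

theorem Expr.leaves_pos : ∀ e : Expr, 1 ≤ e.leaves
  | .const _ => le_rfl
  | .reg _ => le_rfl
  | .get _ _ => le_rfl
  | .op _ e₁ e₂ => le_trans e₁.leaves_pos (Nat.le_add_right _ e₂.leaves)

theorem one_le_wordCost (v : ℕ) : 1 ≤ wordCost v := Nat.le_add_left _ _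

theorem wordCost_mono {u v : ℕ} (h : u ≤ v) : wordCost u ≤ wordCost v :=
  Nat.add_le_add_right (Nat.log_mono_right h) 1

theorem wordCost_pow (U l : ℕ) (hl : 1 ≤ l) : wordCost (U ^ l) ≤ l * wordCost U := by
  unfold wordCost
  have h2 : U < 2 ^ (Nat.log 2 U + 1) := Nat.lt_pow_succ_log_self (by norm_num) U
  have h3 : U ^ l < 2 ^ (l * (Nat.log 2 U + 1)) := by
    calc U ^ l < (2 ^ (Nat.log 2 U + 1)) ^ l := Nat.pow_lt_pow_left h2 (by omega)
      _ = _ := by rw [← pow_mul, mul_comm]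
  exact Nat.log_lt_of_lt_pow' (by positivity) h3

theorem Expr.Bdd.eval_le {U : ℕ} (hU : 2 ≤ U) {s : Store} :
    ∀ {e : Expr}, e.Bdd U s → e.eval s ≤ U ^ e.leaves
  | .const _, h => by simpa [Expr.leaves, Expr.eval, Expr.Bdd] using h
  | .reg _, h => by simpa [Expr.leaves, Expr.eval, Expr.Bdd] using h
  | .get _ _, h => by simpa [Expr.leaves, Expr.eval] using h.2
  | .op o e₁ e₂, h => by
    have h1 := h.1.eval_le hU
    have h2 := h.2.eval_le hU
    have p1 : 2 ≤ U ^ e₁.leaves := le_trans hU (Nat.le_self_pow (by have := e₁.leaves_pos; omega) U)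
    have p2 : 2 ≤ U ^ e₂.leaves := le_trans hU (Nat.le_self_pow (by have := e₂.leaves_pos; omega) U)
    simp only [Expr.leaves, Expr.eval, pow_add]
    generalize e₁.eval s = a at *
    generalize e₂.eval s = b at *
    generalize U ^ e₁.leaves = p at *
    generalize U ^ e₂.leaves = q at *
    have hp : p ≤ p * q := Nat.le_mul_of_pos_right _ (by omega)
    cases o <;> simp only [BinOp.eval]
    · nlinarith
    · omega
    · exact Nat.mul_le_mul h1 h2
    · exact le_trans (Nat.div_le_self _ _) (by omega)

theorem Expr.Bdd.cost_le {U : ℕ} (hU : 2 ≤ U) {s : Store} :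
    ∀ {e : Expr}, e.Bdd U s → e.cost s ≤ e.weight * wordCost U
  | .const _, h => by simpa [Expr.weight, Expr.cost] using wordCost_mono h
  | .reg _, h => by simpa [Expr.weight, Expr.cost] using wordCost_mono h
  | .get _ _, h => by
    have h1 := h.1.cost_le hU
    have h2 := wordCost_mono h.2
    simp only [Expr.weight, Expr.cost, add_mul]
    omega
  | .op o e₁ e₂, h => by
    have h1 := h.1.cost_le hU
    have h2 := h.2.cost_le hU
    have h3 := wordCost_mono (Expr.Bdd.eval_le hU (e := .op o e₁ e₂) h)
    have h4 := wordCost_pow U (Expr.leaves (.op o e₁ e₂)) (Expr.leaves_pos _)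
    simp only [Expr.weight, Expr.cost, Expr.leaves, Expr.eval, add_mul] at *
    omega

/-! ### Partial correctness and bounded runs of oracle-free programs -/

/-- Every terminating run of `p` from `s` ends in a store that satisfies `Q`. -/
def Wlp (p : Cmd) (s : Store) (Q : Store → Prop) : Prop :=
  ∀ s' t qs, Run (fun _ => False) p s s' t qs → Q s'

/-- Some run of `p` from `s` has cost at most `n` words of the length of `U` and ends in a store
that satisfies `Q`. -/
def Can (U : ℕ) (p : Cmd) (s : Store) (n : ℕ) (Q : Store → Prop) : Prop :=
  ∃ s' t, Run (fun _ => False) p s s' t [] ∧ t ≤ n * wordCost U ∧ Q s'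

/-- The registers to which a program may write. -/
def Cmd.WritesReg (y : ℕ) : Cmd → Prop
  | .skip => False
  | .assign x _ => x = y
  | .store _ _ _ => False
  | .guess x => x = y
  | .query x _ _ => x = y
  | .seq p q => p.WritesReg y ∨ q.WritesReg y
  | .ite _ p q => p.WritesReg y ∨ q.WritesReg y
  | .loop _ p => p.WritesReg y

/-- The arrays to which a program may write. -/
def Cmd.WritesMem (B : ℕ) : Cmd → Prop
  | .store A _ _ => A = B
  | .seq p q => p.WritesMem B ∨ q.WritesMem B
  | .ite _ p q => p.WritesMem B ∨ q.WritesMem B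
  | .loop _ p => p.WritesMem B
  | _ => False

/-- The stores agree outside the registers and arrays to which `p` may write. -/
def Frame (p : Cmd) (s s' : Store) : Prop :=
  (∀ y, ¬ p.WritesReg y → s'.reg y = s.reg y) ∧ (∀ B, ¬ p.WritesMem B → s'.mem B = s.mem B)

theorem Run.frame {O : List ℕ → Prop} {p : Cmd} {s s' : Store} {t : ℕ} {qs : List (List ℕ)}
    (h : Run O p s s' t qs) : Frame p s s' := by
  induction h with
  | skip => exact ⟨fun _ _ => rfl, fun _ _ => rfl⟩
  | assign s x e =>
    refine ⟨fun y hy => ?_, fun _ _ => rfl⟩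
    simp [Cmd.WritesReg] at hy
    simp [Ne.symm hy]
  | store s A i e =>
    refine ⟨fun _ _ => rfl, fun B hB => ?_⟩
    simp [Cmd.WritesMem] at hB
    funext j
    simp [Ne.symm hB]
  | guess s x v =>
    refine ⟨fun y hy => ?_, fun _ _ => rfl⟩
    simp [Cmd.WritesReg] at hy
    simp [Ne.symm hy]
  | query_yes s x A len h =>
    refine ⟨fun y hy => ?_, fun _ _ => rfl⟩
    simp [Cmd.WritesReg] at hy
    simp [Ne.symm hy]
  | query_no s x A len h =>
    refine ⟨fun y hy => ?_, fun _ _ => rfl⟩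
    simp [Cmd.WritesReg] at hy
    simp [Ne.symm hy]
  | seq _ _ ih1 ih2 =>
    refine ⟨fun y hy => ?_, fun B hB => ?_⟩
    · simp only [Cmd.WritesReg, not_or] at hy
      rw [ih2.1 y hy.2, ih1.1 y hy.1]
    · simp only [Cmd.WritesMem, not_or] at hB
      rw [ih2.2 B hB.2, ih1.2 B hB.1]
  | ite_true _ _ ih =>
    refine ⟨fun y hy => ?_, fun B hB => ?_⟩
    · simp only [Cmd.WritesReg, not_or] at hy
      exact ih.1 y hy.1
    · simp only [Cmd.WritesMem, not_or] at hB
      exact ih.2 B hB.1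
  | ite_false _ _ ih =>
    refine ⟨fun y hy => ?_, fun B hB => ?_⟩
    · simp only [Cmd.WritesReg, not_or] at hy
      exact ih.1 y hy.2
    · simp only [Cmd.WritesMem, not_or] at hB
      exact ih.2 B hB.2
  | loop_true _ _ _ ih1 ih2 =>
    refine ⟨fun y hy => ?_, fun B hB => ?_⟩
    · rw [ih2.1 y hy, ih1.1 y hy]
    · rw [ih2.2 B hB, ih1.2 B hB]
  | loop_false => exact ⟨fun _ _ => rfl, fun _ _ => rfl⟩

theorem Run.deterministic {O : List ℕ → Prop} {p : Cmd} {s s₁ : Store} {t₁ : ℕ}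
    {q₁ : List (List ℕ)} (h₁ : Run O p s s₁ t₁ q₁) (hp : p.Deterministic) :
    ∀ {s₂ t₂ q₂}, Run O p s s₂ t₂ q₂ → s₁ = s₂ := by
  induction h₁ with
  | skip => intro _ _ _ h; cases h; rfl
  | assign => intro _ _ _ h; cases h; rfl
  | store => intro _ _ _ h; cases h; rfl
  | guess => exact hp.elim
  | query_yes _ _ _ _ hO =>
    intro _ _ _ h
    cases h
    · rfl
    · contradiction
  | query_no _ _ _ _ hO =>
    intro _ _ _ h
    cases h
    · contradiction
    · rfl
  | seq _ _ ih1 ih2 =>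
    intro _ _ _ h
    cases h with
    | seq h1 h2 =>
      obtain rfl := ih1 hp.1 h1
      exact ih2 hp.2 h2
  | ite_true he _ ih =>
    intro _ _ _ h
    cases h with
    | ite_true _ h1 => exact ih hp.1 h1
    | ite_false h0 _ => contradiction
  | ite_false he _ ih =>
    intro _ _ _ h
    cases h with
    | ite_true h0 _ => contradiction
    | ite_false _ h1 => exact ih hp.2 h1
  | loop_true he _ _ ih1 ih2 =>
    intro _ _ _ h
    cases h with
    | loop_true _ h1 h2 =>
      obtain rfl := ih1 hp h1
      exact ih2 hp h2
    | loop_false h0 => contradiction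
  | loop_false he =>
    intro _ _ _ h
    cases h with
    | loop_true h0 _ _ => contradiction
    | loop_false _ => rfl

theorem Wlp.mono {p : Cmd} {s : Store} {Q Q' : Store → Prop} (h : Wlp p s Q)
    (hQ : ∀ s', Frame p s s' → Q s' → Q' s') : Wlp p s Q' :=
  fun s' t qs hr => hQ s' hr.frame (h s' t qs hr)

theorem Can.mono {U n n' : ℕ} {p : Cmd} {s : Store} {Q Q' : Store → Prop} (h : Can U p s n Q)
    (hn : n ≤ n') (hQ : ∀ s', Frame p s s' → Q s' → Q' s') : Can U p s n' Q' := by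
  obtain ⟨s', t, hr, ht, hq⟩ := h
  exact ⟨s', t, hr, ht.trans (Nat.mul_le_mul_right _ hn), hQ s' hr.frame hq⟩

/-- For a deterministic program, a single run tells all. -/
theorem Can.wlp {U n : ℕ} {p : Cmd} {s : Store} {Q : Store → Prop} (h : Can U p s n Q)
    (hp : p.Deterministic) : Wlp p s Q := by
  obtain ⟨s', t, hr, ht, hq⟩ := h
  intro s'' t' qs hr'
  exact hr.deterministic hp hr' ▸ hq

theorem wlp_skip {s : Store} {Q : Store → Prop} (h : Q s) : Wlp .skip s Q := by
  intro s' t qs hr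
  cases hr
  exact h

theorem wlp_assign {s : Store} {x : ℕ} {e : Expr} {Q : Store → Prop}
    (h : Q (s.setReg x (e.eval s))) : Wlp (.assign x e) s Q := by
  intro s' t qs hr
  cases hr
  exact h

theorem wlp_store {s : Store} {A : ℕ} {i e : Expr} {Q : Store → Prop}
    (h : Q (s.setMem A (i.eval s) (e.eval s))) : Wlp (.store A i e) s Q := by
  intro s' t qs hr
  cases hr
  exact h

theorem wlp_guess {s : Store} {x : ℕ} {Q : Store → Prop}
    (h : ∀ v, Q (s.setReg x v)) : Wlp (.guess x) s Q := by
  intro s' t qs hr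
  cases hr
  exact h _

theorem wlp_seq {s : Store} {p q : Cmd} {Q : Store → Prop}
    (h : Wlp p s fun s' => Wlp q s' Q) : Wlp (.seq p q) s Q := by
  intro s' t qs hr
  cases hr with
  | seq h1 h2 => exact h _ _ _ h1 _ _ _ h2

theorem wlp_ite {s : Store} {e : Expr} {p q : Cmd} {Q : Store → Prop}
    (hp : e.eval s ≠ 0 → Wlp p s Q) (hq : e.eval s = 0 → Wlp q s Q) : Wlp (.ite e p q) s Q := by
  intro s' t qs hr
  cases hr with
  | ite_true h0 h1 => exact hp h0 _ _ _ h1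
  | ite_false h0 h1 => exact hq h0 _ _ _ h1

theorem can_skip {U : ℕ} {s : Store} {Q : Store → Prop} (h : Q s) : Can U .skip s 1 Q :=
  ⟨s, 1, .skip s, by have := one_le_wordCost U; omega, h⟩

theorem can_assign {U : ℕ} (hU : 2 ≤ U) {s : Store} {x : ℕ} {e : Expr} {Q : Store → Prop}
    (he : e.Bdd U s) (h : Q (s.setReg x (e.eval s))) : Can U (.assign x e) s (e.weight + 1) Q := by
  refine ⟨_, _, .assign s x e, ?_, h⟩
  have := one_le_wordCost U
  have := he.cost_le hU
  rw [add_mul]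
  omega

theorem can_store {U : ℕ} (hU : 2 ≤ U) {s : Store} {A : ℕ} {i e : Expr} {Q : Store → Prop}
    (hi : i.Bdd U s) (he : e.Bdd U s) (h : Q (s.setMem A (i.eval s) (e.eval s))) :
    Can U (.store A i e) s (i.weight + e.weight + 1) Q := by
  refine ⟨_, _, .store s A i e, ?_, h⟩
  have := one_le_wordCost U
  have := he.cost_le hU
  have := hi.cost_le hU
  rw [add_mul, add_mul]
  omega

theorem can_guess {U : ℕ} {s : Store} {x : ℕ} (v : ℕ) (hv : v ≤ U) {Q : Store → Prop}
    (h : Q (s.setReg x v)) : Can U (.guess x) s 2 Q := by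
  refine ⟨_, _, .guess s x v, ?_, h⟩
  have := one_le_wordCost U
  have := wordCost_mono hv
  omega

theorem can_seq {U n m : ℕ} {s : Store} {p q : Cmd} {Q : Store → Prop}
    (h : Can U p s n fun s' => Can U q s' m Q) : Can U (.seq p q) s (n + m) Q := by
  obtain ⟨s', t, hr, ht, s'', t', hr', ht', hq⟩ := h
  refine ⟨s'', t + t', ?_, ?_, hq⟩
  · simpa using Run.seq hr hr'
  · rw [add_mul]; omega

theorem can_ite {U n m : ℕ} (hU : 2 ≤ U) {s : Store} {e : Expr} {p q : Cmd} {Q : Store → Prop}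
    (he : e.Bdd U s) (hp : e.eval s ≠ 0 → Can U p s n Q) (hq : e.eval s = 0 → Can U q s m Q) :
    Can U (.ite e p q) s (e.weight + 1 + n + m) Q := by
  have h1 := one_le_wordCost U
  have h2 := he.cost_le hU
  by_cases h : e.eval s = 0
  · obtain ⟨s', t, hr, ht, hQ⟩ := hq h
    refine ⟨s', _, .ite_false h hr, ?_, hQ⟩
    simp only [add_mul]
    omega
  · obtain ⟨s', t, hr, ht, hQ⟩ := hp h
    refine ⟨s', _, .ite_true h hr, ?_, hQ⟩
    simp only [add_mul]
    omega

/-- The program that runs forever unless `e` evaluates to `0`. Conditions are therefore coded with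
`0` for truth: conjunction is addition, disjunction is multiplication. -/
def assertZero (e : Expr) : Cmd := .loop e .skip

theorem wlp_assertZero {s : Store} {e : Expr} {Q : Store → Prop}
    (h : e.eval s = 0 → Q s) : Wlp (assertZero e) s Q := by
  have key : ∀ (p : Cmd) (s s' : Store) (t : ℕ) (qs), Run (fun _ => False) p s s' t qs →
      p = assertZero e → e.eval s = 0 ∧ s' = s := by
    intro p s s' t qs hr
    induction hr with
    | loop_true he hp hl ih1 ih2 =>
      intro h
      simp only [assertZero, Cmd.loop.injEq] at h
      obtain ⟨rfl, rfl⟩ := h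
      cases hp
      exact absurd (ih2 rfl).1 he
    | loop_false he =>
      intro h
      simp only [assertZero, Cmd.loop.injEq] at h
      obtain ⟨rfl, rfl⟩ := h
      exact ⟨he, rfl⟩
    | _ => intro h; simp [assertZero] at h
  intro s' t qs hr
  obtain ⟨h0, rfl⟩ := key _ _ _ _ _ hr rfl
  exact h h0

theorem can_assertZero {U : ℕ} (hU : 2 ≤ U) {s : Store} {e : Expr} {Q : Store → Prop}
    (he : e.Bdd U s) (h0 : e.eval s = 0) (h : Q s) : Can U (assertZero e) s (e.weight + 1) Q := by
  refine ⟨s, _, .loop_false h0, ?_, h⟩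
  have := one_le_wordCost U
  have := he.cost_le hU
  rw [add_mul]
  omega

/-- The cost of one execution of a program without proper loops, in words. -/
def Cmd.weight : Cmd → ℕ
  | .skip => 1
  | .assign _ e => e.weight + 1
  | .store _ i e => i.weight + e.weight + 1
  | .guess _ => 2
  | .query _ _ _ => 0
  | .seq p q => p.weight + q.weight
  | .ite e p q => e.weight + 1 + p.weight + q.weight
  | .loop e _ => e.weight + 1

/-! The rules `canw_*` are the instances of the rules `can_*` in which the bound is the weight of
the program, so that the bound need not be found by unification. -/

theorem canw_assign {U : ℕ} (hU : 2 ≤ U) {s : Store} {x : ℕ} {e : Expr} {Q : Store → Prop}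
    (he : e.Bdd U s) (h : Q (s.setReg x (e.eval s))) :
    Can U (.assign x e) s (Cmd.weight (.assign x e)) Q := can_assign hU he h

theorem canw_store {U : ℕ} (hU : 2 ≤ U) {s : Store} {A : ℕ} {i e : Expr} {Q : Store → Prop}
    (hi : i.Bdd U s) (he : e.Bdd U s) (h : Q (s.setMem A (i.eval s) (e.eval s))) :
    Can U (.store A i e) s (Cmd.weight (.store A i e)) Q := can_store hU hi he h

theorem canw_guess {U : ℕ} {s : Store} {x : ℕ} (v : ℕ) (hv : v ≤ U) {Q : Store → Prop}
    (h : Q (s.setReg x v)) : Can U (.guess x) s (Cmd.weight (.guess x)) Q := can_guess v hv h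

theorem canw_seq {U : ℕ} {s : Store} {p q : Cmd} {Q : Store → Prop}
    (h : Can U p s p.weight fun s' => Can U q s' q.weight Q) :
    Can U (.seq p q) s (Cmd.weight (.seq p q)) Q := can_seq h

theorem canw_ite {U : ℕ} (hU : 2 ≤ U) {s : Store} {e : Expr} {p q : Cmd} {Q : Store → Prop}
    (he : e.Bdd U s) (hp : e.eval s ≠ 0 → Can U p s p.weight Q)
    (hq : e.eval s = 0 → Can U q s q.weight Q) :
    Can U (.ite e p q) s (Cmd.weight (.ite e p q)) Q := can_ite hU he hp hq

theorem canw_assertZero {U : ℕ} (hU : 2 ≤ U) {s : Store} {e : Expr} {Q : Store → Prop}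
    (he : e.Bdd U s) (h0 : e.eval s = 0) (h : Q s) :
    Can U (assertZero e) s (assertZero e).weight Q := can_assertZero hU he h0 h

/-- `for i < n do body`, where `i` and `n` are registers. -/
def forLoop (i n : ℕ) (body : Cmd) : Cmd :=
  .seq (.assign i (.const 0)) (.loop (.op .sub (.reg n) (.reg i))
    (.seq body (.assign i (.op .add (.reg i) (.const 1)))))

theorem wlp_forLoop {i n m : ℕ} {body : Cmd} {s : Store} (I : ℕ → Store → Prop) (hin : i ≠ n)
    (hi : ¬ body.WritesReg i) (hn : ¬ body.WritesReg n) (hm : s.reg n = m)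
    (h0 : I 0 (s.setReg i 0))
    (hI : ∀ k < m, ∀ s, I k s → s.reg i = k → s.reg n = m →
      Wlp body s fun s' => I (k + 1) (s'.setReg i (k + 1))) :
    Wlp (forLoop i n body) s (I m) := by
  have key : ∀ (p : Cmd) (s s' : Store) (t : ℕ) (qs), Run (fun _ => False) p s s' t qs →
      p = .loop (.op .sub (.reg n) (.reg i))
        (.seq body (.assign i (.op .add (.reg i) (.const 1)))) →
      ∀ k ≤ m, I k s → s.reg i = k → s.reg n = m → I m s' := by
    intro p s s' t qs hr
    induction hr with
    | loop_true he hp hl ih1 ih2 =>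
      intro h k hk hIk hik hnm
      simp only [Cmd.loop.injEq] at h
      obtain ⟨rfl, rfl⟩ := h
      simp only [Expr.eval, BinOp.eval, hik, hnm] at he
      cases hp with
      | seq hp1 hp2 =>
        have hf := hp1.frame
        have h1 := hI k (by omega) _ hIk hik hnm _ _ _ hp1
        cases hp2
        have hE : (Expr.op .add (.reg i) (.const 1)).eval _ = k + 1 :=
          congrArg (· + 1) ((hf.1 i hi).trans hik)
        rw [hE] at ih2
        refine ih2 rfl (k + 1) (by omega) h1 (by simp) ?_
        simp [Ne.symm hin, hf.1 n hn, hnm]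
    | loop_false he =>
      intro h k hk hIk hik hnm
      simp only [Cmd.loop.injEq] at h
      obtain ⟨rfl, rfl⟩ := h
      simp only [Expr.eval, BinOp.eval, hik, hnm] at he
      obtain rfl : k = m := by omega
      exact hIk
    | _ => intro h; simp at h
  refine wlp_seq (wlp_assign fun s' t qs hr => ?_)
  exact key _ _ _ _ _ hr rfl 0 (Nat.zero_le _) h0 (by simp [Expr.eval])
    (by simp [Ne.symm hin, hm])

theorem can_forLoop {U i n m c : ℕ} (hU : 2 ≤ U) {body : Cmd} {s : Store}
    (I : ℕ → Store → Prop) (hin : i ≠ n)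
    (hi : ¬ body.WritesReg i) (hn : ¬ body.WritesReg n) (hm : s.reg n = m) (hmU : m ≤ U)
    (h0 : I 0 (s.setReg i 0))
    (hI : ∀ k < m, ∀ s, I k s → s.reg i = k → s.reg n = m →
      Can U body s c fun s' => I (k + 1) (s'.setReg i (k + 1))) :
    Can U (forLoop i n body) s (7 + m * (c + 10)) (I m) := by
  have key : ∀ d k, d + k = m → ∀ s, I k s → s.reg i = k → s.reg n = m →
      Can U (.loop (.op .sub (.reg n) (.reg i))
        (.seq body (.assign i (.op .add (.reg i) (.const 1))))) s (5 + d * (c + 10)) (I m) := by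
    intro d
    induction d with
    | zero =>
      intro k hk s hIk hik hnm
      obtain rfl : k = m := by omega
      refine ⟨s, _, .loop_false (by simp [Expr.eval, BinOp.eval, hik, hnm]), ?_, hIk⟩
      have h1 := one_le_wordCost U
      have h2 : (Expr.op .sub (.reg n) (.reg i)).Bdd U s := by
        simp [Expr.Bdd, hik, hnm, hmU]
      have h3 := h2.cost_le hU
      simp only [Expr.weight, Expr.leaves] at h3
      omega
    | succ d ih =>
      intro k hk s hIk hik hnm
      obtain ⟨s', t, hr, ht, hQ⟩ := hI k (by omega) s hIk hik hnm
      have hf := hr.frame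
      have hik' : s'.reg i = k := (hf.1 i hi).trans hik
      have hnm' : s'.reg n = m := (hf.1 n hn).trans hnm
      obtain ⟨s'', t', hr', ht', hQ'⟩ := ih (k + 1) (by omega) _ hQ (by simp)
        (by simp [Ne.symm hin, hnm'])
      have hasg := Run.assign (O := fun _ => False) s' i (.op .add (.reg i) (.const 1))
      have h1 := one_le_wordCost U
      have h2 : (Expr.op .sub (.reg n) (.reg i)).Bdd U s := by
        simp only [Expr.Bdd, hik, hnm]; omega
      have h3 := h2.cost_le hU
      have h4 : (Expr.op .add (.reg i) (.const 1)).Bdd U s' := by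
        simp only [Expr.Bdd, hik']; omega
      have h5 := h4.cost_le hU
      simp only [Expr.weight, Expr.leaves] at h3 h5
      have hE : (Expr.op .add (.reg i) (.const 1)).eval s' = k + 1 := by
        simp [Expr.eval, BinOp.eval, hik']
      rw [hE] at hasg
      have hrun := Run.loop_true (e := .op .sub (.reg n) (.reg i)) (s := s)
        (by simp only [Expr.eval, BinOp.eval, hik, hnm]; omega) (hr.seq hasg) hr'
      refine ⟨s'', _, by simpa using hrun, ?_, hQ'⟩
      · have : (5 + (d + 1) * (c + 10)) * wordCost U =
            (5 + d * (c + 10)) * wordCost U + c * wordCost U + 10 * wordCost U := by ring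
        omega
  have h7 : 7 + m * (c + 10) = ((Expr.const 0).weight + 1) + (5 + m * (c + 10)) := by
    simp only [Expr.weight]; omega
  rw [h7]
  refine can_seq (can_assign hU (Nat.zero_le _) ?_)
  exact key m 0 (by omega) _ h0 (by simp [Expr.eval]) (by simp [Ne.symm hin, hm])

/-! ### Happens-before on tables of events -/

/-- A trace as a table: the threads, operation codes and names of its `size` many events. -/
structure Table where
  size : ℕ
  thr : ℕ → ℕ
  code : ℕ → ℕ
  name : ℕ → ℕ

namespace Table

variable (τ : Table)

/-- The generating pairs of the happens-before order, on positions. -/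
def Step (i j : ℕ) : Prop :=
  i < j ∧ j < τ.size ∧
    (τ.thr i = τ.thr j ∨ (τ.code i = 3 ∧ τ.code j = 2 ∧ τ.name i = τ.name j))

/-- The happens-before order on positions. -/
def Reach : ℕ → ℕ → Prop := Relation.ReflTransGen τ.Step

/-- Two accesses of the same variable, one of them writing; they may belong to the same thread. -/
def Touch (i j : ℕ) : Prop :=
  τ.name i = τ.name j ∧ τ.code i ≤ 1 ∧ τ.code j ≤ 1 ∧ 1 ≤ τ.code i + τ.code j

/-- All pairs of conflicting accesses are ordered. Pairs within one thread are included; they are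
ordered anyway. -/
def RaceFree : Prop := ∀ i j, i < j → j < τ.size → τ.Touch i j → τ.Reach i j

variable {τ}

theorem Reach.le {i j : ℕ} (h : τ.Reach i j) : i ≤ j := by
  induction h with
  | refl => exact le_rfl
  | tail _ h ih => exact ih.trans h.1.le

theorem reach_iff {i k : ℕ} : τ.Reach i k ↔ k = i ∨ ∃ m < k, τ.Reach i m ∧ τ.Step m k := by
  constructor
  · intro h
    cases h with
    | refl => exact Or.inl rfl
    | tail h1 h2 => exact Or.inr ⟨_, h2.1, h1, h2⟩
  · rintro (rfl | ⟨m, _, h1, h2⟩)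
    · exact .refl
    · exact h1.tail h2

/-- A path of the happens-before order, as a sequence of steps. -/
theorem Reach.exists_path {i j : ℕ} (h : τ.Reach i j) :
    ∃ (n : ℕ) (p : ℕ → ℕ), p 0 = i ∧ p n = j ∧ ∀ t < n, τ.Step (p t) (p (t + 1)) := by
  induction h with
  | refl => exact ⟨0, fun _ => i, rfl, rfl, fun t ht => absurd ht (Nat.not_lt_zero t)⟩
  | @tail b c _ h2 ih =>
    obtain ⟨n, p, h0, hn, hp⟩ := ih
    refine ⟨n + 1, fun t => if t ≤ n then p t else c, by simpa using h0, by simp, fun t ht => ?_⟩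
    rcases Nat.lt_or_ge t n with h | h
    · simpa [h.le, Nat.succ_le_of_lt h] using hp t h
    · obtain rfl : t = n := by omega
      simpa [hn] using h2

theorem reach_of_path {p : ℕ → ℕ} {a n : ℕ} (han : a ≤ n)
    (hp : ∀ t < n, τ.Step (p t) (p (t + 1))) : τ.Reach (p a) (p n) := by
  induction n, han using Nat.le_induction with
  | base => exact .refl
  | succ n _ ih => exact (ih fun t ht => hp t (by omega)).tail (hp n (by omega))

end Table

/-! ### Traces as tables -/

/-- The event at a position; the value beyond the end of the trace is irrelevant. -/
def Trace.event (σ : List Event) (i : ℕ) : Event := σ.getD i ⟨0, .read 0⟩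

/-- The table of a trace, with the operation codes that are used in its encoding. -/
def Trace.table (σ : List Event) : Table where
  size := σ.length
  thr i := (Trace.event σ i).thread
  code i := (Trace.event σ i).op.code
  name i := (Trace.event σ i).op.name

theorem Trace.event_fin (σ : List Event) (i : Fin σ.length) : Trace.event σ i = σ.get i := by
  simp [Trace.event]

theorem Operation.ext_code {o o' : Operation} (h : o.code = o'.code) (h' : o.name = o'.name) :
    o = o' := by
  cases o <;> cases o' <;> simp_all [Operation.code, Operation.name]

theorem hbStep_iff (σ : List Event) (i j : Fin σ.length) :
    HBStep σ i j ↔ (Trace.table σ).Step i j := by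
  simp only [HBStep, Table.Step, Trace.table, Trace.event_fin, Fin.lt_def, j.2, true_and]
  refine and_congr_right fun _ => or_congr_right ?_
  constructor
  · rintro ⟨l, h1, h2⟩
    rw [h1, h2]
    exact ⟨rfl, rfl, rfl⟩
  · rintro ⟨h1, h2, h3⟩
    refine ⟨(σ.get i).op.name, ?_, ?_⟩ <;> apply Operation.ext_code <;>
      simp_all [Operation.code, Operation.name]

theorem hb_iff (σ : List Event) (i j : Fin σ.length) :
    HB σ i j ↔ (Trace.table σ).Reach i j := by
  constructor
  · intro h
    induction h with
    | refl => exact .refl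
    | tail _ h ih => exact ih.tail ((hbStep_iff σ _ _).1 h)
  · obtain ⟨j, hj⟩ := j
    intro h
    change (Trace.table σ).Reach i j at h
    induction h with
    | refl => exact .refl
    | @tail b c h1 h2 ih =>
      have hb : b < σ.length := lt_trans h2.1 h2.2.1
      exact (ih hb).tail ((hbStep_iff σ ⟨b, hb⟩ ⟨c, hj⟩).2 h2)

theorem conflicting_iff (σ : List Event) (i j : Fin σ.length) :
    Conflicting σ i j ↔ (Trace.table σ).thr i ≠ (Trace.table σ).thr j ∧
      (Trace.table σ).Touch i j := by
  simp only [Conflicting, Table.Touch, Trace.table, Trace.event_fin, Operation.Accesses]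
  refine and_congr_right fun _ => ?_
  generalize (σ.get i).op = o
  generalize (σ.get j).op = o'
  cases o <;> cases o' <;> simp [Operation.code, Operation.name, eq_comm]

theorem hasHBRace_iff (σ : List Event) :
    HasHBRace σ ↔ ∃ i j, i < j ∧ j < (Trace.table σ).size ∧ (Trace.table σ).Touch i j ∧
      ¬ (Trace.table σ).Reach i j := by
  constructor
  · rintro ⟨i, j, hc, h1, h2⟩
    rw [hb_iff] at h1 h2
    rw [conflicting_iff] at hc
    rcases lt_trichotomy (i : ℕ) j with h | h | h
    · exact ⟨i, j, h, j.2, hc.2, h1⟩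
    · exact absurd (h ▸ rfl) hc.1
    · obtain ⟨ha, hb, hd, he⟩ := hc.2
      exact ⟨j, i, h, i.2, ⟨ha.symm, hd, hb, by omega⟩, h2⟩
  · rintro ⟨i, j, hij, hj, ht, hr⟩
    have hj' : j < σ.length := hj
    refine ⟨⟨i, by omega⟩, ⟨j, hj'⟩, ?_, ?_, ?_⟩
    · rw [conflicting_iff]
      refine ⟨fun h => hr ?_, ht⟩
      exact Relation.ReflTransGen.single ⟨hij, hj, Or.inl h⟩
    · rwa [hb_iff]
    · rw [hb_iff]
      exact fun h => absurd h.le (by simpa using hij)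

theorem not_hasHBRace_iff (σ : List Event) : ¬ HasHBRace σ ↔ (Trace.table σ).RaceFree := by
  rw [hasHBRace_iff, Table.RaceFree]
  push Not
  rfl

/-! ### Hitting sets -/

/-- Greedy hitting sets: sets of at least `K` among `N` positions lose a fraction `K / N` of
their number when those that contain a suitable position are removed. -/
theorem exists_hitting (N K : ℕ) (m : ℕ) (F : Finset (Finset ℕ))
    (hF : ∀ X ∈ F, X ⊆ Finset.range N ∧ K ≤ X.card) (hc : F.card * (N - K) ^ m < N ^ m) :
    ∃ S : ℕ → ℕ, (∀ q, S q ≤ N) ∧ ∀ X ∈ F, ∃ q < m, S q ∈ X := by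
  induction m generalizing F with
  | zero =>
    have : F = ∅ := by simpa using hc
    exact ⟨fun _ => 0, fun _ => Nat.zero_le _, by simp [this]⟩
  | succ m ih =>
    rcases Finset.eq_empty_or_nonempty F with rfl | hne
    · exact ⟨fun _ => 0, fun _ => Nat.zero_le _, by simp⟩
    have hN : 0 < N := by
      rcases Nat.eq_zero_or_pos N with rfl | h
      · simp at hc
      · exact h
    obtain ⟨v, hv, hcard⟩ : ∃ v ∈ Finset.range N,
        F.card * K ≤ (F.filter fun X => v ∈ X).card * N := by
      by_contra hcon
      push Not at hcon
      have h1 : ∑ v ∈ Finset.range N, (F.filter fun X => v ∈ X).card = ∑ X ∈ F, X.card := by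
        simp only [Finset.card_filter]
        rw [Finset.sum_comm]
        refine Finset.sum_congr rfl fun X hX => ?_
        rw [← Finset.card_filter]
        congr 1
        ext v
        simp only [Finset.mem_filter, and_iff_right_iff_imp]
        exact fun h => (hF X hX).1 h
      have h2 : F.card * K ≤ ∑ X ∈ F, X.card := by
        rw [← smul_eq_mul]
        exact Finset.card_nsmul_le_sum _ _ _ fun X hX => (hF X hX).2
      have h3 : (∑ v ∈ Finset.range N, (F.filter fun X => v ∈ X).card) * N
          < ∑ v ∈ Finset.range N, F.card * K := by
        rw [Finset.sum_mul]
        exact Finset.sum_lt_sum_of_nonempty ⟨0, Finset.mem_range.2 hN⟩ hcon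
      rw [Finset.sum_const, Finset.card_range, smul_eq_mul, h1] at h3
      nlinarith
    have hsplit : (F.filter fun X => v ∈ X).card + (F.filter fun X => v ∉ X).card = F.card :=
      Finset.card_filter_add_card_filter_not _
    have hKN : K ≤ N := by
      obtain ⟨X, hX⟩ := hne
      have := Finset.card_le_card (hF X hX).1
      rw [Finset.card_range] at this
      exact (hF X hX).2.trans this
    have hless : (F.filter fun X => v ∉ X).card * N ≤ F.card * (N - K) := by
      rw [Nat.mul_sub]
      have : (F.filter fun X => v ∉ X).card * N + (F.filter fun X => v ∈ X).card * N
          = F.card * N := by rw [← add_mul, add_comm, hsplit]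
      omega
    obtain ⟨S, hS, hit⟩ := ih (F.filter fun X => v ∉ X)
      (fun X hX => hF X (Finset.mem_filter.1 hX).1) (by
        refine Nat.lt_of_mul_lt_mul_left (a := N) ?_
        calc N * ((F.filter fun X => v ∉ X).card * (N - K) ^ m)
            = ((F.filter fun X => v ∉ X).card * N) * (N - K) ^ m := by ring
          _ ≤ (F.card * (N - K)) * (N - K) ^ m := Nat.mul_le_mul_right _ hless
          _ = F.card * (N - K) ^ (m + 1) := by ring
          _ < N ^ (m + 1) := hc
          _ = N * N ^ m := by ring)
    refine ⟨fun q => if q < m then S q else v, fun q => ?_, fun X hX => ?_⟩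
    · have := Finset.mem_range.1 hv
      have := hS q
      dsimp only
      split <;> omega
    · by_cases hvX : v ∈ X
      · exact ⟨m, by omega, by simpa using hvX⟩
      · obtain ⟨q, hq, hqX⟩ := hit X (Finset.mem_filter.2 ⟨hX, hvX⟩)
        exact ⟨q, by omega, by simpa [hq] using hqX⟩

/-- With `K = √N` and `O(√N log N)` rounds, the greedy choice hits `N²` sets. -/
theorem sq_mul_sub_pow_lt (N : ℕ) (hN : 0 < N) :
    N ^ 2 * (N - (N.sqrt + 1)) ^ ((N.sqrt + 1) * (2 * wordCost N)) <
      N ^ ((N.sqrt + 1) * (2 * wordCost N)) := by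
  set K := N.sqrt + 1 with hK
  set L := wordCost N with hL
  have hKK : N < K * K := Nat.lt_succ_sqrt N
  have hNL : N < 2 ^ L := Nat.lt_pow_succ_log_self (by norm_num) N
  rcases Nat.lt_or_ge N K with h | h
  · rw [Nat.sub_eq_zero_of_le h.le, zero_pow, mul_zero]
    · positivity
    · have : 1 ≤ L := one_le_wordCost N
      have : 1 ≤ K := by omega
      positivity
  have hN' : (0 : ℝ) < N := by exact_mod_cast hN
  -- `1 - K / N ≤ exp (-K / N)`, and `K ^ 2 > N`
  have h1 : ((N - K : ℕ) : ℝ) ≤ N * Real.exp (-(K / N)) := by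
    have := Real.add_one_le_exp (-((K : ℝ) / N))
    rw [Nat.cast_sub h]
    calc (N : ℝ) - K = N * (-((K : ℝ) / N) + 1) := by field_simp; ring
      _ ≤ _ := mul_le_mul_of_nonneg_left this hN'.le
  have h2 : ((N - K : ℕ) : ℝ) ^ (K * (2 * L)) ≤
      (N : ℝ) ^ (K * (2 * L)) * Real.exp (-(2 * L)) := by
    calc ((N - K : ℕ) : ℝ) ^ (K * (2 * L)) ≤ (N * Real.exp (-(K / N))) ^ (K * (2 * L)) :=
          pow_le_pow_left₀ (Nat.cast_nonneg _) h1 _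
      _ = (N : ℝ) ^ (K * (2 * L)) * Real.exp (-(K / N) * (K * (2 * L) : ℕ)) := by
          rw [mul_pow, ← Real.exp_nat_mul, mul_comm (-((K : ℝ) / N))]
      _ ≤ _ := by
          refine mul_le_mul_of_nonneg_left (Real.exp_le_exp.2 ?_) (by positivity)
          have : (1 : ℝ) ≤ K / N * K := by
            rw [div_mul_eq_mul_div, le_div_iff₀ hN', one_mul]
            exact_mod_cast hKK.le
          push_cast
          nlinarith [Nat.cast_nonneg (α := ℝ) L]
  have h3 : (N : ℝ) ^ 2 * Real.exp (-(2 * L)) < 1 := by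
    rw [Real.exp_neg, mul_inv_lt_iff₀ (Real.exp_pos _), one_mul]
    have h4 : (2 : ℝ) ≤ Real.exp 1 := by have := Real.add_one_le_exp 1; linarith
    calc (N : ℝ) ^ 2 < ((2 : ℝ) ^ L) ^ 2 := by
          have : (N : ℝ) < 2 ^ L := by exact_mod_cast hNL
          exact pow_lt_pow_left₀ this hN'.le (by norm_num)
      _ ≤ ((Real.exp 1) ^ L) ^ 2 := by gcongr
      _ = Real.exp (2 * L) := by
          rw [← pow_mul, ← Real.exp_nat_mul]; congr 1; push_cast; ring
  have h5 : ((N ^ 2 * (N - K) ^ (K * (2 * L)) : ℕ) : ℝ) < ((N ^ (K * (2 * L)) : ℕ) : ℝ) := by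
    push_cast
    calc (N : ℝ) ^ 2 * ((N - K : ℕ) : ℝ) ^ (K * (2 * L))
        ≤ (N : ℝ) ^ 2 * ((N : ℝ) ^ (K * (2 * L)) * Real.exp (-(2 * L))) :=
          mul_le_mul_of_nonneg_left h2 (by positivity)
      _ = (N : ℝ) ^ (K * (2 * L)) * ((N : ℝ) ^ 2 * Real.exp (-(2 * L))) := by ring
      _ < (N : ℝ) ^ (K * (2 * L)) * 1 := mul_lt_mul_of_pos_left h3 (by positivity)
      _ = _ := mul_one _
  exact_mod_cast h5

namespace Table

/-- A short certificate of `Reach a b` relative to a list `S 0, …, S (m - 1)` of positions: at most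
`K` steps lead from `a` to `b`, or to some `S q` from which `b` can be reached. -/
def Cert (τ : Table) (K m : ℕ) (S : ℕ → ℕ) (a b : ℕ) : Prop :=
  ∃ (n : ℕ) (p : ℕ → ℕ), n ≤ K ∧ p 0 = a ∧ (∀ t < n, τ.Step (p t) (p (t + 1))) ∧
    (p n = b ∨ ∃ q < m, S q = p n ∧ τ.Reach (S q) b)

/-- Long paths have their first `√N` positions hit by a set of size `O(√N log N)`. -/
theorem exists_cert (τ : Table) (hN : 0 < τ.size) :
    ∃ S : ℕ → ℕ, (∀ q, S q ≤ τ.size) ∧ ∀ a b, a < τ.size → b < τ.size → τ.Reach a b →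
      τ.Cert (τ.size.sqrt + 1) ((τ.size.sqrt + 1) * (2 * wordCost τ.size)) S a b := by
  classical
  set N := τ.size
  set K := N.sqrt + 1 with hK
  have hpath : ∀ x : ℕ × ℕ, ∃ np : ℕ × (ℕ → ℕ), τ.Reach x.1 x.2 →
      np.2 0 = x.1 ∧ np.2 np.1 = x.2 ∧ ∀ t < np.1, τ.Step (np.2 t) (np.2 (t + 1)) := by
    intro x
    by_cases h : τ.Reach x.1 x.2
    · obtain ⟨n, p, hp⟩ := h.exists_path
      exact ⟨(n, p), fun _ => hp⟩
    · exact ⟨(0, id), fun h' => absurd h' h⟩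
  choose np hnp using hpath
  set P : Finset (ℕ × ℕ) := (Finset.range N ×ˢ Finset.range N).filter
    fun x => τ.Reach x.1 x.2 ∧ K < (np x).1 with hP
  set F : Finset (Finset ℕ) := P.image fun x => (Finset.range K).image (np x).2 with hF
  have hmono : ∀ x, τ.Reach x.1 x.2 → ∀ a b, a < b → b ≤ (np x).1 → (np x).2 a < (np x).2 b := by
    intro x hx a b hab
    induction b, hab using Nat.le_induction with
    | base => exact fun h => ((hnp x hx).2.2 a (by omega)).1
    | succ b _ ih => exact fun h => (ih (by omega)).trans ((hnp x hx).2.2 b (by omega)).1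
  obtain ⟨S, hS, hit⟩ := exists_hitting N K (K * (2 * wordCost N)) F (by
      intro X hX
      obtain ⟨x, hx, rfl⟩ := Finset.mem_image.1 hX
      obtain ⟨hx1, hx2, hx3⟩ := Finset.mem_filter.1 hx
      constructor
      · intro v hv
        obtain ⟨t, ht, rfl⟩ := Finset.mem_image.1 hv
        have ht' := Finset.mem_range.1 ht
        have := (hnp x hx2).2.2 t (by omega)
        exact Finset.mem_range.2 (this.1.trans this.2.1)
      · rw [Finset.card_image_of_injOn, Finset.card_range]
        intro a ha b hb hab
        have ha' : a < K := by simpa using ha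
        have hb' : b < K := by simpa using hb
        rcases lt_trichotomy a b with h | h | h
        · have := hmono x hx2 a b h (by omega)
          omega
        · exact h
        · have := hmono x hx2 b a h (by omega)
          omega) (by
      refine lt_of_le_of_lt (Nat.mul_le_mul_right _ ?_) (sq_mul_sub_pow_lt N hN)
      calc F.card ≤ P.card := Finset.card_image_le
        _ ≤ (Finset.range N ×ˢ Finset.range N).card := Finset.card_filter_le _ _
        _ = N ^ 2 := by simp [sq])
  refine ⟨S, hS, fun a b ha hb hab => ?_⟩
  obtain ⟨h0, hn, hs⟩ := hnp (a, b) hab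
  rcases Nat.lt_or_ge K (np (a, b)).1 with hlt | hle
  · obtain ⟨q, hq, hqX⟩ := hit ((Finset.range K).image (np (a, b)).2)
      (Finset.mem_image.2 ⟨(a, b), Finset.mem_filter.2 ⟨by simp [ha, hb], hab, hlt⟩, rfl⟩)
    obtain ⟨t, ht, htq⟩ := Finset.mem_image.1 hqX
    have ht' := Finset.mem_range.1 ht
    refine ⟨t, (np (a, b)).2, ht'.le, h0, fun u hu => hs u (by omega),
      Or.inr ⟨q, hq, htq.symm, ?_⟩⟩
    have := reach_of_path (a := t) (by omega) hs
    rwa [hn, htq] at this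
  · exact ⟨_, _, hle, h0, hs, Or.inl hn⟩

end Table

section

/-! ### Programs on a table of events -/

/-- The registers of the verifier. -/
inductive Loc where
  | size | pos | src | base | inner | flag | count | idx | fro | to | cur | nxt | len | step | ans

/-- The arrays of the verifier. -/
inductive Arr where
  | thr | code | name | byThr | byLock | tbl | hub | lastW | nextW

/-- The registers of the verifier are numbered from `b` on, so that they do not interfere with a
program that uses only registers and arrays below `b`. -/
def Loc.addr (b : ℕ) (x : Loc) : ℕ := b + x.ctorIdx

/-- The arrays of the verifier are numbered from `b` on. -/
def Arr.addr (b : ℕ) (x : Arr) : ℕ := b + x.ctorIdx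

@[simp] theorem Loc.addr_inj {b : ℕ} {x y : Loc} : x.addr b = y.addr b ↔ x = y := by
  cases x <;> cases y <;> simp [Loc.addr, Loc.ctorIdx]

@[simp] theorem Arr.addr_inj {b : ℕ} {x y : Arr} : x.addr b = y.addr b ↔ x = y := by
  cases x <;> cases y <;> simp [Arr.addr, Arr.ctorIdx]

/-- The content of a register of the verifier. -/
def Loc.val (b : ℕ) (x : Loc) : Expr := .reg (x.addr b)

/-- The content of a cell of an array of the verifier. -/
def Arr.cell (b : ℕ) (A : Arr) (e : Expr) : Expr := .get (A.addr b) e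

instance : Add Expr := ⟨.op .add⟩
instance : Sub Expr := ⟨.op .sub⟩
instance : Mul Expr := ⟨.op .mul⟩
instance (n : ℕ) : OfNat Expr n := ⟨.const n⟩

@[simp] theorem Expr.eval_add (s : Store) (e f : Expr) : (e + f).eval s = e.eval s + f.eval s := rfl
@[simp] theorem Expr.eval_sub (s : Store) (e f : Expr) : (e - f).eval s = e.eval s - f.eval s := rfl
@[simp] theorem Expr.eval_mul (s : Store) (e f : Expr) : (e * f).eval s = e.eval s * f.eval s := rfl
@[simp] theorem Expr.eval_ofNat (s : Store) (n : ℕ) :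
    Expr.eval s (no_index (OfNat.ofNat n)) = n := rfl
@[simp] theorem Expr.eval_val (s : Store) (b : ℕ) (x : Loc) :
    (x.val b).eval s = s.reg (x.addr b) := rfl
@[simp] theorem Expr.eval_cell (s : Store) (b : ℕ) (A : Arr) (e : Expr) :
    (A.cell b e).eval s = s.mem (A.addr b) (e.eval s) := rfl

@[simp] theorem Expr.bdd_add {U : ℕ} {s : Store} {e f : Expr} :
    (e + f).Bdd U s ↔ e.Bdd U s ∧ f.Bdd U s := Iff.rfl
@[simp] theorem Expr.bdd_sub {U : ℕ} {s : Store} {e f : Expr} :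
    (e - f).Bdd U s ↔ e.Bdd U s ∧ f.Bdd U s := Iff.rfl
@[simp] theorem Expr.bdd_mul {U : ℕ} {s : Store} {e f : Expr} :
    (e * f).Bdd U s ↔ e.Bdd U s ∧ f.Bdd U s := Iff.rfl
@[simp] theorem Expr.bdd_ofNat {U : ℕ} {s : Store} {n : ℕ} :
    Expr.Bdd U s (no_index (OfNat.ofNat n)) ↔ n ≤ U := Iff.rfl
@[simp] theorem Expr.bdd_val {U : ℕ} {s : Store} {b : ℕ} {x : Loc} :
    (x.val b).Bdd U s ↔ s.reg (x.addr b) ≤ U := Iff.rfl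
@[simp] theorem Expr.bdd_cell {U : ℕ} {s : Store} {b : ℕ} {A : Arr} {e : Expr} :
    (A.cell b e).Bdd U s ↔ e.Bdd U s ∧ s.mem (A.addr b) (e.eval s) ≤ U := Iff.rfl

/-- Zero exactly if the values are equal. -/
def Expr.dist (e f : Expr) : Expr := (e - f) + (f - e)

@[simp] theorem Expr.bdd_dist {U : ℕ} {s : Store} {e f : Expr} :
    (e.dist f).Bdd U s ↔ e.Bdd U s ∧ f.Bdd U s := by
  simp only [Expr.dist, Expr.bdd_add, Expr.bdd_sub]
  tauto

theorem Expr.eval_dist {s : Store} {e f : Expr} :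
    (e.dist f).eval s = (e.eval s - f.eval s) + (f.eval s - e.eval s) := rfl

theorem Expr.eval_dist_eq_zero {s : Store} {e f : Expr} :
    (e.dist f).eval s = 0 ↔ e.eval s = f.eval s := by
  rw [Expr.eval_dist]; omega

@[simp] theorem Expr.weight_add (e f : Expr) :
    (e + f).weight = e.weight + f.weight + (e.leaves + f.leaves) := rfl
@[simp] theorem Expr.weight_sub (e f : Expr) :
    (e - f).weight = e.weight + f.weight + (e.leaves + f.leaves) := rfl
@[simp] theorem Expr.weight_mul (e f : Expr) :
    (e * f).weight = e.weight + f.weight + (e.leaves + f.leaves) := rfl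
@[simp] theorem Expr.weight_ofNat (n : ℕ) : Expr.weight (no_index (OfNat.ofNat n)) = 1 := rfl
@[simp] theorem Expr.weight_val (b : ℕ) (x : Loc) : (x.val b).weight = 1 := rfl
@[simp] theorem Expr.weight_cell (b : ℕ) (A : Arr) (e : Expr) :
    (A.cell b e).weight = e.weight + 1 := rfl
@[simp] theorem Expr.leaves_add (e f : Expr) : (e + f).leaves = e.leaves + f.leaves := rfl
@[simp] theorem Expr.leaves_sub (e f : Expr) : (e - f).leaves = e.leaves + f.leaves := rfl
@[simp] theorem Expr.leaves_mul (e f : Expr) : (e * f).leaves = e.leaves + f.leaves := rfl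
@[simp] theorem Expr.leaves_ofNat (n : ℕ) : Expr.leaves (no_index (OfNat.ofNat n)) = 1 := rfl
@[simp] theorem Expr.leaves_val (b : ℕ) (x : Loc) : (x.val b).leaves = 1 := rfl
@[simp] theorem Expr.leaves_cell (b : ℕ) (A : Arr) (e : Expr) : (A.cell b e).leaves = 1 := rfl
@[simp] theorem Expr.leaves_dist (e f : Expr) :
    (e.dist f).leaves = 2 * (e.leaves + f.leaves) := by
  rw [Expr.dist, Expr.leaves_add, Expr.leaves_sub, Expr.leaves_sub]; omega
@[simp] theorem Expr.weight_dist (e f : Expr) :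
    (e.dist f).weight = 2 * (e.weight + f.weight) + 4 * (e.leaves + f.leaves) := by
  simp only [Expr.dist, Expr.weight_add, Expr.weight_sub, Expr.leaves_sub]; omega

/-- Sequential composition of programs. -/
infixr:67 " ;; " => Cmd.seq

/-- The store holds the table in its arrays for threads, codes and names. -/
structure Holds (τ : Table) (b : ℕ) (s : Store) : Prop where
  size : s.reg (Loc.size.addr b) = τ.size
  thr : ∀ k < τ.size, s.mem (Arr.thr.addr b) k = τ.thr k
  code : ∀ k < τ.size, s.mem (Arr.code.addr b) k = τ.code k
  name : ∀ k < τ.size, s.mem (Arr.name.addr b) k = τ.name k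

/-- A bound for the numbers that occur in a table. -/
structure Table.Le (τ : Table) (U : ℕ) : Prop where
  size : τ.size ≤ U
  three : 3 ≤ U
  thr : ∀ k < τ.size, τ.thr k ≤ U
  code : ∀ k < τ.size, τ.code k ≤ U
  name : ∀ k < τ.size, τ.name k ≤ U

theorem Table.Le.mono {τ : Table} {U V : ℕ} (h : τ.Le U) (hUV : U ≤ V) : τ.Le V :=
  ⟨h.size.trans hUV, h.three.trans hUV, fun k hk => (h.thr k hk).trans hUV,
    fun k hk => (h.code k hk).trans hUV, fun k hk => (h.name k hk).trans hUV⟩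

theorem Holds.of_frame {τ : Table} {b : ℕ} {s s' : Store} {p : Cmd} (h : Holds τ b s)
    (hf : Frame p s s') (h1 : ¬ p.WritesReg (Loc.size.addr b)) (h2 : ¬ p.WritesMem (Arr.thr.addr b))
    (h3 : ¬ p.WritesMem (Arr.code.addr b)) (h4 : ¬ p.WritesMem (Arr.name.addr b)) : Holds τ b s' :=
  ⟨(hf.1 _ h1).trans h.size, by rw [hf.2 _ h2]; exact h.thr, by rw [hf.2 _ h3]; exact h.code,
    by rw [hf.2 _ h4]; exact h.name⟩

@[simp] theorem holds_setReg {τ : Table} {b : ℕ} {s : Store} {x : Loc} {v : ℕ}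
    (hx : x ≠ .size) : Holds τ b (s.setReg (x.addr b) v) ↔ Holds τ b s := by
  constructor <;> intro h <;> exact ⟨by simpa [hx.symm] using h.size, h.thr, h.code, h.name⟩

@[simp] theorem holds_setMem {τ : Table} {b : ℕ} {s : Store} {A : Arr} {i v : ℕ}
    (h1 : A ≠ .thr) (h2 : A ≠ .code) (h3 : A ≠ .name) :
    Holds τ b (s.setMem (A.addr b) i v) ↔ Holds τ b s := by
  constructor <;> intro h <;> exact ⟨h.size, by simpa [h1.symm] using h.thr,
    by simpa [h2.symm] using h.code, by simpa [h3.symm] using h.name⟩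

variable (b : ℕ)

/-- Resets the marks of all threads and locks that occur, which may be left from earlier sweeps. -/
def clearMarks : Cmd :=
  forLoop (Loc.inner.addr b) (Loc.size.addr b)
    (.store (Arr.byThr.addr b) (Arr.thr.cell b (Loc.inner.val b)) 0 ;;
     .store (Arr.byLock.addr b) (Arr.name.cell b (Loc.inner.val b)) 0)

/-- An event is reachable if it is the source, or if its thread has a reachable earlier event, or if
it acquires a lock that has been released by a reachable event. The value is `0` or `1`. -/
def sweepFlag : Expr :=
  1 - (1 - ((1 - (Loc.inner.val b).dist (Loc.src.val b)) +
    Arr.byThr.cell b (Arr.thr.cell b (Loc.inner.val b)) +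
    (1 - (Arr.code.cell b (Loc.inner.val b)).dist 2) *
      Arr.byLock.cell b (Arr.name.cell b (Loc.inner.val b))))

/-- One event of the sweep. All marks are `0` or `1`. -/
def sweepStep : Cmd :=
  .assign (Loc.flag.addr b) (sweepFlag b) ;;
  .store (Arr.byThr.addr b) (Arr.thr.cell b (Loc.inner.val b))
    (1 - (1 - (Arr.byThr.cell b (Arr.thr.cell b (Loc.inner.val b)) + Loc.flag.val b))) ;;
  .store (Arr.byLock.addr b) (Arr.name.cell b (Loc.inner.val b))
    (1 - (1 - (Arr.byLock.cell b (Arr.name.cell b (Loc.inner.val b)) +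
      (1 - (Arr.code.cell b (Loc.inner.val b)).dist 3) * Loc.flag.val b))) ;;
  .store (Arr.tbl.addr b) (Loc.base.val b + Loc.inner.val b) (Loc.flag.val b)

/-- Computes the row of the reachability table that belongs to the position `src`, and writes it to
the cells from `base` on. -/
def sweep : Cmd :=
  clearMarks b ;; forLoop (Loc.inner.addr b) (Loc.size.addr b) (sweepStep b)

variable {b}

theorem clearMarks_can {τ : Table} {U : ℕ} {s : Store} (hs : Holds τ b s) (hU : τ.Le U) :
    Can U (clearMarks b) s (7 + τ.size * 20) fun s' => ∀ k < τ.size,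
      s'.mem (Arr.byThr.addr b) (τ.thr k) = 0 ∧ s'.mem (Arr.byLock.addr b) (τ.name k) = 0 := by
  have hU2 : 2 ≤ U := by have := hU.three; omega
  refine (can_forLoop (c := 8) hU2 (m := τ.size) (fun i s => Holds τ b s ∧ ∀ k < i,
      s.mem (Arr.byThr.addr b) (τ.thr k) = 0 ∧ s.mem (Arr.byLock.addr b) (τ.name k) = 0)
    (by simp) (by simp [Cmd.WritesReg]) (by simp [Cmd.WritesReg]) hs.size hU.size ?_ ?_).mono
    (by omega) fun s' _ h => h.2
  · simpa using hs
  · rintro k hk s ⟨hs, hz⟩ hik -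
    have hthr := hs.thr k hk
    have hname := hs.name k hk
    have := hU.size
    refine can_seq (n := 4) (m := 4) (can_store hU2 ?_ ?_ (can_store hU2 ?_ ?_ ?_))
    · simp [hik, hthr, hU.thr k hk]; omega
    · simp
    · simp [hik, hname, hU.name k hk]; omega
    · simp
    · refine ⟨by simpa using hs, fun i hi => ?_⟩
      rcases Nat.lt_succ_iff_lt_or_eq.1 hi with h | rfl
      · simp [hik, hthr, hname, hz i h]
      · simp [hik, hthr, hname]

open Classical in
theorem sweepStep_can {τ : Table} {U i β k : ℕ} {s : Store} (hs : Holds τ b s) (hU : τ.Le U)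
    (hk : k < τ.size) (hik : s.reg (Loc.inner.addr b) = k)
    (hi : s.reg (Loc.src.addr b) = i) (hiU : i ≤ U) (hβ : s.reg (Loc.base.addr b) = β) (hβU : β ≤ U)
    (FT FL : ℕ → ℕ → ℕ)
    (hFT : ∀ n u, FT n u = if ∃ m < n, τ.Reach i m ∧ τ.thr m = u then 1 else 0)
    (hFL : ∀ n l, FL n l = if ∃ m < n, τ.Reach i m ∧ τ.code m = 3 ∧ τ.name m = l then 1 else 0)
    (hm : ∀ k' < τ.size, s.mem (Arr.byThr.addr b) (τ.thr k') = FT k (τ.thr k') ∧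
        s.mem (Arr.byLock.addr b) (τ.name k') = FL k (τ.name k'))
    (ht : ∀ k' < k, s.mem (Arr.tbl.addr b) (β + k') = if τ.Reach i k' then 1 else 0) :
    Can U (sweepStep b) s 300 fun s' => Holds τ b s' ∧
      s'.reg (Loc.src.addr b) = i ∧ s'.reg (Loc.base.addr b) = β ∧
      (∀ k' < τ.size, s'.mem (Arr.byThr.addr b) (τ.thr k') = FT (k + 1) (τ.thr k') ∧
        s'.mem (Arr.byLock.addr b) (τ.name k') = FL (k + 1) (τ.name k')) ∧
      (∀ k' < k + 1, s'.mem (Arr.tbl.addr b) (β + k') = if τ.Reach i k' then 1 else 0) ∧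
      ∀ j, j < β → s'.mem (Arr.tbl.addr b) j = s.mem (Arr.tbl.addr b) j := by
  have hU2 : 2 ≤ U := by have := hU.three; omega
  have hthr := hs.thr k hk
  have hcode := hs.code k hk
  have hname := hs.name k hk
  have := hU.size
  have := hU.three
  have := hU.thr k hk
  have := hU.code k hk
  have := hU.name k hk
  obtain ⟨hmt, hml⟩ := hm k hk
  have hFT1 : FT k (τ.thr k) ≤ 1 := by rw [hFT]; split <;> omega
  have hFL1 : FL k (τ.name k) ≤ 1 := by rw [hFL]; split <;> omega
  have hor : ∀ (p q r : Prop) [Decidable p] [Decidable q] [Decidable r],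
      1 - (1 - ((if p then 1 else 0) + (if q then 1 else 0) +
      if r then 1 else 0)) = if p ∨ q ∨ r then 1 else 0 := by
    intro p q r _ _ _
    by_cases p <;> by_cases q <;> by_cases r <;> simp [*]
  -- the flag computed for event `k` tells whether `k` is reachable
  have hflag : 1 - (1 - ((1 - ((k - i) + (i - k))) + FT k (τ.thr k) +
      (1 - ((τ.code k - 2) + (2 - τ.code k))) * FL k (τ.name k))) =
      if τ.Reach i k then 1 else 0 := by
    have e1 : 1 - ((k - i) + (i - k)) = if k = i then 1 else 0 := by split <;> omega
    have e2 : (1 - ((τ.code k - 2) + (2 - τ.code k))) = if τ.code k = 2 then 1 else 0 := by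
      split <;> omega
    rw [e1, e2, hFT, hFL, ite_mul, zero_mul, one_mul, ← ite_and, hor]
    refine if_congr ?_ rfl rfl
    rw [Table.reach_iff (k := k)]
    refine or_congr_right ⟨?_, ?_⟩
    · rintro (⟨m, h1, h2, h3⟩ | ⟨h0, m, h1, h2, h3, h4⟩)
      · exact ⟨m, h1, h2, h1, hk, Or.inl h3⟩
      · exact ⟨m, h1, h2, h1, hk, Or.inr ⟨h3, h0, h4⟩⟩
    · rintro ⟨m, h1, h2, -, -, h3 | ⟨h3, h0, h4⟩⟩
      · exact Or.inl ⟨m, h1, h2, h3⟩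
      · exact Or.inr ⟨h0, m, h1, h2, h3, h4⟩
  have hFTs : ∀ u, FT (k + 1) u = if τ.Reach i k ∧ τ.thr k = u then 1 else FT k u := by
    intro u
    rw [hFT, hFT]
    simp only [Nat.lt_succ_iff_lt_or_eq]
    by_cases h : τ.Reach i k ∧ τ.thr k = u
    · rw [if_pos h, if_pos ⟨k, Or.inr rfl, h⟩]
    · rw [if_neg h]
      congr 1
      simp only [eq_iff_iff]
      exact ⟨fun ⟨m, hm, h'⟩ => ⟨m, hm.resolve_right (by rintro rfl; exact h h'), h'⟩,
        fun ⟨m, hm, h'⟩ => ⟨m, Or.inl hm, h'⟩⟩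
  have hFLs : ∀ u, FL (k + 1) u =
      if τ.Reach i k ∧ τ.code k = 3 ∧ τ.name k = u then 1 else FL k u := by
    intro u
    rw [hFL, hFL]
    simp only [Nat.lt_succ_iff_lt_or_eq]
    by_cases h : τ.Reach i k ∧ τ.code k = 3 ∧ τ.name k = u
    · rw [if_pos h, if_pos ⟨k, Or.inr rfl, h⟩]
    · rw [if_neg h]
      congr 1
      simp only [eq_iff_iff]
      exact ⟨fun ⟨m, hm, h'⟩ => ⟨m, hm.resolve_right (by rintro rfl; exact h h'), h'⟩,
        fun ⟨m, hm, h'⟩ => ⟨m, Or.inl hm, h'⟩⟩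
  clear hFT hFL
  have hv : (sweepFlag b).eval s = if τ.Reach i k then 1 else 0 := by
    simpa [sweepFlag, Expr.eval_dist, hik, hi, hthr, hcode, hname, hmt, hml] using hflag
  have hv1 : (sweepFlag b).eval s ≤ 1 := by rw [hv]; split <;> omega
  have hb : (sweepFlag b).Bdd U s := by
    simp [sweepFlag, hik, hi, hthr, hcode, hname, hmt, hml]; omega
  refine Can.mono (n := (sweepStep b).weight) ?_ (by simp [sweepStep, sweepFlag, Cmd.weight])
    fun _ _ h => h
  refine canw_seq (canw_assign hU2 hb ?_)
  generalize (sweepFlag b).eval s = v at hv hv1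
  refine canw_seq (canw_store hU2 ?_ ?_ ?_)
  · simp [hik, hthr]; omega
  · simp [hik, hthr, hmt]; omega
  refine canw_seq (canw_store hU2 ?_ ?_ ?_)
  · simp [hik, hname]; omega
  · simp [hik, hname, hcode, hml]; omega
  refine canw_store hU2 ?_ ?_ ?_
  · simp [hik, hβ]; omega
  · simp; omega
  refine ⟨by simpa using hs, by simpa using hi, by simpa using hβ, fun k' hk' => ?_,
    fun k' hk' => ?_, fun j hj => ?_⟩
  · rw [hFTs, hFLs, ← (hm k' hk').1, ← (hm k' hk').2]
    constructor
    · simp only [Store.setMem_mem, Store.setReg_mem, Store.setReg_reg, Store.setMem_reg, hik, hthr,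
        Arr.addr_inj, Loc.addr_inj, reduceCtorEq, false_and, if_false, Expr.eval_cell,
        Expr.eval_val,
        Expr.eval_sub, Expr.eval_add, Expr.eval_ofNat, hmt, hv, true_and, if_true]
      by_cases h : τ.thr k' = τ.thr k
      · rw [if_pos h, h, hmt]
        by_cases hr : τ.Reach i k
        · simp [hr]
        · simp [hr]; omega
      · rw [if_neg h, if_neg fun h' => h h'.2.symm]
    · simp only [Store.setMem_mem, Store.setReg_mem, Store.setReg_reg, Store.setMem_reg, hik, hname,
        hcode, Arr.addr_inj, Loc.addr_inj, reduceCtorEq, false_and, if_false, Expr.eval_cell,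
        Expr.eval_val, Expr.eval_sub, Expr.eval_add, Expr.eval_mul, Expr.eval_dist,
        Expr.eval_ofNat, hml, hv, true_and, if_true]
      by_cases h : τ.name k' = τ.name k
      · rw [if_pos h, h, hml]
        by_cases hr : τ.Reach i k
        · by_cases h3 : τ.code k = 3
          · simp [hr, h3]
          · have : 1 - (τ.code k - 3 + (3 - τ.code k)) = 0 := by omega
            simp [h3, this]; omega
        · simp [hr]; omega
      · rw [if_neg h, if_neg fun h' => h h'.2.2.symm]
  · rcases Nat.lt_succ_iff_lt_or_eq.1 hk' with h | rfl
    · simp [hik, hβ, h.ne, ht k' h]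
    · simp [hik, hβ, hv]
  · simp [hik, hβ, show j ≠ β + k by omega]

/-- The result of a sweep from `i`: the cells from `β` on hold the reachability from `i`, and the
cells below are unchanged. -/
def SweepPost (τ : Table) (b i β : ℕ) (s s' : Store) : Prop :=
  (∀ k < τ.size, (s'.mem (Arr.tbl.addr b) (β + k) ≠ 0 ↔ τ.Reach i k) ∧
    s'.mem (Arr.tbl.addr b) (β + k) ≤ 1) ∧
  ∀ j < β, s'.mem (Arr.tbl.addr b) j = s.mem (Arr.tbl.addr b) j

theorem sweep_can {τ : Table} {U i β : ℕ} {s : Store} (hs : Holds τ b s) (hU : τ.Le U)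
    (hi : s.reg (Loc.src.addr b) = i) (hiU : i ≤ U) (hβ : s.reg (Loc.base.addr b) = β)
    (hβU : β ≤ U) : Can U (sweep b) s (14 + τ.size * 330) (SweepPost τ b i β s) := by
  classical
  have hU2 : 2 ≤ U := by have := hU.three; omega
  refine Can.mono (n := (7 + τ.size * 20) + (7 + τ.size * (300 + 10))) (can_seq
    ((clearMarks_can hs hU).mono le_rfl (Q' := fun s' => Can U _ s' _ _) fun s₁ hf hz => ?_))
    (by omega) fun _ _ h => h
  have hs₁ : Holds τ b s₁ := hs.of_frame hf (by simp [clearMarks, forLoop, Cmd.WritesReg])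
    (by simp [clearMarks, forLoop, Cmd.WritesMem]) (by simp [clearMarks, forLoop, Cmd.WritesMem])
    (by simp [clearMarks, forLoop, Cmd.WritesMem])
  have hi₁ : s₁.reg (Loc.src.addr b) = i :=
    (hf.1 _ (by simp [clearMarks, forLoop, Cmd.WritesReg])).trans hi
  have hβ₁ : s₁.reg (Loc.base.addr b) = β :=
    (hf.1 _ (by simp [clearMarks, forLoop, Cmd.WritesReg])).trans hβ
  have ht₁ : s₁.mem (Arr.tbl.addr b) = s.mem (Arr.tbl.addr b) :=
    hf.2 _ (by simp [clearMarks, forLoop, Cmd.WritesMem])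
  obtain ⟨FT, hFT⟩ : ∃ FT : ℕ → ℕ → ℕ,
      ∀ n u, FT n u = if ∃ m < n, τ.Reach i m ∧ τ.thr m = u then 1 else 0 := ⟨_, fun _ _ => rfl⟩
  obtain ⟨FL, hFL⟩ : ∃ FL : ℕ → ℕ → ℕ, ∀ n l, FL n l =
      if ∃ m < n, τ.Reach i m ∧ τ.code m = 3 ∧ τ.name m = l then 1 else 0 := ⟨_, fun _ _ => rfl⟩
  refine (can_forLoop (c := 300) hU2 (m := τ.size) (fun n s => Holds τ b s ∧
      s.reg (Loc.src.addr b) = i ∧ s.reg (Loc.base.addr b) = β ∧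
      (∀ k < τ.size, s.mem (Arr.byThr.addr b) (τ.thr k) = FT n (τ.thr k) ∧
        s.mem (Arr.byLock.addr b) (τ.name k) = FL n (τ.name k)) ∧
      (∀ k < n, s.mem (Arr.tbl.addr b) (β + k) = if τ.Reach i k then 1 else 0) ∧
      (∀ j, j < β → s.mem (Arr.tbl.addr b) j = s₁.mem (Arr.tbl.addr b) j))
    (by simp) (by simp [sweepStep, Cmd.WritesReg]) (by simp [sweepStep, Cmd.WritesReg])
    hs₁.size hU.size ?_ ?_).mono le_rfl fun s' _ h =>
      ⟨fun k hk => ?_, fun j hj => (h.2.2.2.2.2 j hj).trans (by rw [ht₁])⟩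
  · exact ⟨by simpa using hs₁, by simpa using hi₁, by simpa using hβ₁,
      fun k hk => by simpa [hFT, hFL] using hz k hk, by simp, fun j _ => rfl⟩
  · rintro k hk s₂ ⟨hs, hi, hβ, hm, ht, ho⟩ hik -
    refine (sweepStep_can hs hU hk hik hi hiU hβ hβU FT FL hFT hFL hm ht).mono le_rfl ?_
    rintro s₃ - ⟨h1, h2, h3, h4, h5, h6⟩
    exact ⟨by simpa using h1, by simpa using h2, by simpa using h3, h4, h5,
      fun j hj => (h6 j hj).trans (ho j hj)⟩
  · rw [h.2.2.2.2.1 k hk]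
    by_cases hr : τ.Reach i k <;> simp [hr]

theorem sweep_wlp {τ : Table} {V : ℕ} {s : Store} (hs : Holds τ b s) (hV : τ.Le V) :
    Wlp (sweep b) s (SweepPost τ b (s.reg (Loc.src.addr b)) (s.reg (Loc.base.addr b)) s) :=
  (sweep_can (U := V + s.reg (Loc.src.addr b) + s.reg (Loc.base.addr b)) hs (hV.mono (by omega)) rfl
    (by omega) rfl (by omega)).wlp
    (by simp [sweep, clearMarks, sweepStep, forLoop, Cmd.Deterministic])

end

section

/-! ### Certifying the absence of races -/

/-- The rows of the reachability table that belong to the hubs `0, …, m - 1` are sound. -/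
def SoundRows (τ : Table) (b m : ℕ) (s : Store) : Prop :=
  ∀ q < m, ∀ k < τ.size, s.mem (Arr.tbl.addr b) (q * τ.size + k) ≠ 0 →
    τ.Reach (s.mem (Arr.hub.addr b) q) k

/-- The rows are exactly those of the hubs `S 0, …, S (m - 1)`. -/
def ExactRows (τ : Table) (b m : ℕ) (S : ℕ → ℕ) (s : Store) : Prop :=
  ∀ q < m, s.mem (Arr.hub.addr b) q = S q ∧ ∀ k < τ.size,
    (s.mem (Arr.tbl.addr b) (q * τ.size + k) ≠ 0 ↔ τ.Reach (S q) k) ∧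
    s.mem (Arr.tbl.addr b) (q * τ.size + k) ≤ 1

section
variable (b : ℕ)

/-- Guesses `count` many hubs and computes their rows of the reachability table. -/
def buildTable : Cmd :=
  forLoop (Loc.idx.addr b) (Loc.count.addr b)
    (.guess (Loc.src.addr b) ;;
     .store (Arr.hub.addr b) (Loc.idx.val b) (Loc.src.val b) ;;
     .assign (Loc.base.addr b) (Loc.idx.val b * Loc.size.val b) ;;
     sweep b)

/-- Zero exactly if `(e, f)` is a generating pair of the happens-before order. -/
def stepTest (e f : Expr) : Expr :=
  (((e + 1) - f) + ((f + 1) - Loc.size.val b)) +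
    (Arr.thr.cell b e).dist (Arr.thr.cell b f) *
      ((Arr.code.cell b e).dist 3 + (Arr.code.cell b f).dist 2 +
        (Arr.name.cell b e).dist (Arr.name.cell b f))

/-- Zero exactly if the row of the hub `flag` certifies that `to` can be reached from `cur`. -/
def hubTest : Expr :=
  ((Loc.flag.val b + 1) - Loc.count.val b) +
    (Arr.hub.cell b (Loc.flag.val b)).dist (Loc.cur.val b) +
    (1 - Arr.tbl.cell b (Loc.flag.val b * Loc.size.val b + Loc.to.val b))

/-- Verifies that `to` can be reached from `fro`: guesses a path that leads to `to`, or to a hub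
whose row contains `to`. -/
def check : Cmd :=
  .assign (Loc.cur.addr b) (Loc.fro.val b) ;;
  .guess (Loc.len.addr b) ;;
  forLoop (Loc.step.addr b) (Loc.len.addr b)
    (.guess (Loc.nxt.addr b) ;;
     assertZero (stepTest b (Loc.cur.val b) (Loc.nxt.val b)) ;;
     .assign (Loc.cur.addr b) (Loc.nxt.val b)) ;;
  .guess (Loc.flag.addr b) ;;
  .ite (Loc.flag.val b)
    (assertZero ((Loc.cur.val b).dist (Loc.to.val b)))
    (.guess (Loc.flag.addr b) ;; assertZero (hubTest b))

/-- Clears the last writes, and guesses the first write to each variable. -/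
def initNext : Cmd :=
  forLoop (Loc.pos.addr b) (Loc.size.addr b)
    (.store (Arr.lastW.addr b) (Arr.name.cell b (Loc.pos.val b)) 0 ;;
     .guess (Loc.nxt.addr b) ;;
     .store (Arr.nextW.addr b) (Arr.name.cell b (Loc.pos.val b)) (Loc.nxt.val b))

/-- Verifies that the last write before the access `pos` is ordered before it. -/
def checkLast : Cmd :=
  .ite (Arr.lastW.cell b (Arr.name.cell b (Loc.pos.val b)))
    (.assign (Loc.fro.addr b) (Arr.lastW.cell b (Arr.name.cell b (Loc.pos.val b)) - 1) ;;
     .assign (Loc.to.addr b) (Loc.pos.val b) ;; check b)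
    .skip

/-- At a write: it has to be the predicted one; records it, and predicts the next one. -/
def visitWrite : Cmd :=
  assertZero ((Arr.nextW.cell b (Arr.name.cell b (Loc.pos.val b))).dist (Loc.pos.val b)) ;;
  .guess (Loc.nxt.addr b) ;;
  .store (Arr.nextW.addr b) (Arr.name.cell b (Loc.pos.val b)) (Loc.nxt.val b) ;;
  .store (Arr.lastW.addr b) (Arr.name.cell b (Loc.pos.val b)) (Loc.pos.val b + 1)

/-- At a read: verifies that it is ordered before the predicted next write. -/
def visitRead : Cmd :=
  .assign (Loc.to.addr b) (Arr.nextW.cell b (Arr.name.cell b (Loc.pos.val b))) ;;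
  .ite (Loc.size.val b - Loc.to.val b)
    (.assign (Loc.fro.addr b) (Loc.pos.val b) ;; check b)
    .skip

/-- Visits the event `pos`; acquires and releases are passed over. -/
def visit : Cmd :=
  .ite (Arr.code.cell b (Loc.pos.val b) - 1) .skip
    (checkLast b ;; .ite (Arr.code.cell b (Loc.pos.val b)) (visitWrite b) (visitRead b))

/-- Accepts only traces without races. For each variable, the cell of `lastW` holds the last write
so far (plus one, and zero if there is none), and the cell of `nextW` the predicted next write. -/
def certify : Cmd :=
  .guess (Loc.count.addr b) ;;
  buildTable b ;;
  initNext b ;;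
  forLoop (Loc.pos.addr b) (Loc.size.addr b) (visit b)

end

variable {b : ℕ} {τ : Table}

theorem buildTable_wlp {V m : ℕ} {s : Store} (hs : Holds τ b s) (hV : τ.Le V)
    (hm : s.reg (Loc.count.addr b) = m) :
    Wlp (buildTable b) s fun s' => Holds τ b s' ∧ SoundRows τ b m s' := by
  refine wlp_forLoop (fun q s => Holds τ b s ∧ SoundRows τ b q s) (by simp)
    (by simp [sweep, clearMarks, sweepStep, forLoop, Cmd.WritesReg])
    (by simp [sweep, clearMarks, sweepStep, forLoop, Cmd.WritesReg]) hm
    ⟨by simpa using hs, fun q hq => absurd hq (Nat.not_lt_zero q)⟩ ?_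
  clear hm hs s
  rintro q - s ⟨hs, hr⟩ hq -
  refine wlp_seq (wlp_guess fun v => wlp_seq (wlp_store (wlp_seq (wlp_assign ?_))))
  refine (sweep_wlp (τ := τ) (V := V) (by simpa using hs) hV).mono fun s' hf hp => ?_
  refine ⟨?_, fun q' hq' k hk hne => ?_⟩
  · rw [holds_setReg (by simp)]
    refine Holds.of_frame ?_ hf ?_ ?_ ?_ ?_ <;>
      simp [hs, sweep, clearMarks, sweepStep, forLoop, Cmd.WritesReg, Cmd.WritesMem]
  · have hhub := hf.2 (Arr.hub.addr b)
      (by simp [sweep, clearMarks, sweepStep, forLoop, Cmd.WritesMem])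
    simp only [SweepPost] at hp
    simp [hq, hs.size] at hp
    simp only [Store.setReg_mem] at hne ⊢
    rw [hhub]
    rcases Nat.lt_succ_iff_lt_or_eq.1 hq' with h | rfl
    · have : q' * τ.size + k < q * τ.size := by
        calc q' * τ.size + k < (q' + 1) * τ.size := by rw [add_mul]; omega
          _ ≤ _ := Nat.mul_le_mul_right _ h
      rw [hp.2 _ this] at hne
      simpa [hq, h.ne] using hr q' h k hk hne
    · simpa [hq] using (hp.1 k hk).1.1 hne

theorem buildTable_can {U m : ℕ} {S : ℕ → ℕ} {s : Store} (hs : Holds τ b s) (hU : τ.Le U)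
    (hm : s.reg (Loc.count.addr b) = m) (hmU : m * τ.size ≤ U) (hmU' : m ≤ U) (hS : ∀ q, S q ≤ U) :
    Can U (buildTable b) s (7 + m * (50 + τ.size * 330)) fun s' =>
      Holds τ b s' ∧ ExactRows τ b m S s' := by
  have hU2 : 2 ≤ U := by have := hU.three; omega
  refine (can_forLoop (c := 2 + (3 + (5 + (14 + τ.size * 330)))) hU2 (m := m)
    (fun q s => Holds τ b s ∧ ExactRows τ b q S s) (by simp)
    (by simp [sweep, clearMarks, sweepStep, forLoop, Cmd.WritesReg])
    (by simp [sweep, clearMarks, sweepStep, forLoop, Cmd.WritesReg]) hm hmU'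
    ⟨by simpa using hs, fun q hq => absurd hq (Nat.not_lt_zero q)⟩ ?_).mono
    (Nat.add_le_add_left (Nat.mul_le_mul_left _ (by omega)) _) fun _ _ h => h
  clear hm hs s
  rintro q hqm s ⟨hs, hr⟩ hq -
  have hqU : q * τ.size ≤ U := (Nat.mul_le_mul_right _ hqm.le).trans hmU
  have := hU.size
  refine can_seq (can_guess (S q) (hS q) (can_seq (can_store (i := Loc.idx.val b)
    (e := Loc.src.val b) hU2 ?_ ?_ (can_seq (n := 5) (can_assign hU2 ?_ ?_)))))
  · simp [hq]; omega
  · simp [hS q]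
  · simp [hq, hs.size]; omega
  refine (sweep_can (τ := τ) (i := S q) (β := q * τ.size) (by simpa using hs) hU (by simp) (hS q)
    (by simp [hq, hs.size]) hqU).mono le_rfl fun s' hf hp => ?_
  refine ⟨?_, fun q' hq' => ?_⟩
  · rw [holds_setReg (by simp)]
    refine Holds.of_frame ?_ hf ?_ ?_ ?_ ?_ <;>
      simp [hs, sweep, clearMarks, sweepStep, forLoop, Cmd.WritesReg, Cmd.WritesMem]
  · have hhub := hf.2 (Arr.hub.addr b)
      (by simp [sweep, clearMarks, sweepStep, forLoop, Cmd.WritesMem])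
    simp only [Store.setReg_mem]
    rw [hhub]
    rcases Nat.lt_succ_iff_lt_or_eq.1 hq' with h | rfl
    · refine ⟨by simpa [hq, h.ne] using (hr q' h).1, fun k hk => ?_⟩
      have : q' * τ.size + k < q * τ.size := by
        calc q' * τ.size + k < (q' + 1) * τ.size := by rw [add_mul]; omega
          _ ≤ _ := Nat.mul_le_mul_right _ h
      rw [hp.2 _ this]
      simpa using (hr q' h).2 k hk
    · exact ⟨by simp [hq], hp.1⟩

theorem eval_stepTest {s : Store} (hs : Holds τ b s) (e f : Expr) :
    (stepTest b e f).eval s = 0 ↔ τ.Step (e.eval s) (f.eval s) := by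
  simp only [stepTest, Expr.eval_add, Expr.eval_sub, Expr.eval_mul, Expr.eval_val, Expr.eval_ofNat,
    Nat.add_eq_zero_iff, Nat.mul_eq_zero, Expr.eval_dist_eq_zero, Expr.eval_cell, hs.size,
    Table.Step]
  constructor
  · rintro ⟨⟨h1, h2⟩, h3⟩
    have hf : f.eval s < τ.size := by omega
    have he : e.eval s < τ.size := by omega
    rw [hs.thr _ he, hs.thr _ hf, hs.code _ he, hs.code _ hf, hs.name _ he, hs.name _ hf] at h3
    exact ⟨by omega, hf, h3.imp_right fun h => ⟨h.1.1, h.1.2, h.2⟩⟩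
  · rintro ⟨h1, hf, h3⟩
    have he : e.eval s < τ.size := by omega
    rw [hs.thr _ he, hs.thr _ hf, hs.code _ he, hs.code _ hf, hs.name _ he, hs.name _ hf]
    exact ⟨⟨by omega, by omega⟩, h3.imp_right fun h => ⟨⟨h.1, h.2.1⟩, h.2.2⟩⟩

theorem bdd_stepTest {U : ℕ} {s : Store} (hs : Holds τ b s) (hU : τ.Le U) {e f : Expr}
    (he : e.Bdd U s) (hf : f.Bdd U s) (he' : e.eval s < τ.size) (hf' : f.eval s < τ.size) :
    (stepTest b e f).Bdd U s := by
  have := hU.three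
  have := hU.size
  simp only [stepTest, Expr.bdd_add, Expr.bdd_sub, Expr.bdd_mul, Expr.bdd_dist, Expr.bdd_cell,
    Expr.bdd_val, Expr.bdd_ofNat, hs.size, hs.thr _ he', hs.thr _ hf', hs.code _ he',
    hs.code _ hf', hs.name _ he', hs.name _ hf', hU.thr _ he', hU.thr _ hf', hU.code _ he',
    hU.code _ hf', hU.name _ he', hU.name _ hf', he, hf, and_true, true_and]
  omega

theorem check_wlp {m : ℕ} {s : Store} (hs : Holds τ b s) (hr : SoundRows τ b m s)
    (hm : s.reg (Loc.count.addr b) = m) (hto : s.reg (Loc.to.addr b) < τ.size) :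
    Wlp (check b) s fun _ => τ.Reach (s.reg (Loc.fro.addr b)) (s.reg (Loc.to.addr b)) := by
  set a := s.reg (Loc.fro.addr b)
  set c := s.reg (Loc.to.addr b) with hc
  refine wlp_seq (wlp_assign (wlp_seq (wlp_guess fun n => wlp_seq ?_)))
  refine (wlp_forLoop (m := n) (fun _ s' => Holds τ b s' ∧ SoundRows τ b m s' ∧
    s'.reg (Loc.count.addr b) = m ∧ s'.reg (Loc.to.addr b) = c ∧
    τ.Reach a (s'.reg (Loc.cur.addr b)))
    (by simp) (by simp [assertZero, Cmd.WritesReg]) (by simp [assertZero, Cmd.WritesReg])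
    (by simp) ?_ ?_).mono ?_
  · exact ⟨by simpa using hs, hr, by simpa using hm, by simp [hc], by simpa using .refl⟩
  · rintro t - s' ⟨hs, hr, hm, hto, hreach⟩ - -
    refine wlp_seq (wlp_guess fun v => wlp_seq (wlp_assertZero fun h0 => wlp_assign ?_))
    rw [eval_stepTest (τ := τ) (by simpa using hs)] at h0
    simp only [Expr.eval_val, Store.setReg_reg, Loc.addr_inj, reduceCtorEq, if_false, if_true] at h0
    exact ⟨by simpa using hs, hr, by simpa using hm, by simpa using hto,
      by simpa using (show τ.Reach a v from hreach.tail h0)⟩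
  · rintro s' - ⟨hs, hr, hm, hto', hreach⟩
    refine wlp_seq (wlp_guess fun f => wlp_ite (fun _ => wlp_assertZero fun h0 => ?_) fun _ =>
      wlp_seq (wlp_guess fun q => wlp_assertZero fun h0 => ?_))
    · rw [Expr.eval_dist_eq_zero] at h0
      simp only [Expr.eval_val, Store.setReg_reg, Loc.addr_inj, reduceCtorEq, if_false] at h0
      rwa [h0, hto'] at hreach
    · simp only [hubTest, Expr.eval_add, Expr.eval_sub, Expr.eval_mul, Expr.eval_val,
        Expr.eval_ofNat, Nat.add_eq_zero_iff, Expr.eval_dist_eq_zero, Expr.eval_cell, hs.size, hm,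
        hto', Store.setReg_reg, Store.setReg_mem, Loc.addr_inj, reduceCtorEq, if_false,
        if_true] at h0
      have := hr q (by omega) c hto (by omega)
      rw [h0.1.2] at this
      exact hreach.trans this

theorem check_can {U K m : ℕ} {S : ℕ → ℕ} {s : Store} (hs : Holds τ b s) (hU : τ.Le U)
    (hr : ExactRows τ b m S s) (hm : s.reg (Loc.count.addr b) = m) (hKU : K ≤ U) (hmU : m ≤ U)
    (hS : ∀ q, S q ≤ U)
    (hfro : s.reg (Loc.fro.addr b) < τ.size) (hto : s.reg (Loc.to.addr b) < τ.size)
    (hc : τ.Cert K m S (s.reg (Loc.fro.addr b)) (s.reg (Loc.to.addr b))) :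
    Can U (check b) s (200 + K * 160) fun _ => True := by
  have hU2 : 2 ≤ U := by have := hU.three; omega
  have h3U := hU.three
  have hsU := hU.size
  obtain ⟨n, p, hnK, h0, hp, hend⟩ := hc
  have hpU : ∀ t ≤ n, p t < τ.size := by
    intro t ht
    rcases Nat.eq_zero_or_pos t with rfl | h
    · omega
    · obtain ⟨t, rfl⟩ : ∃ u, t = u + 1 := ⟨t - 1, by omega⟩
      exact (hp t (by omega)).2.1
  refine Can.mono (n := 2 + (2 + ((7 + n * (150 + 10)) + (2 + 150)))) ?_ (by omega) fun _ _ h => h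
  refine can_seq (can_assign (e := Loc.fro.val b) hU2 (by simp; omega)
    (can_seq (can_guess n (by omega) (can_seq ?_))))
  refine (can_forLoop (c := 150) (m := n) hU2 (fun t s' => Holds τ b s' ∧ ExactRows τ b m S s' ∧
    s'.reg (Loc.count.addr b) = m ∧ s'.reg (Loc.to.addr b) = s.reg (Loc.to.addr b) ∧
    s'.reg (Loc.cur.addr b) = p t)
    (by simp) (by simp [assertZero, Cmd.WritesReg]) (by simp [assertZero, Cmd.WritesReg])
    (by simp) (by omega) ?_ ?_).mono le_rfl ?_
  · exact ⟨by simpa using hs, hr, by simpa using hm, by simp, by simpa using h0.symm⟩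
  · rintro t ht s' ⟨hs, hr, hm, hto, hcur⟩ - -
    have hp1 := hpU t ht.le
    have hp2 := hpU (t + 1) ht
    refine Can.mono (n := Cmd.weight _) (canw_seq (canw_guess (p (t + 1)) (by omega)
      (canw_seq (canw_assertZero hU2 (bdd_stepTest (τ := τ) ?_ hU ?_ ?_ ?_ ?_) ?_
      (canw_assign hU2 ?_ ?_))))) (by simp [Cmd.weight, assertZero, stepTest]) fun _ _ h => h
    · simpa using hs
    · simp [hcur]; omega
    · simp; omega
    · simpa [hcur] using hp1
    · simpa using hp2
    · rw [eval_stepTest (τ := τ) (by simpa using hs)]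
      simpa [hcur] using hp t ht
    · simp; omega
    · exact ⟨by simpa using hs, hr, by simpa using hm, by simpa using hto, by simp⟩
  · rintro s' - ⟨hs, hr, hm, hto', hcur⟩
    have hpn := hpU n le_rfl
    refine can_seq (can_guess (if p n = s.reg (Loc.to.addr b) then 1 else 0)
      (by split <;> omega) ?_)
    refine Can.mono (n := Cmd.weight _) (canw_ite hU2 ?_ (fun h => ?_) fun h => ?_)
      (by simp [Cmd.weight, assertZero, hubTest]) fun _ _ h => h
    · simp; split <;> omega
    · refine canw_assertZero hU2 ?_ ?_ trivial
      · simp [hcur, hto']; omega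
      · rw [Expr.eval_dist_eq_zero]
        simpa [hcur, hto'] using h
    · obtain ⟨q, hq, hqn, hqr⟩ := hend.resolve_left (by simpa using h)
      obtain ⟨hh, hrow⟩ := hr q hq
      obtain ⟨hrow, hrow1⟩ := hrow _ hto
      refine canw_seq (canw_guess q (by omega) (canw_assertZero hU2 ?_ ?_ trivial))
      · simp [hubTest, hs.size, hm, hh, hto', hcur]
        have := hS q
        omega
      · have := hrow.2 hqr
        simp [hubTest, hs.size, hm, hh, hto', hcur, Expr.eval_dist]
        omega

end

section

variable {b : ℕ} {τ : Table}

/-! ### Soundness of the certificates for the absence of races -/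

/-- What is known after the first `k` events have been visited: the conflicting accesses among them
are ordered, `lw` holds the last writes (plus one), and the reads whose next write has not been
visited are ordered before the prediction `nx` of that write. -/
structure VisitInv (τ : Table) (k : ℕ) (lw nx : ℕ → ℕ) : Prop where
  ordered : ∀ i j, i < j → j < k → τ.Touch i j → τ.Reach i j
  last_zero : ∀ i < τ.size, lw (τ.name i) = 0 → ∀ w < k, τ.code w = 1 → τ.name w ≠ τ.name i
  last_succ : ∀ i < τ.size, ∀ p, lw (τ.name i) = p + 1 → p < k ∧ τ.code p = 1 ∧
    τ.name p = τ.name i ∧ ∀ w, p < w → w < k → τ.code w = 1 → τ.name w ≠ τ.name i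
  pending : ∀ i < k, τ.code i = 0 →
    (∀ w, i < w → w < k → τ.code w = 1 → τ.name w ≠ τ.name i) →
    nx (τ.name i) < τ.size → τ.Reach i (nx (τ.name i))

theorem VisitInv.write_before {k : ℕ} {lw nx : ℕ → ℕ} (h : VisitInv τ k lw nx) (hk : k < τ.size)
    (hl : lw (τ.name k) ≠ 0 → τ.Reach (lw (τ.name k) - 1) k) {w : ℕ}
    (hw : w < k) (hw1 : τ.code w = 1) (hwk : τ.name w = τ.name k) : τ.Reach w k := by
  rcases Nat.eq_zero_or_pos (lw (τ.name k)) with h0 | h0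
  · exact absurd hwk (h.last_zero k hk h0 w hw hw1)
  · obtain ⟨p, hp⟩ : ∃ p, lw (τ.name k) = p + 1 := ⟨lw (τ.name k) - 1, by omega⟩
    obtain ⟨h1, h2, h3, h4⟩ := h.last_succ k hk p hp
    have hpk : τ.Reach p k := by simpa [hp] using hl (by omega)
    rcases lt_trichotomy w p with hlt | rfl | hlt
    · exact (h.ordered w p hlt h1 ⟨hwk.trans h3.symm, by omega, by omega, by omega⟩).trans hpk
    · exact hpk
    · exact absurd hwk (h4 w hlt hw hw1)

theorem VisitInv.other {k : ℕ} {lw nx : ℕ → ℕ} (h : VisitInv τ k lw nx) (hk2 : 2 ≤ τ.code k) :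
    VisitInv τ (k + 1) lw nx where
  ordered i j hij hj ht := by
    rcases Nat.lt_succ_iff_lt_or_eq.1 hj with hj | rfl
    · exact h.ordered i j hij hj ht
    · have := ht.2.2.1; omega
  last_zero i hi h0 w hw hw1 := by
    rcases Nat.lt_succ_iff_lt_or_eq.1 hw with hw | rfl
    · exact h.last_zero i hi h0 w hw hw1
    · omega
  last_succ i hi p hp := by
    obtain ⟨h1, h2, h3, h4⟩ := h.last_succ i hi p hp
    refine ⟨by omega, h2, h3, fun w hpw hw hw1 => ?_⟩
    rcases Nat.lt_succ_iff_lt_or_eq.1 hw with hw | rfl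
    · exact h4 w hpw hw hw1
    · omega
  pending i hi hi0 hn := by
    rcases Nat.lt_succ_iff_lt_or_eq.1 hi with hi | rfl
    · exact h.pending i hi hi0 fun w h1 h2 => hn w h1 (by omega)
    · omega

theorem VisitInv.read {k : ℕ} {lw nx : ℕ → ℕ} (h : VisitInv τ k lw nx) (hk : k < τ.size)
    (hk0 : τ.code k = 0) (hl : lw (τ.name k) ≠ 0 → τ.Reach (lw (τ.name k) - 1) k)
    (hx : nx (τ.name k) < τ.size → τ.Reach k (nx (τ.name k))) : VisitInv τ (k + 1) lw nx where
  ordered i j hij hj ht := by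
    rcases Nat.lt_succ_iff_lt_or_eq.1 hj with hj | rfl
    · exact h.ordered i j hij hj ht
    · obtain ⟨h1, h2, h3, h4⟩ := ht
      exact h.write_before hk hl hij (by omega) h1
  last_zero i hi h0 w hw hw1 := by
    rcases Nat.lt_succ_iff_lt_or_eq.1 hw with hw | rfl
    · exact h.last_zero i hi h0 w hw hw1
    · omega
  last_succ i hi p hp := by
    obtain ⟨h1, h2, h3, h4⟩ := h.last_succ i hi p hp
    refine ⟨by omega, h2, h3, fun w hpw hw hw1 => ?_⟩
    rcases Nat.lt_succ_iff_lt_or_eq.1 hw with hw | rfl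
    · exact h4 w hpw hw hw1
    · omega
  pending i hi hi0 hn := by
    rcases Nat.lt_succ_iff_lt_or_eq.1 hi with hi | rfl
    · exact h.pending i hi hi0 fun w h1 h2 => hn w h1 (by omega)
    · exact hx

theorem VisitInv.write {k : ℕ} {lw nx lw' nx' : ℕ → ℕ} (h : VisitInv τ k lw nx) (hk : k < τ.size)
    (hk1 : τ.code k = 1) (hl : lw (τ.name k) ≠ 0 → τ.Reach (lw (τ.name k) - 1) k)
    (hx : nx (τ.name k) = k) (hlw : ∀ x, lw' x = if x = τ.name k then k + 1 else lw x)
    (hnx : ∀ x, x ≠ τ.name k → nx' x = nx x) : VisitInv τ (k + 1) lw' nx' where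
  ordered i j hij hj ht := by
    rcases Nat.lt_succ_iff_lt_or_eq.1 hj with hj | rfl
    · exact h.ordered i j hij hj ht
    · obtain ⟨h1, h2, h3, h4⟩ := ht
      rcases Nat.eq_zero_or_pos (τ.code i) with hi0 | hi1
      · -- a read: either some write lies in between, or `j` is its next write
        by_cases hn : ∀ w, i < w → w < j → τ.code w = 1 → τ.name w ≠ τ.name i
        · have := h.pending i hij hi0 hn (by rw [h1, hx]; exact hk)
          rwa [h1, hx] at this
        · push Not at hn
          obtain ⟨w, hiw, hwj, hw1, hwi⟩ := hn
          exact (h.ordered i w hiw hwj ⟨hwi.symm, h2, by omega, by omega⟩).trans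
            (h.write_before hk hl hwj hw1 (hwi.trans h1))
      · exact h.write_before hk hl hij (by omega) h1
  last_zero i hi h0 w hw hw1 := by
    rw [hlw] at h0
    split at h0
    · omega
    · rename_i hne
      rcases Nat.lt_succ_iff_lt_or_eq.1 hw with hw | rfl
      · exact h.last_zero i hi h0 w hw hw1
      · exact Ne.symm hne
  last_succ i hi p hp := by
    rw [hlw] at hp
    split at hp
    · rename_i he
      obtain rfl : k = p := by omega
      exact ⟨by omega, hk1, he.symm, fun w h1 h2 => by omega⟩
    · rename_i hne
      obtain ⟨h1, h2, h3, h4⟩ := h.last_succ i hi p hp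
      refine ⟨by omega, h2, h3, fun w hpw hw hw1 => ?_⟩
      rcases Nat.lt_succ_iff_lt_or_eq.1 hw with hw | rfl
      · exact h4 w hpw hw hw1
      · exact Ne.symm hne
  pending i hi hi0 hn := by
    rcases Nat.lt_succ_iff_lt_or_eq.1 hi with hi | rfl
    · rw [hnx _ (Ne.symm (hn k hi (by omega) hk1))]
      exact h.pending i hi hi0 fun w h1 h2 => hn w h1 (by omega)
    · omega

theorem frame_check_holds {s s' : Store} (hs : Holds τ b s) (hf : Frame (check b) s s') :
    Holds τ b s' := by
  refine hs.of_frame hf ?_ ?_ ?_ ?_ <;>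
    simp [check, forLoop, assertZero, Cmd.WritesReg, Cmd.WritesMem]

theorem frame_check_reg {s s' : Store} (hf : Frame (check b) s s') {x : Loc}
    (h1 : x ≠ .cur) (h2 : x ≠ .len) (h3 : x ≠ .step) (h4 : x ≠ .nxt) (h5 : x ≠ .flag) :
    s'.reg (x.addr b) = s.reg (x.addr b) :=
  hf.1 _ (by simp [check, forLoop, assertZero, Cmd.WritesReg, *, Ne.symm h1, Ne.symm h2,
    Ne.symm h3, Ne.symm h4, Ne.symm h5])

theorem frame_check_mem {s s' : Store} (hf : Frame (check b) s s') : s'.mem = s.mem :=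
  funext fun _ => hf.2 _ (by simp [check, forLoop, assertZero, Cmd.WritesMem])

/-- The part of the state on which `visit` relies for calls of `check`. -/
def Ready (τ : Table) (b m k : ℕ) (s : Store) : Prop :=
  Holds τ b s ∧ s.reg (Loc.count.addr b) = m ∧ s.reg (Loc.pos.addr b) = k

theorem Ready.check {m k : ℕ} {s s' : Store} (h : Ready τ b m k s) (hf : Frame (check b) s s') :
    Ready τ b m k s' :=
  ⟨frame_check_holds h.1 hf, by rw [frame_check_reg hf] <;> simp [h.2.1],
    by rw [frame_check_reg hf] <;> simp [h.2.2]⟩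

@[simp] theorem ready_setReg {m k : ℕ} {s : Store} {x : Loc} {v : ℕ} (h1 : x ≠ .size)
    (h2 : x ≠ .count) (h3 : x ≠ .pos) :
    Ready τ b m k (s.setReg (x.addr b) v) ↔ Ready τ b m k s := by
  simp [Ready, h1, h2.symm, h3.symm]

theorem checkLast_wlp {m k : ℕ} {s : Store} (hs : Ready τ b m k s) (hr : SoundRows τ b m s)
    (hk : k < τ.size) :
    Wlp (checkLast b) s fun s' => Ready τ b m k s' ∧ s'.mem = s.mem ∧
      (s.mem (Arr.lastW.addr b) (τ.name k) ≠ 0 →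
        τ.Reach (s.mem (Arr.lastW.addr b) (τ.name k) - 1) k) := by
  obtain ⟨h1, h2, h3⟩ := hs
  have hname := h1.name k hk
  refine wlp_ite (fun h => wlp_seq (wlp_assign (wlp_seq (wlp_assign ?_)))) fun h => wlp_skip ?_
  · refine Wlp.mono (check_wlp (τ := τ) (m := m) ?_ ?_ ?_ ?_) fun s' hf hreach => ?_
    · simpa using h1
    · simpa [SoundRows] using hr
    · simpa using h2
    · simpa [h3] using hk
    refine ⟨Ready.check (by simpa using ⟨h1, h2, h3⟩) hf, (frame_check_mem hf).trans rfl,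
      fun _ => ?_⟩
    simpa [h3, hname] using hreach
  · refine ⟨⟨h1, h2, h3⟩, rfl, fun h' => absurd ?_ h'⟩
    simpa [h3, hname] using h

theorem visitWrite_wlp {m k : ℕ} {s : Store} (hs : Ready τ b m k s) (hk : k < τ.size) :
    Wlp (visitWrite b) s fun s' => Ready τ b m k s' ∧
      s'.mem (Arr.tbl.addr b) = s.mem (Arr.tbl.addr b) ∧
      s'.mem (Arr.hub.addr b) = s.mem (Arr.hub.addr b) ∧
      s.mem (Arr.nextW.addr b) (τ.name k) = k ∧
      (∀ x, s'.mem (Arr.lastW.addr b) x =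
        if x = τ.name k then k + 1 else s.mem (Arr.lastW.addr b) x) ∧
      ∀ x, x ≠ τ.name k → s'.mem (Arr.nextW.addr b) x = s.mem (Arr.nextW.addr b) x := by
  have hname := hs.1.name k hk
  obtain ⟨h1, h2, h3⟩ := hs
  refine wlp_seq (wlp_assertZero fun h => wlp_seq (wlp_guess fun v => wlp_seq (wlp_store
    (wlp_store ?_))))
  rw [Expr.eval_dist_eq_zero] at h
  refine ⟨⟨by simpa using h1, by simpa using h2, by simpa using h3⟩, ?_, ?_, ?_, ?_, ?_⟩
  · funext j; simp
  · funext j; simp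
  · simpa [h3, hname] using h
  · intro x; simp [h3, hname]
  · intro x hx; simp [h3, hname, hx]

theorem visitRead_wlp {m k : ℕ} {s : Store} (hs : Ready τ b m k s) (hr : SoundRows τ b m s)
    (hk : k < τ.size) :
    Wlp (visitRead b) s fun s' => Ready τ b m k s' ∧ s'.mem = s.mem ∧
      (s.mem (Arr.nextW.addr b) (τ.name k) < τ.size →
        τ.Reach k (s.mem (Arr.nextW.addr b) (τ.name k))) := by
  obtain ⟨h1, h2, h3⟩ := hs
  have hname := h1.name k hk
  refine wlp_seq (wlp_assign (wlp_ite (fun h => wlp_seq (wlp_assign ?_)) fun h => wlp_skip ?_))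
  · refine Wlp.mono (check_wlp (τ := τ) (m := m) ?_ ?_ ?_ ?_) fun s' hf hreach => ?_
    · simpa using h1
    · simpa [SoundRows] using hr
    · simpa using h2
    · simp [h3, hname, h1.size] at h
      simp [h3, hname]
      omega
    refine ⟨Ready.check (by simpa using ⟨h1, h2, h3⟩) hf, (frame_check_mem hf).trans rfl,
      fun _ => ?_⟩
    simpa [h3, hname] using hreach
  · refine ⟨by simpa using ⟨h1, h2, h3⟩, rfl, fun h' => ?_⟩
    simp [h3, hname, h1.size] at h
    omega

theorem certify_wlp {V : ℕ} {s : Store} (hs : Holds τ b s) (hV : τ.Le V) :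
    Wlp (certify b) s fun _ => τ.RaceFree := by
  refine wlp_seq (wlp_guess fun m => wlp_seq ((buildTable_wlp (τ := τ) (V := V) (m := m)
    (by simpa using hs) hV (by simp)).mono fun s hf ⟨hs, hr⟩ => wlp_seq ?_))
  have hm : s.reg (Loc.count.addr b) = m := by
    rw [hf.1 _ (by simp [buildTable, sweep, clearMarks, sweepStep, forLoop, Cmd.WritesReg])]
    simp
  clear hf
  refine (wlp_forLoop (m := τ.size) (fun k s' => Holds τ b s' ∧
      s'.reg (Loc.count.addr b) = m ∧ SoundRows τ b m s' ∧
      ∀ i < k, s'.mem (Arr.lastW.addr b) (τ.name i) = 0)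
      (by simp) (by simp [Cmd.WritesReg]) (by simp [Cmd.WritesReg]) hs.size ?_ ?_).mono ?_
  · exact ⟨by simpa using hs, by simpa using hm, hr, by simp⟩
  · rintro k hk s ⟨hs, hm, hr, hz⟩ hik -
    refine wlp_seq (wlp_store (wlp_seq (wlp_guess fun v => wlp_store ?_)))
    refine ⟨by simpa using hs, by simpa using hm, ?_, fun i hi => ?_⟩
    · simpa [SoundRows] using hr
    · rcases Nat.lt_succ_iff_lt_or_eq.1 hi with h | rfl
      · simp [hz i h]
      · simp [hik, hs.name i hk]
  rintro s - ⟨hs, hm, hr, hz⟩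
  refine (wlp_forLoop (m := τ.size) (fun k s' => Holds τ b s' ∧
      s'.reg (Loc.count.addr b) = m ∧ SoundRows τ b m s' ∧
      VisitInv τ k (s'.mem (Arr.lastW.addr b)) (s'.mem (Arr.nextW.addr b)))
      (by simp) ?_ ?_ hs.size ?_ ?_).mono fun s' _ h i j hij hj => h.2.2.2.ordered i j hij hj
  · simp [visit, checkLast, visitWrite, visitRead, check, forLoop, assertZero, Cmd.WritesReg]
  · simp [visit, checkLast, visitWrite, visitRead, check, forLoop, assertZero, Cmd.WritesReg]
  · refine ⟨by simpa using hs, by simpa using hm, hr, ?_⟩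
    exact ⟨fun i j _ hj => absurd hj (Nat.not_lt_zero j), fun i _ _ w hw =>
      absurd hw (Nat.not_lt_zero w), fun i hi p hp => by simp [hz i hi] at hp,
      fun i hi => absurd hi (Nat.not_lt_zero i)⟩
  rintro k hk s ⟨hs, hm, hr, hinv⟩ hik -
  have hcode := hs.code k hk
  refine wlp_ite (fun h => wlp_skip ?_) fun h => wlp_seq ?_
  · refine ⟨by simpa using hs, by simpa using hm, hr, hinv.other ?_⟩
    simp [hik, hcode] at h
    omega
  simp [hik, hcode] at h
  refine (checkLast_wlp ⟨hs, hm, hik⟩ hr hk).mono fun s₁ _ ⟨h1, h2, h3⟩ => ?_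
  have hr₁ : SoundRows τ b m s₁ := by simpa [SoundRows, h2] using hr
  rw [← h2] at hinv h3
  refine wlp_ite (fun h' => ?_) fun h' => ?_
  · simp [h1.2.2, h2, hcode] at h'
    refine (visitWrite_wlp h1 hk).mono fun s₂ _ ⟨h4, h5, h6, h7, h8, h9⟩ => ?_
    refine ⟨by simpa using h4.1, by simpa using h4.2.1, ?_,
      hinv.write hk (by omega) h3 h7 h8 h9⟩
    simpa [SoundRows, h5, h6] using hr₁
  · simp [h1.2.2, h2, hcode] at h'
    refine (visitRead_wlp h1 hr₁ hk).mono fun s₂ _ ⟨h4, h5, h6⟩ => ?_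
    refine ⟨by simpa using h4.1, by simpa using h4.2.1, ?_, ?_⟩
    · simpa [SoundRows, h5] using hr₁
    · simp only [Store.setReg_mem]
      rw [h5]
      exact hinv.read hk h' h3 h6

end

section

variable {b : ℕ} {τ : Table}

/-! ### Completeness of the certificates for the absence of races -/

/-- `w` is the position of the first write to `x` from `k` on, or the size of the table. -/
structure Table.IsNext (τ : Table) (k x w : ℕ) : Prop where
  ge : k ≤ w
  le : w ≤ τ.size
  write : w < τ.size → τ.code w = 1 ∧ τ.name w = x
  first : ∀ v, k ≤ v → v < w → ¬ (τ.code v = 1 ∧ τ.name v = x)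

theorem Table.exists_isNext (τ : Table) {k : ℕ} (x : ℕ) (hk : k ≤ τ.size) :
    ∃ w, τ.IsNext k x w := by
  classical
  have hex : ∃ w, k ≤ w ∧ (w = τ.size ∨ (τ.code w = 1 ∧ τ.name w = x)) := ⟨_, hk, Or.inl rfl⟩
  refine ⟨Nat.find hex, (Nat.find_spec hex).1, Nat.find_min' hex ⟨hk, Or.inl rfl⟩, fun h => ?_,
    fun v hkv hv h => Nat.find_min hex hv ⟨hkv, Or.inr h⟩⟩
  exact (Nat.find_spec hex).2.resolve_left h.ne

theorem Table.IsNext.eq_self {k x w : ℕ} (h : τ.IsNext k x w) (hk1 : τ.code k = 1)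
    (hkx : τ.name k = x) : w = k := by
  by_contra hne
  have := h.ge
  exact h.first k le_rfl (by omega) ⟨hk1, hkx⟩

theorem Table.IsNext.succ {k x w : ℕ} (h : τ.IsNext k x w) (hk : k < τ.size)
    (hkx : ¬ (τ.code k = 1 ∧ τ.name k = x)) : τ.IsNext (k + 1) x w := by
  refine ⟨?_, h.le, h.write, fun v hv => h.first v (by omega)⟩
  have := h.ge
  rcases Nat.eq_or_lt_of_le this with rfl | h'
  · exact absurd (h.write hk) hkx
  · omega

/-- The contents of `lastW` and `nextW` before the visit of the event `k`, in a run with the right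
predictions. -/
structure VisitExact (τ : Table) (k : ℕ) (lw nx : ℕ → ℕ) : Prop where
  last : ∀ i < τ.size, ∀ p, lw (τ.name i) = p + 1 → p < k ∧ τ.code p = 1 ∧ τ.name p = τ.name i
  next : ∀ i < τ.size, τ.IsNext k (τ.name i) (nx (τ.name i))

theorem VisitExact.last_le {k : ℕ} {lw nx : ℕ → ℕ} (h : VisitExact τ k lw nx) {i : ℕ}
    (hi : i < τ.size) : lw (τ.name i) ≤ k := by
  rcases Nat.eq_zero_or_pos (lw (τ.name i)) with h0 | h0
  · omega
  · have := (h.last i hi (lw (τ.name i) - 1) (by omega)).1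
    omega

theorem VisitExact.skip {k : ℕ} {lw nx : ℕ → ℕ} (h : VisitExact τ k lw nx) (hk : k < τ.size)
    (hk1 : τ.code k ≠ 1) : VisitExact τ (k + 1) lw nx where
  last i hi p hp := by
    obtain ⟨h1, h2⟩ := h.last i hi p hp
    exact ⟨by omega, h2⟩
  next i hi := (h.next i hi).succ hk fun h' => hk1 h'.1

theorem VisitExact.write {k w : ℕ} {lw nx lw' nx' : ℕ → ℕ} (h : VisitExact τ k lw nx)
    (hk : k < τ.size) (hk1 : τ.code k = 1) (hw : τ.IsNext (k + 1) (τ.name k) w)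
    (hlw : ∀ x, lw' x = if x = τ.name k then k + 1 else lw x)
    (hnx : ∀ x, nx' x = if x = τ.name k then w else nx x) : VisitExact τ (k + 1) lw' nx' where
  last i hi p hp := by
    rw [hlw] at hp
    split at hp
    · rename_i he
      obtain rfl : k = p := by omega
      exact ⟨by omega, hk1, he.symm⟩
    · obtain ⟨h1, h2⟩ := h.last i hi p hp
      exact ⟨by omega, h2⟩
  next i hi := by
    rw [hnx]
    split
    · rename_i he
      rwa [he]
    · rename_i hne
      exact (h.next i hi).succ hk fun h' => hne h'.2.symm

/-- The bounds under which all calls of `check` succeed at a bounded cost. -/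
structure Setup (τ : Table) (U K m : ℕ) (S : ℕ → ℕ) : Prop where
  table : τ.Le U
  steps : K ≤ U
  rows : m * τ.size ≤ U
  hubs : m ≤ U
  hub : ∀ q, S q ≤ U
  cert : ∀ i j, i < τ.size → j < τ.size → τ.Reach i j → τ.Cert K m S i j

variable {U K m : ℕ} {S : ℕ → ℕ}

theorem visit_check_can {s : Store} {k : ℕ} (hU : Setup τ U K m S) (hs : Ready τ b m k s)
    (hr : ExactRows τ b m S s) (hfro : s.reg (Loc.fro.addr b) < τ.size)
    (hto : s.reg (Loc.to.addr b) < τ.size)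
    (h : τ.Reach (s.reg (Loc.fro.addr b)) (s.reg (Loc.to.addr b))) :
    Can U (check b) s (200 + K * 160) fun s' => Ready τ b m k s' ∧ s'.mem = s.mem :=
  (check_can hs.1 hU.table hr hs.2.1 hU.steps hU.hubs hU.hub hfro hto
    (hU.cert _ _ hfro hto h)).mono le_rfl fun _ hf _ => ⟨hs.check hf, frame_check_mem hf⟩

theorem checkLast_can {s : Store} {k : ℕ} (hU : Setup τ U K m S) (hs : Ready τ b m k s)
    (hr : ExactRows τ b m S s) (hk : k < τ.size) (hrf : τ.RaceFree) (hk1 : τ.code k ≤ 1)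
    (hx : VisitExact τ k (s.mem (Arr.lastW.addr b)) (s.mem (Arr.nextW.addr b))) :
    Can U (checkLast b) s (250 + K * 160) fun s' => Ready τ b m k s' ∧ s'.mem = s.mem := by
  have hU2 : 2 ≤ U := by have := hU.table.three; omega
  have hname := hs.1.name k hk
  have hnU := hU.table.name k hk
  have hsU := hU.table.size
  have hlast := hx.last_le hk
  have hpos := hs.2.2
  refine Can.mono (n := 4 + ((7 + (2 + (200 + K * 160))) + 1)) (can_ite hU2 ?_ (fun h => can_seq
    (can_assign hU2 ?_ (can_seq (can_assign hU2 ?_ ?_)))) fun h => can_skip ⟨hs, rfl⟩) ?_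
    fun _ _ h => h
  · simp [hpos, hname]; omega
  · simp [hpos, hname]; omega
  · simp [hpos]; omega
  · simp [hpos, hname] at h
    obtain ⟨p, hp⟩ : ∃ p, s.mem (Arr.lastW.addr b) (τ.name k) = p + 1 :=
      ⟨s.mem (Arr.lastW.addr b) (τ.name k) - 1, by omega⟩
    obtain ⟨h1, h2, h3⟩ := hx.last k hk p hp
    refine Can.mono (visit_check_can hU (k := k) ?_ ?_ ?_ ?_ ?_) le_rfl fun s' _ h' => h'
    · simpa using hs
    · simpa [ExactRows] using hr
    · simp [hpos, hname]; omega
    · simp [hpos]; omega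
    · simp [hpos, hname, hp]
      exact hrf p k h1 hk ⟨h3, by omega, by omega, by omega⟩
  · omega

theorem visitWrite_can {s : Store} {k : ℕ} (hU : Setup τ U K m S) (hs : Ready τ b m k s)
    (hr : ExactRows τ b m S s) (hk : k < τ.size) (hk1 : τ.code k = 1)
    (hx : VisitExact τ k (s.mem (Arr.lastW.addr b)) (s.mem (Arr.nextW.addr b))) :
    Can U (visitWrite b) s 50 fun s' => Ready τ b m (k + 1) (s'.setReg (Loc.pos.addr b) (k + 1)) ∧
      ExactRows τ b m S s' ∧
      VisitExact τ (k + 1) (s'.mem (Arr.lastW.addr b)) (s'.mem (Arr.nextW.addr b)) := by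
  have hU2 : 2 ≤ U := by have := hU.table.three; omega
  have hname := hs.1.name k hk
  have hnU := hU.table.name k hk
  have hsU := hU.table.size
  obtain ⟨h1, h2, h3⟩ := hs
  obtain ⟨w, hw⟩ := τ.exists_isNext (τ.name k) (Nat.succ_le_of_lt hk)
  have hwU := hw.le
  have hnx : s.mem (Arr.nextW.addr b) (τ.name k) = k := (hx.next k hk).eq_self hk1 rfl
  refine Can.mono (n := Cmd.weight _) (canw_seq (canw_assertZero hU2 ?_ ?_ (canw_seq
    (canw_guess w (by omega) (canw_seq (canw_store hU2 ?_ ?_ (canw_store hU2 ?_ ?_ ?_)))))))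
    (by simp [Cmd.weight, assertZero]) fun _ _ h => h
  · simp [h3, hname, hnx]; omega
  · rw [Expr.eval_dist_eq_zero]; simp [h3, hname, hnx]
  · simp [h3, hname]; omega
  · simp; omega
  · simp [h3, hname]; omega
  · simp [h3]; omega
  · refine ⟨⟨by simpa using h1, by simpa using h2, by simp⟩, by simpa [ExactRows] using hr,
      hx.write hk hk1 hw (fun x => ?_) fun x => ?_⟩
    · simp [h3, hname]
    · simp [h3, hname]

theorem visitRead_can {s : Store} {k : ℕ} (hU : Setup τ U K m S) (hs : Ready τ b m k s)
    (hr : ExactRows τ b m S s) (hk : k < τ.size) (hrf : τ.RaceFree) (hk0 : τ.code k = 0)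
    (hx : VisitExact τ k (s.mem (Arr.lastW.addr b)) (s.mem (Arr.nextW.addr b))) :
    Can U (visitRead b) s (250 + K * 160) fun s' => Ready τ b m k s' ∧ s'.mem = s.mem := by
  have hU2 : 2 ≤ U := by have := hU.table.three; omega
  have hname := hs.1.name k hk
  have hnU := hU.table.name k hk
  have hsU := hU.table.size
  have hpos := hs.2.2
  have hnext := hx.next k hk
  have hnU := hnext.le
  refine Can.mono (n := 4 + (5 + (2 + (200 + K * 160)) + 1)) (can_seq (can_assign hU2 ?_
    (can_ite hU2 ?_ (fun h => can_seq (can_assign hU2 ?_ ?_)) fun h => can_skip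
      ⟨by simpa using hs, rfl⟩))) (by omega) fun _ _ h => h
  · simp [hpos, hname]; omega
  · simp [hpos, hname, hs.1.size]; omega
  · simp [hpos]; omega
  · simp [hpos, hname, hs.1.size] at h
    obtain ⟨hw1, hw2⟩ := hnext.write (by omega)
    have hne : k ≠ s.mem (Arr.nextW.addr b) (τ.name k) := by
      intro h'
      rw [← h'] at hw1
      omega
    have := hnext.ge
    refine Can.mono (visit_check_can hU (k := k) ?_ ?_ ?_ ?_ ?_) le_rfl fun s' _ h' => h'
    · simpa using hs
    · simpa [ExactRows] using hr
    · simp [hpos]; omega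
    · simp [hpos, hname]; omega
    · simp [hpos, hname]
      exact hrf k _ (by omega) (by omega) ⟨hw2.symm, by omega, by omega, by omega⟩

theorem visit_can {s : Store} {k : ℕ} (hU : Setup τ U K m S) (hs : Ready τ b m k s)
    (hr : ExactRows τ b m S s) (hk : k < τ.size) (hrf : τ.RaceFree)
    (hx : VisitExact τ k (s.mem (Arr.lastW.addr b)) (s.mem (Arr.nextW.addr b))) :
    Can U (visit b) s (600 + K * 320) fun s' =>
      Ready τ b m (k + 1) (s'.setReg (Loc.pos.addr b) (k + 1)) ∧ ExactRows τ b m S s' ∧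
      VisitExact τ (k + 1) (s'.mem (Arr.lastW.addr b)) (s'.mem (Arr.nextW.addr b)) := by
  have hU2 : 2 ≤ U := by have := hU.table.three; omega
  have hcode := hs.1.code k hk
  have hcU := hU.table.code k hk
  have hsU := hU.table.size
  have hpos := hs.2.2
  have hstep : ∀ s' : Store, Ready τ b m k s' →
      Ready τ b m (k + 1) (s'.setReg (Loc.pos.addr b) (k + 1)) := fun s' h =>
    ⟨by simpa using h.1, by simpa using h.2.1, by simp⟩
  refine Can.mono (n := 6 + 1 + ((250 + K * 160) + (3 + 50 + (250 + K * 160))))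
    (can_ite hU2 ?_ (fun h => can_skip ?_) fun h => can_seq ?_) ?_ fun _ _ h => h
  · simp [hpos, hcode]; omega
  · simp [hpos, hcode] at h
    exact ⟨hstep s hs, hr, hx.skip hk (by omega)⟩
  · simp [hpos, hcode] at h
    refine (checkLast_can hU hs hr hk hrf (by omega) hx).mono le_rfl fun s₁ _ ⟨h1, h2⟩ => ?_
    have hr₁ : ExactRows τ b m S s₁ := by simpa [ExactRows, h2] using hr
    rw [← h2] at hx
    refine can_ite hU2 ?_ (fun h' => ?_) fun h' => ?_
    · simp [h1.2.2, h2, hcode]; omega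
    · simp [h1.2.2, h2, hcode] at h'
      exact visitWrite_can hU h1 hr₁ hk (by omega) hx
    · simp [h1.2.2, h2, hcode] at h'
      refine (visitRead_can hU h1 hr₁ hk hrf h' hx).mono le_rfl fun s₂ _ ⟨h3, h4⟩ => ?_
      exact ⟨hstep s₂ h3, by simpa [ExactRows, h4] using hr₁, by
        rw [h4]; exact hx.skip hk (by omega)⟩
  · simp; omega

theorem certify_can {s : Store} (hs : Holds τ b s) (hU : Setup τ U K m S) (hrf : τ.RaceFree) :
    Can U (certify b) s (30 + m * (50 + τ.size * 330) + τ.size * (700 + K * 320))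
      fun _ => True := by
  have hU2 : 2 ≤ U := by have := hU.table.three; omega
  have hsU := hU.table.size
  refine Can.mono (n := 2 + ((7 + m * (50 + τ.size * 330)) + ((7 + τ.size * (20 + 10)) +
    (7 + τ.size * ((600 + K * 320) + 10))))) (can_seq (can_guess m hU.hubs (can_seq
    ((buildTable_can (τ := τ) (S := S) (m := m) ?_ hU.table ?_ hU.rows hU.hubs hU.hub).mono le_rfl
    fun s₁ hf ⟨hs, hr⟩ => can_seq ?_)))) ?_ fun _ _ h => h
  · simpa using hs
  · simp
  · have hm : s₁.reg (Loc.count.addr b) = m := by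
      rw [hf.1 _ (by simp [buildTable, sweep, clearMarks, sweepStep, forLoop, Cmd.WritesReg])]
      simp
    refine (can_forLoop (c := 20) hU2 (m := τ.size) (fun k s' => Holds τ b s' ∧
        s'.reg (Loc.count.addr b) = m ∧ ExactRows τ b m S s' ∧
        ∀ i < k, s'.mem (Arr.lastW.addr b) (τ.name i) = 0 ∧
          τ.IsNext 0 (τ.name i) (s'.mem (Arr.nextW.addr b) (τ.name i)))
        (by simp) (by simp [Cmd.WritesReg]) (by simp [Cmd.WritesReg]) hs.size hsU ?_ ?_).mono
        le_rfl ?_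
    · exact ⟨by simpa using hs, by simpa using hm, hr, by simp⟩
    · rintro k hk s ⟨hs, hm, hr, hz⟩ hik -
      have hname := hs.name k hk
      have hnU := hU.table.name k hk
      obtain ⟨w, hw⟩ := τ.exists_isNext (τ.name k) (Nat.zero_le _)
      have hwU := hw.le
      refine Can.mono (n := Cmd.weight _) (canw_seq (canw_store hU2 ?_ ?_ (canw_seq
        (canw_guess w (by omega) (canw_store hU2 ?_ ?_ ?_))))) (by simp [Cmd.weight])
        fun _ _ h => h
      · simp [hik, hname]; omega
      · simp
      · simp [hik, hname]; omega
      · simp; omega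
      refine ⟨by simpa using hs, by simpa using hm, ?_, fun i hi => ?_⟩
      · simpa [ExactRows] using hr
      · by_cases he : τ.name i = τ.name k
        · simpa [hik, hname, he] using hw
        · have : i < k := by
            rcases Nat.lt_succ_iff_lt_or_eq.1 hi with h | rfl
            · exact h
            · exact absurd rfl he
          simpa [hik, hname, he] using hz i this
    · rintro s - ⟨hs, hm, hr, hz⟩
      refine (can_forLoop (c := 600 + K * 320) hU2 (m := τ.size) (fun k s' =>
          Ready τ b m k s' ∧ ExactRows τ b m S s' ∧
          VisitExact τ k (s'.mem (Arr.lastW.addr b)) (s'.mem (Arr.nextW.addr b)))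
          (by simp) ?_ ?_ hs.size hsU ?_ ?_).mono le_rfl fun s' _ h => trivial
      · simp [visit, checkLast, visitWrite, visitRead, check, forLoop, assertZero, Cmd.WritesReg]
      · simp [visit, checkLast, visitWrite, visitRead, check, forLoop, assertZero, Cmd.WritesReg]
      · refine ⟨⟨by simpa using hs, by simpa using hm, by simp⟩, hr, fun i hi p hp => ?_,
          fun i hi => (hz i hi).2⟩
        simp [(hz i hi).1] at hp
      · rintro k hk s ⟨h1, h2, h3⟩ - -
        exact (visit_can hU h1 h2 hk hrf h3).mono le_rfl fun s' _ h => ⟨h.1, h.2.1, h.2.2⟩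
  · ring_nf; omega

/-! ### Finding a race -/

section
variable (b : ℕ)

/-- Zero exactly if `fro` and `to` are conflicting accesses, in this order. -/
def touchTest : Expr :=
  ((Loc.fro.val b + 1) - Loc.to.val b) + ((Loc.to.val b + 1) - Loc.size.val b) +
    (Arr.name.cell b (Loc.fro.val b)).dist (Arr.name.cell b (Loc.to.val b)) +
    (Arr.code.cell b (Loc.fro.val b) - 1) + (Arr.code.cell b (Loc.to.val b) - 1) +
    (1 - (Arr.code.cell b (Loc.fro.val b) + Arr.code.cell b (Loc.to.val b)))

/-- Accepts only traces with a race: guesses it, and computes all that can be reached from its first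
event. -/
def findRace : Cmd :=
  .guess (Loc.fro.addr b) ;; .guess (Loc.to.addr b) ;; assertZero (touchTest b) ;;
  .assign (Loc.src.addr b) (Loc.fro.val b) ;; .assign (Loc.base.addr b) 0 ;; sweep b ;;
  assertZero (Arr.tbl.cell b (Loc.to.val b))

end

theorem eval_touchTest {s : Store} (hs : Holds τ b s) : (touchTest b).eval s = 0 ↔
    s.reg (Loc.fro.addr b) < s.reg (Loc.to.addr b) ∧ s.reg (Loc.to.addr b) < τ.size ∧
      τ.Touch (s.reg (Loc.fro.addr b)) (s.reg (Loc.to.addr b)) := by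
  simp only [touchTest, Expr.eval_add, Expr.eval_sub, Expr.eval_val, Expr.eval_ofNat,
    Nat.add_eq_zero_iff, Expr.eval_dist_eq_zero, Expr.eval_cell, hs.size, Table.Touch]
  by_cases h : s.reg (Loc.fro.addr b) < s.reg (Loc.to.addr b) ∧ s.reg (Loc.to.addr b) < τ.size
  · have h1 : s.reg (Loc.fro.addr b) < τ.size := by omega
    rw [hs.name _ h1, hs.name _ h.2, hs.code _ h1, hs.code _ h.2]
    omega
  · constructor
    · rintro ⟨⟨⟨⟨⟨_, _⟩, _⟩, _⟩, _⟩, _⟩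
      omega
    · rintro ⟨h1, h2, _⟩
      exact absurd ⟨h1, h2⟩ h

theorem findRace_wlp {V : ℕ} {s : Store} (hs : Holds τ b s) (hV : τ.Le V) :
    Wlp (findRace b) s fun _ => ¬ τ.RaceFree := by
  refine wlp_seq (wlp_guess fun i => wlp_seq (wlp_guess fun j => wlp_seq (wlp_assertZero fun h =>
    wlp_seq (wlp_assign (wlp_seq (wlp_assign (wlp_seq ?_)))))))
  rw [eval_touchTest (τ := τ) (by simpa using hs)] at h
  simp only [Store.setReg_reg, Loc.addr_inj, reduceCtorEq, if_false, if_true] at h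
  refine Wlp.mono (sweep_wlp (τ := τ) (V := V) ?_ hV) fun s' hf hp =>
    wlp_assertZero fun h0 hrf => ?_
  · simpa using hs
  · have hto : s'.reg (Loc.to.addr b) = j := by
      rw [hf.1 _ (by simp [sweep, clearMarks, sweepStep, forLoop, Cmd.WritesReg])]
      simp
    have := (hp.1 j h.2.1).1
    simp at this
    simp [hto] at h0
    exact this.2 (hrf i j h.1 h.2.1 h.2.2) h0

theorem findRace_can {s : Store} (hs : Holds τ b s) (hU : τ.Le U) (hr : ¬ τ.RaceFree) :
    Can U (findRace b) s (250 + τ.size * 330) fun _ => True := by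
  have hU2 : 2 ≤ U := by have := hU.three; omega
  have hsU := hU.size
  simp only [Table.RaceFree, not_forall] at hr
  obtain ⟨i, j, hij, hj, ht, hn⟩ := hr
  have hi : i < τ.size := by omega
  have := hU.code i hi
  have := hU.code j hj
  have := hU.name i hi
  have := hU.name j hj
  refine Can.mono (n := 2 + (2 + (200 + (2 + (2 + ((14 + τ.size * 330) + 3))))))
    (can_seq (can_guess i (by omega) (can_seq (can_guess j (by omega) (can_seq
    ((can_assertZero hU2 ?_ ?_ ?_).mono (n' := 200) (Q' := fun s' => Can U _ s' _ _) ?_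
      fun _ _ h => h)))))) (by omega) fun _ _ h => h
  · simp [touchTest, hs.size, hs.code i hi, hs.code j hj, hs.name i hi, hs.name j hj]
    omega
  · rw [eval_touchTest (τ := τ) (by simpa using hs)]
    simpa using ⟨hij, hj, ht⟩
  · refine can_seq (can_assign hU2 ?_ (can_seq (can_assign hU2 ?_ (can_seq ?_))))
    · simp; omega
    · simp
    refine Can.mono (sweep_can (τ := τ) (i := i) (β := 0) ?_ hU ?_ (by omega) ?_ (by omega))
      le_rfl fun s' hf hp => ?_
    · simpa using hs
    · simp
    · simp
    have hto : s'.reg (Loc.to.addr b) = j := by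
      rw [hf.1 _ (by simp [sweep, clearMarks, sweepStep, forLoop, Cmd.WritesReg])]
      simp
    have h1 := hp.1 j hj
    rw [zero_add] at h1
    refine can_assertZero hU2 ?_ ?_ trivial
    · simp [hto]; omega
    · simpa [hto] using fun h => hn (h1.1.1 h)
  · simp [touchTest]

end

section

/-! ### Answering an oracle query nondeterministically -/

theorem event_code_le (o : Operation) : o.code ≤ 3 := by cases o <;> simp [Operation.code]

theorem flatMap_triple (σ : List Event) {k : ℕ} (hk : k < σ.length) :
    let w := σ.flatMap fun e => [e.thread, e.op.code, e.op.name]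
    w.getD (3 * k) 0 = (Trace.table σ).thr k ∧ w.getD (3 * k + 1) 0 = (Trace.table σ).code k ∧
      w.getD (3 * k + 2) 0 = (Trace.table σ).name k := by
  induction σ generalizing k with
  | nil => simp at hk
  | cons e σ ih =>
    cases k with
    | zero => simp [Trace.table, Trace.event]
    | succ k =>
      have := ih (k := k) (by simpa using hk)
      simpa [Trace.table, Trace.event, mul_add, Nat.add_right_comm] using this

theorem flatMap_triple_length (σ : List Event) :
    (σ.flatMap fun e => [e.thread, e.op.code, e.op.name]).length = 3 * σ.length := by
  induction σ with
  | nil => rfl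
  | cons e σ ih =>
    rw [List.flatMap_cons, List.length_append, ih, List.length_cons]
    simp only [List.length_cons, List.length_nil]
    omega

theorem flatMap_triple_injective {σ σ' : List Event}
    (h : (σ.flatMap fun e => [e.thread, e.op.code, e.op.name]) =
      σ'.flatMap fun e => [e.thread, e.op.code, e.op.name]) : σ = σ' := by
  induction σ generalizing σ' with
  | nil => cases σ' <;> simp_all
  | cons e σ ih =>
    cases σ' with
    | nil => simp at h
    | cons e' σ' =>
      obtain ⟨t, o⟩ := e
      obtain ⟨t', o'⟩ := e'
      simp only [List.flatMap_cons, List.cons_append, List.nil_append, List.cons.injEq] at h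
      obtain ⟨rfl, h1, h2, h3⟩ := h
      rw [ih h3, Operation.ext_code h1 h2]

theorem Store.word_getD (s : Store) (A n i : ℕ) (hi : i < n) :
    (s.word A n).getD i 0 = s.mem A i := by
  simp [Store.word, hi]

section
variable (b : ℕ)

/-- Copies a trace of which the encoding is stored in `A` to the arrays of the verifier. -/
def loadBody (A : ℕ) : Cmd :=
  .store (Arr.thr.addr b) (Loc.pos.val b) (.get A (3 * Loc.pos.val b)) ;;
  .store (Arr.code.addr b) (Loc.pos.val b) (.get A (3 * Loc.pos.val b + 1)) ;;
  .store (Arr.name.addr b) (Loc.pos.val b) (.get A (3 * Loc.pos.val b + 2))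

/-- Guesses the answer to a query, and verifies it. -/
def answer (x : ℕ) : Cmd :=
  .guess (Loc.ans.addr b) ;;
  .ite (Loc.ans.val b) (findRace b ;; .assign x 1) (certify b ;; .assign x 0)

/-- Replaces the oracle query `query x A len`. -/
def simQuery (x A : ℕ) (len : Expr) : Cmd :=
  .assign (Loc.size.addr b) (.op .div len (.const 3)) ;;
  forLoop (Loc.pos.addr b) (Loc.size.addr b) (loadBody b A) ;;
  answer b x

end

variable {b : ℕ}

theorem Loc.lt_ne {y : ℕ} (hy : y < b) (l : Loc) : l.addr b ≠ y := by
  unfold Loc.addr; omega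

theorem Arr.lt_ne {B : ℕ} (hB : B < b) (A : Arr) : A.addr b ≠ B := by
  unfold Arr.addr; omega

/-- Array `A` holds the table, in the encoding of traces. -/
def Encoded (τ : Table) (A : ℕ) (s : Store) : Prop :=
  ∀ k < τ.size, s.mem A (3 * k) = τ.thr k ∧ s.mem A (3 * k + 1) = τ.code k ∧
    s.mem A (3 * k + 2) = τ.name k

theorem load_can {τ : Table} {U A : ℕ} {s : Store} (hA : A < b) (hs : Encoded τ A s)
    (hN : s.reg (Loc.size.addr b) = τ.size) (hU : τ.Le U) :
    Can U (forLoop (Loc.pos.addr b) (Loc.size.addr b) (loadBody b A)) s (7 + τ.size * 60)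
      (Holds τ b) := by
  have hU2 : 2 ≤ U := by have := hU.three; omega
  have h3U := hU.three
  have hsU := hU.size
  have hne : ∀ B : Arr, A ≠ B.addr b := fun B => (Arr.lt_ne hA B).symm
  refine (can_forLoop (c := 50) hU2 (m := τ.size) (fun i s => Encoded τ A s ∧
    s.reg (Loc.size.addr b) = τ.size ∧ ∀ k < i, s.mem (Arr.thr.addr b) k = τ.thr k ∧
      s.mem (Arr.code.addr b) k = τ.code k ∧ s.mem (Arr.name.addr b) k = τ.name k) (by simp)
    (by simp [loadBody, Cmd.WritesReg]) (by simp [loadBody, Cmd.WritesReg]) hN hU.size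
    ⟨hs, by simpa using hN, by simp⟩ ?_).mono (by omega) fun s' _ h =>
      ⟨h.2.1, fun k hk => (h.2.2 k hk).1, fun k hk => (h.2.2 k hk).2.1,
        fun k hk => (h.2.2 k hk).2.2⟩
  rintro k hk s ⟨he, hN, hz⟩ hik -
  obtain ⟨h1, h2, h3⟩ := he k hk
  have := hU.thr k hk
  have := hU.code k hk
  have := hU.name k hk
  have hget : ∀ (s : Store) (e : Expr), (Expr.get A e).eval s = s.mem A (e.eval s) :=
    fun _ _ => rfl
  have hbget : ∀ (s : Store) (e : Expr),
      (Expr.get A e).Bdd U s ↔ e.Bdd U s ∧ s.mem A (e.eval s) ≤ U := fun _ _ => Iff.rfl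
  refine Can.mono (n := Cmd.weight _) (canw_seq (canw_store hU2 ?_ ?_ (canw_seq
    (canw_store hU2 ?_ ?_ (canw_store hU2 ?_ ?_ ?_)))))
    (by simp [Cmd.weight, Expr.weight]) fun _ _ h => h
  · simp [hik]; omega
  · simp [hbget, hik, h1]; omega
  · simp [hik]; omega
  · simp [hbget, hik, h2, hne]; omega
  · simp [hik]; omega
  · simp [hbget, hik, h3, hne]; omega
  · refine ⟨?_, by simpa using hN, fun i hi => ?_⟩
    · simpa [Encoded, hne] using he
    · rcases Nat.lt_succ_iff_lt_or_eq.1 hi with h | rfl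
      · simpa [hik, hget, hne, h.ne] using hz i h
      · simp [hik, hget, hne, h1, h2, h3]

theorem answer_wlp {τ : Table} {V x : ℕ} {s : Store} (hs : Holds τ b s) (hV : τ.Le V) :
    Wlp (answer b x) s fun s' =>
      (¬ τ.RaceFree ∧ s'.reg x = 1) ∨ (τ.RaceFree ∧ s'.reg x = 0) := by
  refine wlp_seq (wlp_guess fun v => wlp_ite (fun _ => wlp_seq ?_) fun _ => wlp_seq ?_)
  · exact Wlp.mono (findRace_wlp (τ := τ) (by simpa using hs) hV)
      fun s' _ h => wlp_assign (Or.inl ⟨h, by simp⟩)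
  · exact Wlp.mono (certify_wlp (τ := τ) (by simpa using hs) hV)
      fun s' _ h => wlp_assign (Or.inr ⟨h, by simp⟩)

theorem answer_can {τ : Table} {U K m x : ℕ} {S : ℕ → ℕ} {s : Store} (hs : Holds τ b s)
    (hU : Setup τ U K m S) :
    Can U (answer b x) s (300 + m * (50 + τ.size * 330) + τ.size * (1030 + K * 320)) fun s' =>
      (¬ τ.RaceFree ∧ s'.reg x = 1) ∨ (τ.RaceFree ∧ s'.reg x = 0) := by
  have h3U := hU.table.three
  have hU2 : 2 ≤ U := by omega
  by_cases h : τ.RaceFree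
  · refine Can.mono (n := 2 + (2 + (0 + ((30 + m * (50 + τ.size * 330) +
      τ.size * (700 + K * 320)) + 2)))) (can_seq (can_guess 0 (by omega) (Can.mono (can_ite
      (n := 0) hU2 ?_ (fun h0 => absurd ?_ h0) fun _ => can_seq ((certify_can (τ := τ) ?_ hU h).mono
      le_rfl fun s' _ _ => can_assign hU2 ?_ (Or.inr ⟨h, by simp⟩))) (le_of_eq ?_) fun _ _ h => h)))
      ?_ fun _ _ h => h
    · simp
    · simp
    · simpa using hs
    · simp
    · simp
    · ring_nf; omega
  · refine Can.mono (n := 2 + (2 + ((250 + τ.size * 330) + 2) + 0)) (can_seq (can_guess 1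
      (by omega) (can_ite (m := 0) hU2 ?_ (fun _ => can_seq ((findRace_can (τ := τ) ?_ hU.table
      h).mono le_rfl fun s' _ _ => can_assign hU2 ?_ (Or.inl ⟨h, by simp⟩)))
      fun h0 => absurd h0 ?_))) ?_ fun _ _ h => h
    · simp; omega
    · simpa using hs
    · simp; omega
    · simp
    · ring_nf; omega

theorem wordCost_le_succ (n : ℕ) : wordCost n ≤ n + 1 :=
  Nat.add_le_add_right (Nat.log_le_self 2 n) 1

theorem wordCost_add_two (n : ℕ) : wordCost (n + 2) ≤ 3 * wordCost n := by
  have h1 := one_le_wordCost n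
  have h2 : n < 2 ^ wordCost n := Nat.lt_pow_succ_log_self (by norm_num) n
  have h3 : n + 2 < 2 ^ (wordCost n + 2) := by
    rw [pow_add]
    have : 2 ≤ 2 ^ wordCost n := by
      calc 2 = 2 ^ 1 := rfl
        _ ≤ _ := Nat.pow_le_pow_right (by norm_num) h1
    omega
  have : Nat.log 2 (n + 2) < wordCost n + 2 := Nat.log_lt_of_lt_pow (by omega) h3
  unfold wordCost at *
  omega

/-- A bound for the cost of a verified answer to a query about a trace with `N` events. -/
def simCost (c N : ℕ) : ℕ :=
  (1000 + 3000 * ((N.sqrt + 1) * N * wordCost N)) * (3 * (c + 5) * wordCost N)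

theorem table_le {c : ℕ} (y : (hbRaceProblem c).Inst) :
    (Trace.table y.1).Le ((y.1.length + 2) ^ (c + 5)) := by
  have hσ := y.2.2
  generalize y.1 = σ at hσ
  have h1 : σ.length ^ c ≤ (σ.length + 2) ^ (c + 5) :=
    (Nat.pow_le_pow_left (by omega) c).trans (Nat.pow_le_pow_right (by omega) (by omega))
  have h2 : σ.length + 2 ≤ (σ.length + 2) ^ (c + 5) := Nat.le_self_pow (by omega) _
  have h3 : 2 ^ 5 ≤ (σ.length + 2) ^ (c + 5) :=
    (Nat.pow_le_pow_left (by omega) 5).trans (Nat.pow_le_pow_right (by omega) (by omega))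
  have hmem : ∀ k < σ.length, Trace.event σ k ∈ σ := fun k hk => by
    simp [Trace.event, hk]
  refine ⟨?_, ?_, fun k hk => ?_, fun k hk => ?_, fun k hk => ?_⟩
  · simp only [Trace.table]; omega
  · omega
  · exact (hσ _ (hmem k hk)).1.le.trans h1
  · exact (event_code_le _).trans (by omega)
  · exact (hσ _ (hmem k hk)).2.le.trans h1

theorem exists_setup {c : ℕ} (y : (hbRaceProblem c).Inst) :
    ∃ (K m : ℕ) (S : ℕ → ℕ), Setup (Trace.table y.1) ((y.1.length + 2) ^ (c + 5)) K m S ∧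
      K ≤ y.1.length.sqrt + 1 ∧ (y.1.length = 0 → m = 0) ∧
      m ≤ 2 * ((y.1.length.sqrt + 1) * wordCost y.1.length) := by
  have hle := table_le y
  set N := y.1.length with hN
  have hsize : (Trace.table y.1).size = N := rfl
  rcases Nat.eq_zero_or_pos N with h0 | h0
  · refine ⟨0, 0, fun _ => 0, ⟨hle, Nat.zero_le _, by simp, Nat.zero_le _, fun _ => Nat.zero_le _,
      fun i j hi => ?_⟩, Nat.zero_le _, fun _ => rfl, Nat.zero_le _⟩
    rw [hsize, h0] at hi
    exact absurd hi (Nat.not_lt_zero i)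
  · obtain ⟨S, hS, hc⟩ := (Trace.table y.1).exists_cert h0
    rw [hsize] at hS hc
    have hK : N.sqrt ≤ N := Nat.sqrt_le_self N
    have hw := wordCost_le_succ N
    have hp : ∀ j ≤ 5, (N + 2) ^ j ≤ (N + 2) ^ (c + 5) := fun j hj =>
      Nat.pow_le_pow_right (by omega) (by omega)
    have hm : (N.sqrt + 1) * (2 * wordCost N) ≤ (N + 2) ^ 3 := by
      calc (N.sqrt + 1) * (2 * wordCost N) ≤ (N + 2) * ((N + 2) * (N + 2)) :=
            Nat.mul_le_mul (by omega) (Nat.mul_le_mul (by omega) (by omega))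
        _ = _ := by ring
    refine ⟨N.sqrt + 1, (N.sqrt + 1) * (2 * wordCost N), S, ⟨hle, ?_, ?_, ?_, fun q => ?_, hc⟩,
      le_rfl, fun h => by omega, le_of_eq (by ring)⟩
    · have := hp 1 (by omega); rw [pow_one] at this; omega
    · rw [hsize]
      calc (N.sqrt + 1) * (2 * wordCost N) * N ≤ (N + 2) ^ 3 * (N + 2) :=
            Nat.mul_le_mul hm (by omega)
        _ = (N + 2) ^ 4 := by ring
        _ ≤ _ := hp 4 (by omega)
    · exact hm.trans (hp 3 (by omega))
    · have := hp 1 (by omega); rw [pow_one] at this; have := hS q; omega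

theorem encoded_of_word {c : ℕ} (y : (hbRaceProblem c).Inst) {s : Store} {A n : ℕ}
    (h : s.word A n = (hbRaceProblem c).encode y) :
    n = 3 * y.1.length ∧ Encoded (Trace.table y.1) A s := by
  have hlen : n = 3 * y.1.length := by
    have := (congrArg List.length h).trans (flatMap_triple_length y.1)
    simpa [Store.word] using this
  refine ⟨hlen, fun k hk => ?_⟩
  have hk' : k < y.1.length := hk
  have h3 := flatMap_triple y.1 hk'
  have h' : (y.1.flatMap fun e => [e.thread, e.op.code, e.op.name]) = s.word A n := h.symm
  simp only [h'] at h3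
  rwa [s.word_getD A n _ (by omega), s.word_getD A n _ (by omega),
    s.word_getD A n _ (by omega)] at h3

open Classical in
theorem simQuery_wlp {c : ℕ} (y : (hbRaceProblem c).Inst) {s : Store} {x A : ℕ} {len : Expr}
    (hA : A < b) (h : s.word A (len.eval s) = (hbRaceProblem c).encode y) :
    Wlp (simQuery b x A len) s fun s' =>
      s'.reg x = if (hbRaceProblem c).Yes y then 1 else 0 := by
  obtain ⟨h1, h2⟩ := encoded_of_word y h
  have hV := table_le y
  refine wlp_seq (wlp_assign (wlp_seq (Wlp.mono (Can.wlp (load_can (τ := Trace.table y.1) hA ?_ ?_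
    hV) (by simp [loadBody, forLoop, Cmd.Deterministic])) fun s₁ _ hs₁ =>
      (answer_wlp hs₁ hV).mono fun s₂ _ hs₂ => ?_)))
  · simpa [Encoded] using h2
  · simp [Expr.eval, BinOp.eval, h1, Trace.table]
  · rw [← not_hasHBRace_iff, not_not] at hs₂
    rcases hs₂ with ⟨h3, h4⟩ | ⟨h3, h4⟩
    · exact h4.trans (if_pos (show (hbRaceProblem c).Yes y from h3)).symm
    · exact h4.trans (if_neg (show ¬ (hbRaceProblem c).Yes y from h3)).symm

open Classical in
theorem simQuery_run {c : ℕ} (y : (hbRaceProblem c).Inst) {s : Store} {x A : ℕ} {len : Expr}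
    (hA : A < b) (h : s.word A (len.eval s) = (hbRaceProblem c).encode y) :
    ∃ s' t, Run (fun _ => False) (simQuery b x A len) s s' t [] ∧
      t ≤ len.cost s + simCost c y.1.length ∧
      s'.reg x = if (hbRaceProblem c).Yes y then 1 else 0 := by
  obtain ⟨h1, h2⟩ := encoded_of_word y h
  obtain ⟨K, m, S, hU, hK, hm0, hm⟩ := exists_setup y
  set N := y.1.length with hN
  set L := wordCost N with hL
  have hL1 : 1 ≤ L := one_le_wordCost N
  have hsize : (Trace.table y.1).size = N := rfl
  obtain ⟨s', t, hr, ht, hQ⟩ : Can ((N + 2) ^ (c + 5))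
      (forLoop (Loc.pos.addr b) (Loc.size.addr b) (loadBody b A) ;; answer b x)
      (s.setReg (Loc.size.addr b) ((Expr.op .div len (.const 3)).eval s))
      ((7 + N * 60) + (300 + m * (50 + N * 330) + N * (1030 + K * 320))) (fun s' =>
        (¬ (Trace.table y.1).RaceFree ∧ s'.reg x = 1) ∨
          ((Trace.table y.1).RaceFree ∧ s'.reg x = 0)) := by
    refine can_seq (Can.mono (load_can (τ := Trace.table y.1) hA ?_ ?_ hU.table)
      (by rw [hsize]) fun s₁ _ hs₁ => ?_)
    · simpa [Encoded] using h2
    · simp [Expr.eval, BinOp.eval, h1, Trace.table, hN]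
    · have := answer_can (x := x) hs₁ hU
      rwa [hsize] at this
  refine ⟨s', _, (Run.assign s _ _).seq hr, ?_, ?_⟩
  · have hW : wordCost ((N + 2) ^ (c + 5)) ≤ 3 * (c + 5) * L := by
      calc wordCost ((N + 2) ^ (c + 5)) ≤ (c + 5) * wordCost (N + 2) := wordCost_pow _ _ (by omega)
        _ ≤ (c + 5) * (3 * L) := Nat.mul_le_mul_left _ (wordCost_add_two N)
        _ = _ := by ring
    have hcost : (Expr.op .div len (.const 3)).cost s = len.cost s + 2 + L := by
      simp only [Expr.cost, Expr.eval, BinOp.eval, h1]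
      rw [Nat.mul_div_cancel_left _ (by norm_num)]
      rfl
    have hsteps : (7 + N * 60) + (300 + m * (50 + N * 330) + N * (1030 + K * 320)) + 4 ≤
        1000 + 3000 * ((N.sqrt + 1) * N * L) := by
      have e1 : m * (50 + N * 330) ≤ 760 * ((N.sqrt + 1) * N * L) := by
        rcases Nat.eq_zero_or_pos N with h0 | h0
        · simp [hm0 h0]
        · calc m * (50 + N * 330) ≤ (2 * ((N.sqrt + 1) * L)) * (380 * N) :=
              Nat.mul_le_mul hm (by omega)
            _ = _ := by ring
      have e2 : N * (1090 + K * 320) ≤ 1410 * ((N.sqrt + 1) * N * L) := by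
        calc N * (1090 + K * 320) ≤ N * (1410 * (N.sqrt + 1)) := Nat.mul_le_mul_left _ (by omega)
          _ ≤ N * (1410 * (N.sqrt + 1)) * L := Nat.le_mul_of_pos_right _ hL1
          _ = _ := by ring
      have e3 : N * (1090 + K * 320) = N * 60 + N * (1030 + K * 320) := by ring
      omega
    have h4 : L ≤ 3 * (c + 5) * L := Nat.le_mul_of_pos_left _ (by omega)
    rw [hcost]
    calc len.cost s + 2 + L + 1 + t
        ≤ len.cost s + 4 * (3 * (c + 5) * L) +
          ((7 + N * 60) + (300 + m * (50 + N * 330) + N * (1030 + K * 320))) *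
            (3 * (c + 5) * L) := by
          have := ht.trans (Nat.mul_le_mul_left _ hW)
          omega
      _ = len.cost s + ((7 + N * 60) + (300 + m * (50 + N * 330) + N * (1030 + K * 320)) + 4) *
            (3 * (c + 5) * L) := by ring
      _ ≤ len.cost s + simCost c N := Nat.add_le_add_left (Nat.mul_le_mul_right _ hsteps) _
  · rw [← not_hasHBRace_iff, not_not] at hQ
    rcases hQ with ⟨h3, h4⟩ | ⟨h3, h4⟩
    · exact h4.trans (if_pos (show (hbRaceProblem c).Yes y from h3)).symm
    · exact h4.trans (if_neg (show ¬ (hbRaceProblem c).Yes y from h3)).symm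

end

/-! ### Replacing the oracle -/

/-- All registers and arrays that occur in the expression are numbered below `b`. -/
def Expr.Below (b : ℕ) : Expr → Prop
  | .const _ => True
  | .reg x => x < b
  | .get A e => A < b ∧ e.Below b
  | .op _ e₁ e₂ => e₁.Below b ∧ e₂.Below b

/-- All registers and arrays that occur in the program are numbered below `b`. -/
def Cmd.Below (b : ℕ) : Cmd → Prop
  | .skip => True
  | .assign x e => x < b ∧ e.Below b
  | .store A i e => A < b ∧ i.Below b ∧ e.Below b
  | .guess x => x < b
  | .query x A len => x < b ∧ A < b ∧ len.Below b
  | .seq p q => p.Below b ∧ q.Below b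
  | .ite e p q => e.Below b ∧ p.Below b ∧ q.Below b
  | .loop e p => e.Below b ∧ p.Below b

theorem Expr.exists_below : ∀ e : Expr, ∃ b, ∀ b', b ≤ b' → e.Below b'
  | .const _ => ⟨0, fun _ _ => trivial⟩
  | .reg x => ⟨x + 1, fun _ h => h⟩
  | .get A e => by
    obtain ⟨b, hb⟩ := e.exists_below
    exact ⟨A + 1 + b, fun b' h => ⟨by omega, hb b' (by omega)⟩⟩
  | .op _ e₁ e₂ => by
    obtain ⟨b₁, h₁⟩ := e₁.exists_below
    obtain ⟨b₂, h₂⟩ := e₂.exists_below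
    exact ⟨b₁ + b₂, fun b' h => ⟨h₁ b' (by omega), h₂ b' (by omega)⟩⟩

theorem Cmd.exists_below : ∀ p : Cmd, ∃ b, ∀ b', b ≤ b' → p.Below b'
  | .skip => ⟨0, fun _ _ => trivial⟩
  | .assign x e => by
    obtain ⟨b, hb⟩ := e.exists_below
    exact ⟨x + 1 + b, fun b' h => ⟨by omega, hb b' (by omega)⟩⟩
  | .store A i e => by
    obtain ⟨b₁, h₁⟩ := i.exists_below
    obtain ⟨b₂, h₂⟩ := e.exists_below
    exact ⟨A + 1 + b₁ + b₂, fun b' h => ⟨by omega, h₁ b' (by omega), h₂ b' (by omega)⟩⟩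
  | .guess x => ⟨x + 1, fun _ h => h⟩
  | .query x A e => by
    obtain ⟨b, hb⟩ := e.exists_below
    exact ⟨x + 1 + A + 1 + b, fun b' h => ⟨by omega, by omega, hb b' (by omega)⟩⟩
  | .seq p q => by
    obtain ⟨b₁, h₁⟩ := p.exists_below
    obtain ⟨b₂, h₂⟩ := q.exists_below
    exact ⟨b₁ + b₂, fun b' h => ⟨h₁ b' (by omega), h₂ b' (by omega)⟩⟩
  | .ite e p q => by
    obtain ⟨b, hb⟩ := e.exists_below
    obtain ⟨b₁, h₁⟩ := p.exists_below
    obtain ⟨b₂, h₂⟩ := q.exists_below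
    exact ⟨b + b₁ + b₂, fun b' h => ⟨hb b' (by omega), h₁ b' (by omega), h₂ b' (by omega)⟩⟩
  | .loop e p => by
    obtain ⟨b, hb⟩ := e.exists_below
    obtain ⟨b₁, h₁⟩ := p.exists_below
    exact ⟨b + b₁, fun b' h => ⟨hb b' (by omega), h₁ b' (by omega)⟩⟩

/-- The stores agree on the registers and arrays below `b`. -/
def Agree (b : ℕ) (s s' : Store) : Prop :=
  (∀ y < b, s'.reg y = s.reg y) ∧ ∀ B < b, s'.mem B = s.mem B

theorem Agree.eval {b : ℕ} {s s' : Store} (h : Agree b s s') :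
    ∀ {e : Expr}, e.Below b → e.eval s' = e.eval s
  | .const _, _ => rfl
  | .reg x, he => h.1 x he
  | .get A e, he => by simp only [Expr.eval, h.eval he.2, h.2 A he.1]
  | .op o e₁ e₂, he => by simp only [Expr.eval, h.eval he.1, h.eval he.2]

theorem Agree.cost {b : ℕ} {s s' : Store} (h : Agree b s s') :
    ∀ {e : Expr}, e.Below b → e.cost s' = e.cost s
  | .const _, _ => rfl
  | .reg x, he => by simp only [Expr.cost, h.1 x he]
  | .get A e, he => by simp only [Expr.cost, h.eval he.2, h.2 A he.1, h.cost he.2]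
  | .op o e₁ e₂, he => by
    simp only [Expr.cost, h.eval he.1, h.eval he.2, h.cost he.1, h.cost he.2]

theorem Agree.setReg {b : ℕ} {s s' : Store} (h : Agree b s s') (x v : ℕ) :
    Agree b (s.setReg x v) (s'.setReg x v) := by
  refine ⟨fun y hy => ?_, h.2⟩
  simp only [Store.setReg_reg, h.1 y hy]

theorem Agree.setMem {b : ℕ} {s s' : Store} (h : Agree b s s') (A i v : ℕ) :
    Agree b (s.setMem A i v) (s'.setMem A i v) := by
  refine ⟨h.1, fun B hB => ?_⟩
  funext j
  simp only [Store.setMem_mem, h.2 B hB]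

theorem Agree.word {b : ℕ} {s s' : Store} (h : Agree b s s') {A : ℕ} (hA : A < b) (n : ℕ) :
    s'.word A n = s.word A n := by
  simp only [Store.word, h.2 A hA]

theorem simQuery_agree {b x A : ℕ} {len : Expr} {s s₁ s₂ : Store} (h : Agree b s s₁)
    (hf : Frame (simQuery b x A len) s₁ s₂) {v : ℕ} (hx : s₂.reg x = v) :
    Agree b (s.setReg x v) s₂ := by
  refine ⟨fun y hy => ?_, fun B hB => ?_⟩
  · have hne := Loc.lt_ne hy
    rw [Store.setReg_reg]
    split
    · rename_i hyx
      rw [hyx, hx]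
    · rename_i hyx
      rw [hf.1 y, h.1 y hy]
      simp [simQuery, loadBody, answer, findRace, certify, buildTable, initNext, visit, checkLast,
        visitWrite, visitRead, check, sweep, clearMarks, sweepStep, forLoop, assertZero,
        Cmd.WritesReg, hne, Ne.symm hyx]
  · have hne := Arr.lt_ne hB
    rw [hf.2 B, h.2 B hB, Store.setReg_mem]
    simp [simQuery, loadBody, answer, findRace, certify, buildTable, initNext, visit, checkLast,
      visitWrite, visitRead, check, sweep, clearMarks, sweepStep, forLoop, assertZero,
      Cmd.WritesMem, hne]

/-- Replaces each oracle query by a guessed and verified answer. -/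
def Cmd.unquery (b : ℕ) : Cmd → Cmd
  | .query x A len => simQuery b x A len
  | .seq p q => .seq (p.unquery b) (q.unquery b)
  | .ite e p q => .ite e (p.unquery b) (q.unquery b)
  | .loop e p => .loop e (p.unquery b)
  | p => p

theorem Cmd.unquery_oracleFree (b : ℕ) : ∀ p : Cmd, (p.unquery b).OracleFree
  | .skip => trivial
  | .assign _ _ => trivial
  | .store _ _ _ => trivial
  | .guess _ => trivial
  | .query x A len => by
    simp [Cmd.unquery, simQuery, loadBody, answer, findRace, certify, buildTable, initNext, visit,
      checkLast, visitWrite, visitRead, check, sweep, clearMarks, sweepStep, forLoop, assertZero,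
      Cmd.OracleFree]
  | .seq p q => ⟨p.unquery_oracleFree b, q.unquery_oracleFree b⟩
  | .ite _ p q => ⟨p.unquery_oracleFree b, q.unquery_oracleFree b⟩
  | .loop _ p => p.unquery_oracleFree b

/-- The encoding is injective, so the oracle answers about the instance that was asked. -/
theorem oracle_encode {c : ℕ} (y : (hbRaceProblem c).Inst) :
    (hbRaceProblem c).oracle ((hbRaceProblem c).encode y) ↔ (hbRaceProblem c).Yes y := by
  constructor
  · rintro ⟨y', h, hy⟩
    obtain rfl : y' = y := Subtype.ext (flatMap_triple_injective h)
    exact hy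
  · exact fun h => ⟨y, rfl, h⟩

/-- A run that asks only about proper instances can be imitated; each query costs `simCost`. -/
theorem Run.unquery {b c : ℕ} {p : Cmd} {s s' : Store} {t : ℕ} {qs : List (List ℕ)}
    (hr : Run (hbRaceProblem c).oracle p s s' t qs) (hb : p.Below b) {s₁ : Store}
    (hs : Agree b s s₁) (ys : List (hbRaceProblem c).Inst)
    (hy : qs = ys.map (hbRaceProblem c).encode) :
    ∃ s₁' t₁, Run (fun _ => False) (p.unquery b) s₁ s₁' t₁ [] ∧ Agree b s' s₁' ∧
      t₁ ≤ t + (ys.map fun y => simCost c y.1.length).sum := by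
  induction hr generalizing s₁ ys with
  | skip s => exact ⟨_, _, .skip _, hs, by omega⟩
  | assign s x e =>
    refine ⟨_, _, .assign _ x e, ?_, ?_⟩
    · rw [hs.eval hb.2]; exact hs.setReg _ _
    · rw [hs.cost hb.2]; omega
  | store s A i e =>
    refine ⟨_, _, .store _ A i e, ?_, ?_⟩
    · rw [hs.eval hb.2.1, hs.eval hb.2.2]; exact hs.setMem _ _ _
    · rw [hs.cost hb.2.1, hs.cost hb.2.2]; omega
  | guess s x v => exact ⟨_, _, .guess _ x v, hs.setReg _ _, by omega⟩
  | query_yes s x A len hO =>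
    obtain ⟨y, rfl, he⟩ := List.map_eq_singleton_iff.1 hy.symm
    rw [← he, oracle_encode] at hO
    obtain ⟨s₁', t₁, h1, h2, h3⟩ := simQuery_run (b := b) (x := x) y (s := s₁) hb.2.1
      (by rw [hs.word hb.2.1, hs.eval hb.2.2, ← he])
    rw [if_pos hO] at h3
    refine ⟨s₁', t₁, h1, simQuery_agree hs h1.frame h3, ?_⟩
    rw [hs.cost hb.2.2] at h2
    simp only [List.map_cons, List.map_nil, List.sum_cons, List.sum_nil]
    omega
  | query_no s x A len hO =>
    obtain ⟨y, rfl, he⟩ := List.map_eq_singleton_iff.1 hy.symm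
    rw [← he, oracle_encode] at hO
    obtain ⟨s₁', t₁, h1, h2, h3⟩ := simQuery_run (b := b) (x := x) y (s := s₁) hb.2.1
      (by rw [hs.word hb.2.1, hs.eval hb.2.2, ← he])
    rw [if_neg hO] at h3
    refine ⟨s₁', t₁, h1, simQuery_agree hs h1.frame h3, ?_⟩
    rw [hs.cost hb.2.2] at h2
    simp only [List.map_cons, List.map_nil, List.sum_cons, List.sum_nil]
    omega
  | seq _ _ ih1 ih2 =>
    obtain ⟨ys1, ys2, rfl, e1, e2⟩ := List.append_eq_map_iff.1 hy
    obtain ⟨s₂, t₂, r1, a1, c1⟩ := ih1 hb.1 hs ys1 e1.symm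
    obtain ⟨s₃, t₃, r2, a2, c2⟩ := ih2 hb.2 a1 ys2 e2.symm
    refine ⟨s₃, t₂ + t₃, by simpa [Cmd.unquery] using r1.seq r2, a2, ?_⟩
    rw [List.map_append, List.sum_append]
    omega
  | ite_true he _ ih =>
    obtain ⟨s₂, t₂, r1, a1, c1⟩ := ih hb.2.1 hs ys hy
    refine ⟨s₂, _, .ite_true (by rwa [hs.eval hb.1]) r1, a1, ?_⟩
    rw [hs.cost hb.1]; omega
  | ite_false he _ ih =>
    obtain ⟨s₂, t₂, r1, a1, c1⟩ := ih hb.2.2 hs ys hy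
    refine ⟨s₂, _, .ite_false (by rwa [hs.eval hb.1]) r1, a1, ?_⟩
    rw [hs.cost hb.1]; omega
  | @loop_true e p _ _ _ _ _ _ _ he _ _ ih1 ih2 =>
    obtain ⟨ys1, ys2, rfl, e1, e2⟩ := List.append_eq_map_iff.1 hy
    obtain ⟨s₂, t₂, r1, a1, c1⟩ := ih1 hb.2 hs ys1 e1.symm
    obtain ⟨s₃, t₃, r2, a2, c2⟩ := ih2 hb a1 ys2 e2.symm
    have := Run.loop_true (e := e) (s := s₁) (by rwa [hs.eval hb.1]) r1 r2
    refine ⟨s₃, _, by simpa [Cmd.unquery] using this, a2, ?_⟩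
    rw [hs.cost hb.1, List.map_append, List.sum_append]
    omega
  | @loop_false e p s he =>
    refine ⟨s₁, _, .loop_false (by rwa [hs.eval hb.1]), hs, ?_⟩
    rw [hs.cost hb.1]; omega

/-- All terminating runs of the translated program imitate the run of the deterministic oracle
program, since wrong guesses of answers do not lead to terminating runs. -/
theorem Run.unquery_sound {b c : ℕ} {p : Cmd} {s s' : Store} {t : ℕ} {qs : List (List ℕ)}
    (hr : Run (hbRaceProblem c).oracle p s s' t qs) (hb : p.Below b) (hd : p.Deterministic)
    (hq : ∀ w ∈ qs, ∃ y, (hbRaceProblem c).encode y = w) {s₁ : Store} (hs : Agree b s s₁)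
    {s₁' : Store} {t₁ : ℕ} {qs₁ : List (List ℕ)}
    (hr₁ : Run (fun _ => False) (p.unquery b) s₁ s₁' t₁ qs₁) : Agree b s' s₁' := by
  induction hr generalizing s₁ s₁' t₁ qs₁ with
  | skip s => cases hr₁; exact hs
  | assign s x e => cases hr₁; rw [hs.eval hb.2]; exact hs.setReg _ _
  | store s A i e =>
    cases hr₁; rw [hs.eval hb.2.1, hs.eval hb.2.2]; exact hs.setMem _ _ _
  | guess s x v => exact hd.elim
  | query_yes s x A len hO =>
    obtain ⟨y, he⟩ := hq _ (List.mem_singleton_self _)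
    rw [← he, oracle_encode] at hO
    have h3 := simQuery_wlp (b := b) (x := x) y (s := s₁) hb.2.1
      (by rw [hs.word hb.2.1, hs.eval hb.2.2, ← he]) _ _ _ hr₁
    rw [if_pos hO] at h3
    exact simQuery_agree hs hr₁.frame h3
  | query_no s x A len hO =>
    obtain ⟨y, he⟩ := hq _ (List.mem_singleton_self _)
    rw [← he, oracle_encode] at hO
    have h3 := simQuery_wlp (b := b) (x := x) y (s := s₁) hb.2.1
      (by rw [hs.word hb.2.1, hs.eval hb.2.2, ← he]) _ _ _ hr₁
    rw [if_neg hO] at h3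
    exact simQuery_agree hs hr₁.frame h3
  | seq _ _ ih1 ih2 =>
    cases hr₁ with
    | seq r1 r2 =>
      exact ih2 hb.2 hd.2 (fun w hw => hq w (List.mem_append_right _ hw))
        (ih1 hb.1 hd.1 (fun w hw => hq w (List.mem_append_left _ hw)) hs r1) r2
  | ite_true he _ ih =>
    cases hr₁ with
    | ite_true _ r => exact ih hb.2.1 hd.1 hq hs r
    | ite_false h0 _ => rw [hs.eval hb.1] at h0; contradiction
  | ite_false he _ ih =>
    cases hr₁ with
    | ite_true h0 _ => rw [hs.eval hb.1] at h0; contradiction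
    | ite_false _ r => exact ih hb.2.2 hd.2 hq hs r
  | loop_true he _ _ ih1 ih2 =>
    cases hr₁ with
    | loop_true _ r1 r2 =>
      exact ih2 hb hd (fun w hw => hq w (List.mem_append_right _ hw))
        (ih1 hb.2 hd (fun w hw => hq w (List.mem_append_left _ hw)) hs r1) r2
    | loop_false h0 => rw [hs.eval hb.1] at h0; contradiction
  | loop_false he =>
    cases hr₁ with
    | loop_true h0 _ _ => rw [hs.eval hb.1] at h0; contradiction
    | loop_false _ => exact hs

theorem Run.length_queries_le {O : List ℕ → Prop} {p : Cmd} {s s' : Store} {t : ℕ}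
    {qs : List (List ℕ)} (hr : Run O p s s' t qs) : qs.length ≤ t ∧ 1 ≤ t := by
  induction hr <;> (try simp only [List.length_nil, List.length_cons, List.length_append]) <;> omega



/-! ### Satisfiability and tautologies -/

/-- The same formula read as a disjunction of terms is a tautology exactly if it is unsatisfiable as
a conjunction of clauses: exchange `v` with its negation. -/
theorem kTAUT_yes_iff {k : ℕ} (φ : KFormula k) : (kTAUT k).Yes φ ↔ ¬ (kSAT k).Yes φ := by
  change (∀ v : Fin φ.n → Bool, ∃ c ∈ φ.parts, ∀ l ∈ c, v l.1 = l.2) ↔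
    ¬ ∃ v : Fin φ.n → Bool, ∀ c ∈ φ.parts, ∃ l ∈ c, v l.1 = l.2
  push Not
  constructor
  · intro h v
    obtain ⟨c, hc, hl⟩ := h fun i => !v i
    exact ⟨c, hc, fun l hlc => by have := hl l hlc; cases h1 : v l.1 <;> simp_all⟩
  · intro h v
    obtain ⟨c, hc, hl⟩ := h fun i => !v i
    refine ⟨c, hc, fun l hlc => ?_⟩
    have := hl l hlc
    cases h1 : v l.1 <;> cases h2 : l.2 <;> simp_all

/-! ### The final count -/

theorem wordCost_le_rpow {θ : ℝ} (hθ : 0 < θ) :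
    ∃ A : ℝ, 1 ≤ A ∧ ∀ N : ℕ, 1 ≤ N → (wordCost N : ℝ) ≤ A * (N : ℝ) ^ θ := by
  have hl : 0 < Real.log 2 := Real.log_pos (by norm_num)
  refine ⟨1 / (θ * Real.log 2) + 1, by have : 0 < 1 / (θ * Real.log 2) := by positivity
                                       linarith, fun N hN => ?_⟩
  have hN' : (1 : ℝ) ≤ N := by exact_mod_cast hN
  have h1 : (1 : ℝ) ≤ (N : ℝ) ^ θ := Real.one_le_rpow hN' hθ.le
  have h2 : (Nat.log 2 N : ℝ) ≤ Real.log N / Real.log 2 := by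
    rw [le_div_iff₀ hl, ← Real.log_pow]
    refine Real.log_le_log (by positivity) ?_
    exact_mod_cast Nat.pow_log_le_self 2 (by omega)
  have h3 : Real.log N / Real.log 2 ≤ 1 / (θ * Real.log 2) * (N : ℝ) ^ θ := by
    have := Real.log_le_rpow_div (x := N) (by linarith) hθ
    calc Real.log N / Real.log 2 ≤ ((N : ℝ) ^ θ / θ) / Real.log 2 := by gcongr
      _ = _ := by field_simp
  simp only [wordCost, Nat.cast_add, Nat.cast_one]
  linarith

theorem simCost_le (c : ℕ) {η : ℝ} (hη : 0 < η) :
    ∃ D : ℝ, 0 ≤ D ∧ ∀ N : ℕ, (simCost c N : ℝ) ≤ D * (1 + (N : ℝ) ^ (3 / 2 + η)) := by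
  obtain ⟨A, hA, hw⟩ := wordCost_le_rpow (half_pos hη)
  set E : ℝ := 3 * (c + 5) with hE
  have hE0 : 0 ≤ E := by positivity
  refine ⟨1000 * E + 7000 * E * A ^ 2, by positivity, fun N => ?_⟩
  rcases Nat.eq_zero_or_pos N with rfl | hN
  · have h0 : (simCost c 0 : ℝ) = 1000 * E := by
      simp [simCost, wordCost, hE]
    rw [h0, Nat.cast_zero, Real.zero_rpow (by positivity), add_zero, mul_one]
    have : 0 ≤ 7000 * E * A ^ 2 := by positivity
    linarith
  have hN1 : (1 : ℝ) ≤ N := by exact_mod_cast hN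
  have hN0 : (0 : ℝ) < N := by linarith
  have hL := hw N hN
  set L : ℝ := (wordCost N : ℝ) with hLdef
  have hL1 : (1 : ℝ) ≤ L := by rw [hLdef]; exact_mod_cast one_le_wordCost N
  have hs : ((N.sqrt : ℕ) : ℝ) + 1 ≤ 2 * (N : ℝ) ^ (1 / 2 : ℝ) := by
    have h1 : ((N.sqrt : ℕ) : ℝ) ≤ (N : ℝ) ^ (1 / 2 : ℝ) := by
      rw [← Real.sqrt_eq_rpow]; exact Real.nat_sqrt_le_real_sqrt
    have h2 : (1 : ℝ) ≤ (N : ℝ) ^ (1 / 2 : ℝ) := Real.one_le_rpow hN1 (by norm_num)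
    linarith
  set P : ℝ := (N : ℝ) ^ (3 / 2 : ℝ) with hP
  have hP1 : 1 ≤ P := Real.one_le_rpow hN1 (by norm_num)
  have hKN : (((N.sqrt : ℕ) : ℝ) + 1) * N ≤ 2 * P := by
    calc (((N.sqrt : ℕ) : ℝ) + 1) * N ≤ 2 * (N : ℝ) ^ (1 / 2 : ℝ) * N :=
          mul_le_mul_of_nonneg_right hs hN0.le
      _ = 2 * ((N : ℝ) ^ (1 / 2 : ℝ) * (N : ℝ) ^ (1 : ℝ)) := by rw [Real.rpow_one]; ring
      _ = 2 * P := by rw [← Real.rpow_add hN0, hP]; norm_num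
  have hLL : L * L ≤ A ^ 2 * (N : ℝ) ^ η := by
    calc L * L ≤ (A * (N : ℝ) ^ (η / 2)) * (A * (N : ℝ) ^ (η / 2)) :=
          mul_le_mul hL hL (by linarith) (by positivity)
      _ = A ^ 2 * ((N : ℝ) ^ (η / 2) * (N : ℝ) ^ (η / 2)) := by ring
      _ = _ := by rw [← Real.rpow_add hN0, add_halves]
  have hcast : (simCost c N : ℝ) =
      (1000 + 3000 * ((((N.sqrt : ℕ) : ℝ) + 1) * N * L)) * (E * L) := by
    simp only [simCost, hE, hLdef]; push_cast; ring
  have hPL : 1 ≤ P * L := by nlinarith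
  calc (simCost c N : ℝ) = (1000 + 3000 * ((((N.sqrt : ℕ) : ℝ) + 1) * N * L)) * (E * L) := hcast
    _ ≤ (1000 * (P * L) + 3000 * ((2 * P) * L)) * (E * L) := by
        refine mul_le_mul_of_nonneg_right ?_ (by positivity)
        have := mul_le_mul_of_nonneg_right hKN (by linarith : 0 ≤ L)
        linarith
    _ = 7000 * E * P * (L * L) := by ring
    _ ≤ 7000 * E * P * (A ^ 2 * (N : ℝ) ^ η) := mul_le_mul_of_nonneg_left hLL (by positivity)
    _ = 7000 * E * A ^ 2 * (N : ℝ) ^ (3 / 2 + η) := by rw [Real.rpow_add hN0, hP]; ring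
    _ ≤ _ := by
        have h1 : 0 ≤ (N : ℝ) ^ (3 / 2 + η) := by positivity
        have h2 : 0 ≤ 1000 * E * (N : ℝ) ^ (3 / 2 + η) := by positivity
        have h3 : 0 ≤ 7000 * E * A ^ 2 := by positivity
        nlinarith

/-- An oracle reduction from `k`-SAT to race detection becomes a nondeterministic algorithm for
`k`-TAUT when all answers are guessed and verified, and the final answer is reversed. -/
theorem nTime_kTAUT_of_reduction {k c : ℕ} {R : Cmd} {C D : ℝ} {f g : ℕ → ℝ} (hD : 0 ≤ D)
    (hf : ∀ N, (simCost c N : ℝ) ≤ D * (1 + f N))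
    (h : TuringReduction (kSAT k) (hbRaceProblem c) R C f g) : NTime (kTAUT k) g := by
  obtain ⟨hdet, hred⟩ := h
  obtain ⟨b₀, hb₀⟩ := R.exists_below
  have hb : R.Below (b₀ + 1) := hb₀ _ (by omega)
  have hb1 : 0 < b₀ + 1 := by omega
  generalize b₀ + 1 = b at hb hb1
  refine ⟨R.unquery b ;; .ite (.reg 0) (.assign 0 (.const 0)) (.assign 0 (.const 1)),
    ⟨R.unquery_oracleFree b, trivial, trivial⟩, C * (6 + 2 * D), fun φ => ⟨fun hyes => ?_,
      fun hno => ?_⟩⟩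
  · obtain ⟨s, t, ys, hrun, hacc, ht, hsum⟩ := hred φ
    have h0 : s.reg 0 = 0 := by
      by_contra hne
      exact (kTAUT_yes_iff φ).1 hyes (hacc.1 hne)
    obtain ⟨s₁, t₁, hrun₁, hagree, ht₁⟩ := hrun.unquery hb
      (s₁ := initStore ((kTAUT k).encode φ)) ⟨fun _ _ => rfl, fun _ _ => rfl⟩ ys rfl
    have h0' : s₁.reg 0 = 0 := (hagree.1 0 hb1).trans h0
    refine ⟨_, _, _, hrun₁.seq (.ite_false h0' (.assign _ _ _)), ?_, ?_⟩
    · simp [Store.Accepting, Expr.eval]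
    · have hq := hrun.length_queries_le
      rw [List.length_map] at hq
      have hcost : (Expr.reg 0).cost s₁ + 1 + ((Expr.const 1).cost s₁ + 1) = 4 := by
        simp [Expr.cost, h0', wordCost]
      rw [hcost]
      have hs : (((ys.map fun y => simCost c y.1.length).sum : ℕ) : ℝ) ≤
          D * (ys.length + (ys.map fun y => f ((hbRaceProblem c).size y)).sum) := by
        clear * - hf
        induction ys with
        | nil => simp
        | cons y ys ih =>
          have := hf y.1.length
          simp only [List.map_cons, List.sum_cons, List.length_cons, Nat.cast_add, Nat.cast_one]
            at ih ⊢
          have e : f ((hbRaceProblem c).size y) = f y.1.length := rfl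
          rw [e]
          nlinarith
      have hq1 : (ys.length : ℝ) ≤ t := by exact_mod_cast hq.1
      have hq2 : (1 : ℝ) ≤ t := by exact_mod_cast hq.2
      have ht₁' : (t₁ : ℝ) ≤ t + ((ys.map fun y => simCost c y.1.length).sum : ℕ) := by
        exact_mod_cast ht₁
      have hs' : (((ys.map fun y => simCost c y.1.length).sum : ℕ) : ℝ) ≤
          D * (C * g φ.n + C * g φ.n) :=
        hs.trans (mul_le_mul_of_nonneg_left (add_le_add (hq1.trans ht) hsum) hD)
      have ht' : (t : ℝ) ≤ C * g φ.n := ht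
      change ((t₁ + 4 : ℕ) : ℝ) ≤ C * (6 + 2 * D) * g φ.n
      push_cast
      nlinarith
  · rintro ⟨s₂, t₂, qs₂, hrun₂, hacc₂⟩
    obtain ⟨s, t, ys, hrun, hacc, -, -⟩ := hred φ
    have h0 : s.reg 0 ≠ 0 := hacc.2 (not_not.1 fun h => hno ((kTAUT_yes_iff φ).2 h))
    cases hrun₂ with
    | seq h1 h2 =>
      have hagree := hrun.unquery_sound hb hdet (fun w hw => by
        obtain ⟨y, -, hy⟩ := List.mem_map.1 hw
        exact ⟨y, hy⟩) ⟨fun _ _ => rfl, fun _ _ => rfl⟩ h1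
      have h0' := h0
      rw [← hagree.1 0 hb1] at h0'
      cases h2 with
      | ite_true _ h3 =>
        cases h3
        simp [Store.Accepting, Expr.eval] at hacc₂
      | ite_false h3 _ => exact h0' h3

end FGC

theorem mainTheorem7 (ε : ℝ) (hε : 0 < ε) (c : ℕ) (hNSETH : FGC.NSETH) :
    ¬ FGC.FineGrainedReduces FGC.kSAT (fun n => (2 : ℝ) ^ n)
      (FGC.hbRaceProblem c) (fun N => (N : ℝ) ^ (3 / 2 + ε)) := by
  intro hred
  -- chosen so that `(3 / 2 + ε) * (1 - ε') = 3 / 2 + ε / 2`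
  obtain ⟨δ, hδ, hred⟩ := hred (ε / 2 / (3 / 2 + ε)) (by positivity)
  obtain ⟨k, hk⟩ := hNSETH δ hδ
  obtain ⟨R, C, hR⟩ := hred k
  obtain ⟨D, hD, hsim⟩ := FGC.simCost_le c (half_pos hε)
  refine hk ?_
  have hg : (fun n : ℕ => (2 : ℝ) ^ ((n : ℝ) * (1 - δ))) =
      fun n : ℕ => ((2 : ℝ) ^ n) ^ (1 - δ) := by
    funext n
    rw [Real.rpow_mul (by norm_num), Real.rpow_natCast]
  rw [hg]
  refine FGC.nTime_kTAUT_of_reduction hD (fun N => ?_) hR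
  have he : (3 / 2 + ε) * (1 - ε / 2 / (3 / 2 + ε)) = 3 / 2 + ε / 2 := by
    field_simp
    ring
  rw [← Real.rpow_mul (Nat.cast_nonneg N), he]
  exact hsim N
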